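/- Notation. Let $\phi,\Phi$ be the standard normal density and distribution function and $N(\mu,v)$ the normal law with mean $\mu$ and variance $v$. Let $(b_i),(h_i),(\sigma_{p,i}),(\sigma_{f,i})$, $i\ge 1$, be sequences of positive reals, $\tilde b_i=b_i/(b_i+h_i)$, and let $(\theta_i)$ be a real sequence. For each $n$ let $X=(X_1,\dots,X_n)$ have independent coordinates $X_i\sim N(\theta_i,\sigma_{p,i})$. For $q\in\mathbb R^n$ put $$L_n(\theta,q)=\frac1n\sum_{i=1}^n \mathbb E_{Y\sim N(\theta_i,\sigma_{f,i})}\big[b_i(Y-q_i)^++h_i(q_i-Y)^+\big],$$ and for a prediction rule $\hat q=\hat q(X)$ put $R_n(\theta,\hat q)=\mathbb E[L_n(\theta,\hat q(X))]$. For $\eta\in\mathbb R$, $\tau\in[0,\infty]$ let $\alpha_i(\tau)=\tau/(\tau+\sigma_{p,i})$ (with $\alpha_i(\infty)=1$) and $$\hat q_i(\eta,\tau)=\alpha_i(\tau)X_i+(1-\alpha_i(\tau))\eta+\sqrt{\sigma_{f,i}+\alpha_i(\tau)\sigma_{p,i}}\;\Phi^{-1}(\tilde b_i).$$ Assumptions.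 (A1) $0<\inf_i\tilde b_i\le\sup_i\tilde b_i<1$ and $\sup_i(b_i+h_i)<\infty$. (A2) $\limsup_n \frac1n\sum_{i\le n}|\theta_i|<\infty$. (A3) $\sup_i\sigma_{p,i}/\sigma_{f,i}<1/(4e)$, $\sup_i\sigma_{f,i}<\infty$, $\inf_i\sigma_{p,i}>0$. Risk estimate. Let $G(w,\beta)=\phi(w)+w\Phi(w)-\beta w$, and let $H_k$ be the probabilists' Hermite polynomials. Fix constants $\gamma_i$ with $\inf_i\gamma_i>0$ and $\gamma_i<1/\sqrt{4e}-\sqrt{\sigma_{p,i}/\sigma_{f,i}}$, and put $\lambda_n(i)=\gamma_i\sqrt{2\log n}$, $K_n(i)=1+\big\lceil e^2(\gamma_i+\sqrt{2\sigma_{p,i}/\sigma_{f,i}})^2\,2\log n\big\rceil$. With $\alpha_i=\alpha_i(\tau)$ let $$c_i(\tau)=\sqrt{\frac{\sigma_{f,i}+\alpha_i\sigma_{p,i}}{\sigma_{f,i}+\alpha_i^2\sigma_{p,i}}}\,\Phi^{-1}(\tilde b_i),\qquad d_i(\tau)=-\frac{1-\alpha_i}{\sqrt{\sigma_{f,i}+\sigma_{p,i}\alpha_i^2}},\qquad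 s_i(\tau)=\sqrt{2\sigma_{p,i}d_i(\tau)^2},$$ $$S_i(u)=G(0,\tilde b_i)+\partial_wG(0,\tilde b_i)\,u+\phi(0)\sum_{k=0}^{K_n(i)-2}\frac{(-1)^kH_k(0)}{(k+2)!}\,s_i(\tau)^{k+2}H_{k+2}\!\Big(\frac{u}{s_i(\tau)}\Big)$$ (for $s_i(\tau)=0$ the product $s^{m}H_m(u/s)$ is read as its limit $u^{m}$), and $\tilde S_i=\max(-n,\min(n,S_i))$. For real $x,z$ let $U=c_i(\tau)+d_i(\tau)(x+\sqrt{\sigma_{p,i}}z)$, $V=c_i(\tau)+d_i(\tau)(x-\sqrt{\sigma_{p,i}}z)$, and let $\hat T_i(x,z,\tau)$ be $-\tilde b_iU$ if $V<-\lambda_n(i)$, $\tilde S_i(U)$ if $|V|\le\lambda_n(i)$, and $(1-\tilde b_i)U$ if $V>\lambda_n(i)$. Let $\hat T_i(x,\tau)=\mathbb E_{Z\sim N(0,1)}[\hat T_i(x,Z,\tau)]$ and $$\widehat{\mathrm{ARE}}{}^D_n(\eta,\tau)=\frac1n\sum_{i=1}^n(b_i+h_i)\sqrt{\sigma_{f,i}+\sigma_{p,i}\alpha_i(\tau)^2}\;\hat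 T_i(X_i-\eta,\tau).$$ Range and grids. Let $a_n=\log\log n$ and $\hat M_n=[\hat m_n(\alpha_1),\hat m_n(\alpha_2)]$, where $\hat m_n(\alpha)$ is the $\alpha$-th empirical quantile of $X_1,\dots,X_n$ and $\alpha_1,\alpha_2$ are the minimum and maximum of $\tilde b_1,\dots,\tilde b_n$. Let $C_1,\dots,C_4$ be constants with $b_i+h_i\le C_1$, $\max(\sigma_{p,i},\sigma_{p,i}^{-1})\le C_2$ for all $i$, $\sup_i(\sigma_{p,i}/\sigma_{f,i})\,\sup_i|\Phi^{-1}(\tilde b_i)|\le C_3$, and $\frac1n\sum_{i\le n}|\theta_i|\le C_4\sqrt{a_n}$ for all large $n$. Put $\delta_{n,1}=(2C_1a_n)^{-1}$ and $\delta_{n,2}=\{2C_1C_2(2\phi(0)+C_3+\sqrt{a_n}\,C_4+a_n+a_n^2)\}^{-1}$. Let $\Lambda_{n,1}=\{-a_n+k\delta_{n,1}:k=0,1,2,\dots\}\cap[-a_n,a_n]$, and let $\Lambda_{n,2}$ be the set of $\tau$ with $\tau/(\tau+1)=j\delta_{n,2}$ for some $j\in\{0,\dots,\lceil1/\delta_{n,2}\rceil-1\}$.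 The candidate locations are $\Lambda_{n,1}\cap\hat M_n$ or, when this set is empty, the points of $\Lambda_{n,1}$ at minimal distance from $\hat M_n$. For all large $n$, let $(\hat\eta^D_n,\hat\tau^D_n)$ be any measurable (in $X$) choice of a minimizer of $\widehat{\mathrm{ARE}}{}^D_n$ over (candidate locations)$\times\Lambda_{n,2}$, and let $(\eta^{\mathsf{DOR}}_n,\tau^{\mathsf{DOR}}_n)$ be any minimizer of $L_n(\theta,\hat q(\eta,\tau))$ over $\eta\in\hat M_n$, $\tau\in[0,\infty]$. Theorem. Under A1, A2 and A3, for all large $n$ the losses $L_n(\theta,\hat q(\hat\eta^D_n,\hat\tau^D_n))$ and $L_n(\theta,\hat q(\eta^{\mathsf{DOR}}_n,\tau^{\mathsf{DOR}}_n))$ are integrable, and $$\lim_{n\to\infty}\Big\{R_n\big(\theta,\hat q(\hat\eta^D_n,\hat\tau^D_n)\big)-\mathbb E\big[L_n\big(\theta,\hat q(\eta^{\mathsf{DOR}}_n,\tau^{\mathsf{DOR}}_n)\big)\big]\Big\}=0.$$ -/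

import Mathlib

open MeasureTheory ProbabilityTheory Filter Topology
open scoped ENNReal

noncomputable section

/-- Standard normal density. -/
def stdNormalPDF (w : ℝ) : ℝ := gaussianPDFReal 0 1 w

/-- Standard normal distribution function. -/
def stdNormalCDF (w : ℝ) : ℝ := cdf (gaussianReal 0 1) w

/-- Standard normal quantile function, the inverse of `stdNormalCDF` on the open unit interval. -/
def stdNormalQuantile (p : ℝ) : ℝ := sInf {w : ℝ | p ≤ stdNormalCDF w}

/-- `G(w, β) = φ(w) + w Φ(w) - β w`. -/
def lossG (w β : ℝ) : ℝ := stdNormalPDF w + w * stdNormalCDF w - β * w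

/-- Homogenized probabilists' Hermite polynomial: the polynomial in `(s, u)` that equals
`s ^ k * H_k (u / s)` for `s ≠ 0`. -/
def scaledHermite (k : ℕ) (s u : ℝ) : ℝ :=
  ∑ j ∈ Finset.range (k + 1), ((Polynomial.hermite k).coeff j : ℝ) * u ^ j * s ^ (k - j)

theorem scaledHermite_eq (k : ℕ) {s : ℝ} (hs : s ≠ 0) (u : ℝ) :
    scaledHermite k s u = s ^ k * Polynomial.aeval (u / s) (Polynomial.hermite k) := by
  rw [Polynomial.aeval_eq_sum_range, Polynomial.natDegree_hermite, Finset.mul_sum, scaledHermite]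
  refine Finset.sum_congr rfl fun j hj => ?_
  have hjk : j ≤ k := Nat.lt_succ_iff.mp (Finset.mem_range.mp hj)
  have h : s ^ k = s ^ (k - j) * s ^ j := by rw [← pow_add, Nat.sub_add_cancel hjk]
  rw [zsmul_eq_mul, div_pow, h]
  field_simp

/-- The `p`-th quantile `inf {t : F_n(t) ≥ p}` of the sample `x`, where `F_n` is the empirical
distribution function. -/
def sampleQuantile {n : ℕ} (x : Fin n → ℝ) (p : ℝ) : ℝ :=
  sInf {t : ℝ | p ≤ ((Finset.univ.filter fun i => x i ≤ t).card : ℝ) / n}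

/-- `p` minimizes `f` over the set `S`. -/
def IsArgmin {α : Type*} (f : α → ℝ) (S : Set α) (p : α) : Prop := p ∈ S ∧ IsMinOn f S p

/-- `a_n = log log n`. -/
def logLog (n : ℕ) : ℝ := Real.log (Real.log n)

/-- The known quantities of the prediction problem: for each coordinate `i` (indexed from `0`)
the underestimation cost `b i`, the overestimation cost `h i`, and the variances `σp i` and `σf i`
of the past and of the future observation. -/
structure PredModel where
  b : ℕ → ℝ
  h : ℕ → ℝ
  σp : ℕ → ℝ
  σf : ℕ → ℝ
  b_pos : ∀ i, 0 < b i
  h_pos : ∀ i, 0 < h i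
  σp_pos : ∀ i, 0 < σp i
  σf_pos : ∀ i, 0 < σf i

/-- The constants in the mesh sizes of the grids. -/
structure GridConstants where
  C₁ : ℝ
  C₂ : ℝ
  C₃ : ℝ
  C₄ : ℝ

/-- The averages of `|θ_i|` have finite limsup. -/
def BoundedMeans (θ : ℕ → ℝ) : Prop :=
  ∃ B : ℝ, ∀ᶠ n : ℕ in atTop, (∑ i : Fin n, |θ i|) / n ≤ B

namespace PredModel

variable (M : PredModel)

/-- Critical ratio `b_i / (b_i + h_i)`. -/
def ratio (i : ℕ) : ℝ := M.b i / (M.b i + M.h i)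

/-- Bounded weights: the critical ratios are bounded away from `0` and `1`, and `b_i + h_i` is
bounded. -/
def BoundedWeights : Prop :=
  (∃ lo : ℝ, 0 < lo ∧ ∀ i, lo ≤ M.ratio i) ∧
  (∃ hi : ℝ, hi < 1 ∧ ∀ i, M.ratio i ≤ hi) ∧
  (∃ B : ℝ, ∀ i, M.b i + M.h i ≤ B)

/-- Sufficient historical data: `sup σp_i / σf_i < 1 / (4 e)`, `sup σf_i < ∞`, `inf σp_i > 0`. -/
def SufficientHistory : Prop :=
  (∃ r : ℝ, r < 1 / (4 * Real.exp 1) ∧ ∀ i, M.σp i / M.σf i ≤ r) ∧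
  (∃ B : ℝ, ∀ i, M.σf i ≤ B) ∧
  (∃ m : ℝ, 0 < m ∧ ∀ i, m ≤ M.σp i)

/-- Law of the past `X = (X_0, …, X_{n-1})`: independent `N(θ_i, σp_i)` coordinates. -/
def pastLaw (θ : ℕ → ℝ) (n : ℕ) : Measure (Fin n → ℝ) :=
  Measure.pi fun i : Fin n => gaussianReal (θ i) (M.σp i).toNNReal

/-- Predictive check loss of coordinate `i`: expectation over the future `Y ~ N(t, σf_i)`. -/
def coordLoss (i : ℕ) (t q : ℝ) : ℝ :=
  ∫ y, (M.b i * max (y - q) 0 + M.h i * max (q - y) 0) ∂(gaussianReal t (M.σf i).toNNReal)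

/-- Average predictive loss `L_n(θ, q)`. -/
def loss (θ : ℕ → ℝ) {n : ℕ} (q : Fin n → ℝ) : ℝ :=
  (1 / (n : ℝ)) * ∑ i : Fin n, M.coordLoss i (θ i) (q i)

/-- Predictive risk `R_n(θ, q̂)` of a prediction rule `q̂`. -/
def risk (θ : ℕ → ℝ) {n : ℕ} (qhat : (Fin n → ℝ) → (Fin n → ℝ)) : ℝ :=
  ∫ x, M.loss θ (qhat x) ∂(M.pastLaw θ n)

/-- Shrinkage factor `α_i(τ) = τ / (τ + σp_i)`, with `α_i(∞) = 1`. -/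
def shrink (i : ℕ) (τ : ℝ≥0∞) : ℝ :=
  if τ = ⊤ then 1 else τ.toReal / (τ.toReal + M.σp i)

/-- The shrinkage predictor `q̂(η, τ)` evaluated at the data `x`; here `p = (η, τ)`. -/
def predictor {n : ℕ} (p : ℝ × ℝ≥0∞) (x : Fin n → ℝ) : Fin n → ℝ := fun i =>
  M.shrink i p.2 * x i + (1 - M.shrink i p.2) * p.1
    + Real.sqrt (M.σf i + M.shrink i p.2 * M.σp i) * stdNormalQuantile (M.ratio i)

/-! ### The asymptotic risk estimate -/

/-- Intercept `c_i(τ)` of the standardized risk argument. -/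
def interceptC (i : ℕ) (τ : ℝ≥0∞) : ℝ :=
  Real.sqrt ((M.σf i + M.shrink i τ * M.σp i) / (M.σf i + M.shrink i τ ^ 2 * M.σp i))
    * stdNormalQuantile (M.ratio i)

/-- Slope `d_i(τ)` of the standardized risk argument. -/
def slopeD (i : ℕ) (τ : ℝ≥0∞) : ℝ :=
  -(1 - M.shrink i τ) / Real.sqrt (M.σf i + M.σp i * M.shrink i τ ^ 2)

/-- Admissible threshold constants: `0 < γ_i < 1 / √(4e) - √(σp_i / σf_i)`, with `γ` bounded away
from zero. -/
def ThresholdConstants (γ : ℕ → ℝ) : Prop :=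
  (∃ γ₀ : ℝ, 0 < γ₀ ∧ ∀ i, γ₀ ≤ γ i) ∧
  ∀ i, γ i < 1 / Real.sqrt (4 * Real.exp 1) - Real.sqrt (M.σp i / M.σf i)

/-- Threshold `γ_i √(2 log n)`. -/
def threshold (γ : ℕ → ℝ) (n i : ℕ) : ℝ := γ i * Real.sqrt (2 * Real.log n)

/-- Truncation order `K_n(i) = 1 + ⌈e² (γ_i + √(2 σp_i / σf_i))² (2 log n)⌉`. -/
def truncOrder (γ : ℕ → ℝ) (n i : ℕ) : ℕ :=
  1 + ⌈Real.exp 1 ^ 2 * (γ i + Real.sqrt (2 * (M.σp i / M.σf i))) ^ 2 * (2 * Real.log n)⌉₊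

/-- `S_i(u)`: unbiased estimate of the Taylor polynomial of `G(·, b̃_i)` of order `K_n(i)`, from
`u ~ N(·, 2 σp_i d_i(τ)²)`. The factor `Φ(0) - b̃_i` is the derivative of `G(·, b̃_i)` at `0`, and
the sum runs over `0 ≤ k ≤ K_n(i) - 2`. -/
def taylorEstimate (γ : ℕ → ℝ) (n i : ℕ) (τ : ℝ≥0∞) (u : ℝ) : ℝ :=
  lossG 0 (M.ratio i) + (stdNormalCDF 0 - M.ratio i) * u
    + stdNormalPDF 0 * ∑ k ∈ Finset.range (M.truncOrder γ n i - 1),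
        (-1 : ℝ) ^ k * Polynomial.aeval (0 : ℝ) (Polynomial.hermite k) / (Nat.factorial (k + 2) : ℝ)
          * scaledHermite (k + 2) (Real.sqrt (2 * M.σp i * M.slopeD i τ ^ 2)) u

/-- Randomized coordinatewise estimate `T̂_i(X_i, Z_i, τ)` at `X_i = x`, `Z_i = z`. -/
def randomizedT (γ : ℕ → ℝ) (n i : ℕ) (τ : ℝ≥0∞) (x z : ℝ) : ℝ :=
  let u := M.interceptC i τ + M.slopeD i τ * (x + Real.sqrt (M.σp i) * z)
  let v := M.interceptC i τ + M.slopeD i τ * (x - Real.sqrt (M.σp i) * z)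
  if v < -threshold γ n i then -M.ratio i * u
  else if v ≤ threshold γ n i then max (-(n : ℝ)) (min (n : ℝ) (M.taylorEstimate γ n i τ u))
  else (1 - M.ratio i) * u

/-- Rao–Blackwellized estimate `T̂_i(X_i, τ)`: average over the added noise `Z_i ~ N(0, 1)`. -/
def coordT (γ : ℕ → ℝ) (n i : ℕ) (τ : ℝ≥0∞) (x : ℝ) : ℝ :=
  ∫ z, M.randomizedT γ n i τ x z ∂(gaussianReal 0 1)

/-- Asymptotic risk estimate for shrinkage towards the origin. -/
def areOrigin (γ : ℕ → ℝ) {n : ℕ} (τ : ℝ≥0∞) (x : Fin n → ℝ) : ℝ :=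
  (1 / (n : ℝ)) * ∑ i : Fin n, (M.b i + M.h i)
    * Real.sqrt (M.σf i + M.σp i * M.shrink i τ ^ 2) * M.coordT γ n i τ (x i)

/-- Asymptotic risk estimate for shrinkage towards `η`; here `p = (η, τ)`. -/
def areD (γ : ℕ → ℝ) {n : ℕ} (x : Fin n → ℝ) (p : ℝ × ℝ≥0∞) : ℝ :=
  M.areOrigin γ p.2 fun i => x i - p.1

/-! ### Range of the location, grids, and the tuned hyperparameters -/

/-- Data-dependent range `[m̂_n(α₁), m̂_n(α₂)]` of the location, where `α₁` and `α₂` are the smallest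
and the largest critical ratio among the first `n` coordinates. -/
def locRange {n : ℕ} (x : Fin n → ℝ) : Set ℝ :=
  Set.Icc (sampleQuantile x (⨅ i : Fin n, M.ratio i)) (sampleQuantile x (⨆ i : Fin n, M.ratio i))

/-- The requirements on the constants used for the grids. The third one says that the product of
the suprema of `σp_i / σf_i` and of `|Φ⁻¹(b̃_i)|` is at most `C₃`. -/
def AdmissibleGridConstants (θ : ℕ → ℝ) (C : GridConstants) : Prop :=
  (∀ i, M.b i + M.h i ≤ C.C₁) ∧
  (∀ i, M.σp i ≤ C.C₂ ∧ (M.σp i)⁻¹ ≤ C.C₂) ∧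
  (∀ i j, M.σp i / M.σf i * |stdNormalQuantile (M.ratio j)| ≤ C.C₃) ∧
  (∀ᶠ n : ℕ in atTop, (∑ i : Fin n, |θ i|) / n ≤ C.C₄ * Real.sqrt (logLog n))

end PredModel

namespace GridConstants

variable (C : GridConstants)

/-- Mesh of the location grid. -/
def meshLoc (n : ℕ) : ℝ := (2 * C.C₁ * logLog n)⁻¹

/-- Mesh of the transformed scale grid. -/
def meshScale (n : ℕ) : ℝ :=
  (2 * C.C₁ * C.C₂ * (2 * stdNormalPDF 0 + C.C₃ + Real.sqrt (logLog n) * C.C₄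
    + logLog n + logLog n ^ 2))⁻¹

/-- Location grid: equispaced points of `[-a_n, a_n]`, starting at `-a_n`. -/
def gridLoc (n : ℕ) : Set ℝ :=
  {η | ∃ k : ℕ, η = -logLog n + k * C.meshLoc n ∧ η ≤ logLog n}

/-- Scale grid: the points `τ` with `τ / (τ + 1) = j δ`, for `j = 0, …, ⌈1/δ⌉ - 1`. -/
def gridScale (n : ℕ) : Set ℝ≥0∞ :=
  {τ | ∃ j : ℕ, j < ⌈1 / C.meshScale n⌉₊ ∧
    τ = ENNReal.ofReal (j * C.meshScale n / (1 - j * C.meshScale n))}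

end GridConstants

namespace PredModel

variable (M : PredModel)

open Classical in
/-- Candidate locations: the grid points in the data-dependent range. If there is none, the grid
points closest to that range. -/
def candidateLoc (C : GridConstants) {n : ℕ} (x : Fin n → ℝ) : Set ℝ :=
  if (C.gridLoc n ∩ M.locRange x).Nonempty then C.gridLoc n ∩ M.locRange x
  else {η | IsArgmin (fun t => Metric.infDist t (M.locRange x)) (C.gridLoc n) η}

/-- `p = (η̂, τ̂)` minimizes the asymptotic risk estimate over the candidate grid at the data `x`. -/
def IsAREChoice (γ : ℕ → ℝ) (C : GridConstants) {n : ℕ} (x : Fin n → ℝ) (p : ℝ × ℝ≥0∞) : Prop :=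
  IsArgmin (M.areD γ x) (M.candidateLoc C x ×ˢ C.gridScale n) p

/-- `p = (η, τ)` minimizes the true loss over `η` in the data-dependent range and `τ ∈ [0, ∞]`. -/
def IsOracleChoice (θ : ℕ → ℝ) {n : ℕ} (x : Fin n → ℝ) (p : ℝ × ℝ≥0∞) : Prop :=
  IsArgmin (fun p => M.loss θ (M.predictor p x)) (M.locRange x ×ˢ Set.univ) p

end PredModel

end

/-! ### Standard normal density and distribution function -/

/-! The tuned pair minimizes an estimate of the loss over a finite grid. It is therefore nearly
optimal once the estimate is close to the loss at all grid points simultaneously and the grid is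
fine enough that rounding the oracle costs little.

Quality of the estimate. Averaged over the past, the loss of coordinate `i` is a known factor times
`G(ω)`, where `ω` is the standardized bias of the predictor (`integral_coordLoss_coordPredictor`).
Adding and subtracting independent noise turns one observation into two independent variables `U, V`
with law `N(ω, s²)` (`map_noisyPair`): `V` selects a region and `U` estimates. If `|V|` exceeds the
threshold, `G` is replaced by a linear asymptote, which `U` estimates without bias; the error is a
Gaussian tail (`stdNormalCDF_mul_normalGain_le`). Otherwise `G` is replaced by its Taylor
polynomial, whose monomials `ω ^ k` are the means of `s ^ k H_k(U / s)`. With `N` terms the Taylor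
remainder is at most `ω² exp((e ω² - N) / 2)` (`abs_lossG_sub_taylorG_le`), and the second moment of
the estimate is of order `N² exp(e ω²)` (`integral_hermiteEstimate_sq_le`).

Put `L = log n` and `W = γ + √(2 σp / σf)`. The bounds on `γ` give `2 e W² < 1` with room to spare,
so for `|ω| ≤ W √(2L)` the remainder is `n^(-c)` and the second moment `n^(1-c)`, up to powers of
`L`; clipping at `±n` is then harmless. For larger `|ω|` the event that `|V|` is below the threshold
has probability at most `1 / (n √L)`, which compensates the clipping level `n`. Altogether the bias
is `O(1/√L)` and the second moment `O(n/√L)` (`selectEstimate_error_of_log`). Averaging out the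
noise preserves the mean and does not increase the second moment (`integral_sq_average_le`), and
averaging independent coordinates divides the variance by `n`. Hence the mean absolute error at each
grid point is `O((log n)^(-1/4))` (`exists_integral_abs_areD_sub_loss_le`). The grid has only
`O((log log n)^4)` points, so even the sum of these errors over the whole grid tends to zero.

Rounding. The loss is Lipschitz in `η` and in `τ / (τ + 1)` (`abs_loss_sub_le`). Oracle and tuned
pair are compared in both directions, since a tuned location outside the range might beat the
oracle; each is matched with a nearby admissible point of the other problem
(`exists_candidateLoc_near`, `exists_locRange_near`). This needs the range to lie in `[-a_n, a_n]`,
which holds when the average of `|X_i|` is at most `c a_n`, because quantiles at levels in `[c, 1 -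
c]` are at most that average divided by `c`. On the complement both losses are bounded by a multiple
of the average, which in turn is at most a multiple of the mean squared deviation divided by `a_n`
(`abs_loss_choice_sub_oracle_le_of_lt`), so its contribution to the expectation is `O(1/a_n)`. -/

lemma stdNormalPDF_eq (w : ℝ) :
    stdNormalPDF w = (√(2 * Real.pi))⁻¹ * Real.exp (-w ^ 2 / 2) := by
  simp [stdNormalPDF, gaussianPDFReal]

lemma stdNormalPDF_nonneg (w : ℝ) : 0 ≤ stdNormalPDF w := gaussianPDFReal_nonneg 0 1 w

lemma stdNormalPDF_neg (w : ℝ) : stdNormalPDF (-w) = stdNormalPDF w := by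
  simp [stdNormalPDF_eq]

lemma stdNormalPDF_eq_zero_mul_exp (w : ℝ) :
    stdNormalPDF w = stdNormalPDF 0 * Real.exp (-w ^ 2 / 2) := by
  simp [stdNormalPDF_eq]

lemma stdNormalPDF_zero_le_one : stdNormalPDF 0 ≤ 1 := by
  have h : (1 : ℝ) ≤ √(2 * Real.pi) := Real.one_le_sqrt.2 (by linarith [Real.pi_gt_three])
  simpa [stdNormalPDF_eq] using inv_le_one_of_one_le₀ h

lemma stdNormalPDF_le_exp (w : ℝ) : stdNormalPDF w ≤ Real.exp (-w ^ 2 / 2) := by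
  rw [stdNormalPDF_eq_zero_mul_exp]
  exact mul_le_of_le_one_left (Real.exp_pos _).le stdNormalPDF_zero_le_one

lemma stdNormalPDF_le_one (w : ℝ) : stdNormalPDF w ≤ 1 :=
  (stdNormalPDF_le_exp w).trans (Real.exp_le_one_iff.2 (by nlinarith [sq_nonneg w]))

lemma hasDerivAt_stdNormalPDF (w : ℝ) :
    HasDerivAt stdNormalPDF (-w * stdNormalPDF w) w := by
  have h : HasDerivAt (fun x : ℝ => (√(2 * Real.pi))⁻¹ * Real.exp (-x ^ 2 / 2))
      ((√(2 * Real.pi))⁻¹ * (Real.exp (-w ^ 2 / 2) * (-(2 * w) / 2))) w := by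
    have h1 : HasDerivAt (fun x : ℝ => -x ^ 2 / 2) (-(2 * w) / 2) w := by
      simpa using ((hasDerivAt_pow 2 w).neg).div_const 2
    exact (h1.exp).const_mul _
  have e : stdNormalPDF = fun x : ℝ => (√(2 * Real.pi))⁻¹ * Real.exp (-x ^ 2 / 2) :=
    funext stdNormalPDF_eq
  rw [e]
  convert h using 1
  ring

lemma continuous_stdNormalPDF : Continuous stdNormalPDF :=
  continuous_iff_continuousAt.2 fun w => (hasDerivAt_stdNormalPDF w).continuousAt

lemma stdNormalCDF_eq (w : ℝ) : stdNormalCDF w = (gaussianReal 0 1).real (Set.Iic w) :=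
  cdf_eq_real _ w

lemma stdNormalCDF_nonneg (w : ℝ) : 0 ≤ stdNormalCDF w := cdf_nonneg _ w

lemma stdNormalCDF_le_one (w : ℝ) : stdNormalCDF w ≤ 1 := cdf_le_one _ w

instance : NullSingletonClass (gaussianReal 0 1) :=
  nullSingletonClass_gaussianReal one_ne_zero

lemma gaussianReal_real_Ioi (w : ℝ) :
    (gaussianReal 0 1).real (Set.Ioi w) = 1 - stdNormalCDF w := by
  rw [stdNormalCDF_eq, ← Set.compl_Iic, probReal_compl_eq_one_sub measurableSet_Iic]

lemma stdNormalCDF_neg (w : ℝ) : stdNormalCDF (-w) = 1 - stdNormalCDF w := by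
  have h : (gaussianReal 0 1).map (fun x : ℝ => -x) = gaussianReal 0 1 := by
    rw [gaussianReal_map_neg, neg_zero]
  rw [← gaussianReal_real_Ioi, stdNormalCDF_eq, ← h,
    map_measureReal_apply (by fun_prop) measurableSet_Iic]
  have : (fun x : ℝ => -x) ⁻¹' Set.Iic (-w) = Set.Ici w := by ext; simp
  rw [this, measureReal_congr Ioi_ae_eq_Ici.symm, h]

lemma stdNormalCDF_eq_integral (w : ℝ) :
    stdNormalCDF w = ∫ x in Set.Iic w, stdNormalPDF x := by
  rw [stdNormalCDF_eq, measureReal_def, gaussianReal_apply_eq_integral 0 one_ne_zero,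
    ENNReal.toReal_ofReal (integral_nonneg fun x => gaussianPDFReal_nonneg _ _ _)]
  rfl

lemma integrable_stdNormalPDF : Integrable stdNormalPDF := integrable_gaussianPDFReal 0 1

lemma hasDerivAt_stdNormalCDF (w : ℝ) : HasDerivAt stdNormalCDF (stdNormalPDF w) w := by
  have e : stdNormalCDF = fun x => stdNormalCDF 0 + ∫ t in (0 : ℝ)..x, stdNormalPDF t := by
    funext x
    rw [stdNormalCDF_eq_integral, stdNormalCDF_eq_integral,
      ← intervalIntegral.integral_Iic_sub_Iic integrable_stdNormalPDF.integrableOn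
        integrable_stdNormalPDF.integrableOn]
    ring
  rw [e]
  exact (intervalIntegral.integral_hasDerivAt_right
    (continuous_stdNormalPDF.intervalIntegrable _ _)
    continuous_stdNormalPDF.stronglyMeasurable.stronglyMeasurableAtFilter
    continuous_stdNormalPDF.continuousAt).const_add _

/-! ### Affine images of the standard normal law -/

lemma gaussianReal_eq_map_std (m v : ℝ) (hv : 0 ≤ v) :
    gaussianReal m v.toNNReal = (gaussianReal 0 1).map (fun z => m + √v * z) := by
  have h1 : (gaussianReal 0 1).map (fun z => √v * z) = gaussianReal 0 v.toNNReal := by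
    rw [gaussianReal_map_const_mul, mul_zero, mul_one]
    congr 1
    ext
    simp [Real.sq_sqrt hv, hv]
  have h2 : (fun z => m + √v * z) = (fun z => m + z) ∘ (fun z : ℝ => √v * z) := rfl
  rw [h2, ← Measure.map_map (by fun_prop) (by fun_prop), h1, gaussianReal_map_const_add, zero_add]

lemma integral_gaussianReal_eq_std (m : ℝ) {v : ℝ} (hv : 0 ≤ v) {f : ℝ → ℝ} (hf : Measurable f) :
    ∫ x, f x ∂(gaussianReal m v.toNNReal) = ∫ z, f (m + √v * z) ∂(gaussianReal 0 1) := by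
  rw [gaussianReal_eq_map_std m v hv, integral_map (by fun_prop) hf.aestronglyMeasurable]

lemma gaussianReal_real_Iic (m : ℝ) {v : ℝ} (hv : 0 < v) (y : ℝ) :
    (gaussianReal m v.toNNReal).real (Set.Iic y) = stdNormalCDF ((y - m) / √v) := by
  rw [gaussianReal_eq_map_std m v hv.le, map_measureReal_apply (by fun_prop) measurableSet_Iic,
    stdNormalCDF_eq]
  congr 1
  ext z
  have := Real.sqrt_pos.2 hv
  simp only [Set.mem_preimage, Set.mem_Iic]
  rw [le_div_iff₀ this]
  constructor <;> intro h <;> linarith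

lemma gaussianReal_real_Ioi_eq (m : ℝ) {v : ℝ} (hv : 0 < v) (y : ℝ) :
    (gaussianReal m v.toNNReal).real (Set.Ioi y) = stdNormalCDF ((m - y) / √v) := by
  rw [← Set.compl_Iic, probReal_compl_eq_one_sub measurableSet_Iic, gaussianReal_real_Iic m hv,
    ← stdNormalCDF_neg]
  congr 1
  ring

lemma integrable_pow_gaussianReal (m : ℝ) (v : NNReal) (k : ℕ) :
    Integrable (fun x : ℝ => x ^ k) (gaussianReal m v) := by
  have h : MemLp (fun x : ℝ => x) k (gaussianReal m v) := memLp_id_gaussianReal (k : NNReal)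
  refine (h.integrable_norm_pow').mono' (by fun_prop) (ae_of_all _ fun x => by simp)

lemma integrable_id_gaussianReal (m : ℝ) (v : NNReal) :
    Integrable (fun x : ℝ => x) (gaussianReal m v) := by
  simpa using integrable_pow_gaussianReal m v 1

lemma integrable_sub_sq_gaussianReal (m : ℝ) (v : NNReal) (a : ℝ) :
    Integrable (fun x : ℝ => (x - a) ^ 2) (gaussianReal m v) := by
  have h : (fun x : ℝ => (x - a) ^ 2) = fun x => x ^ 2 + (-2 * a * x + a ^ 2) := by
    ext; ring
  rw [h]
  exact (integrable_pow_gaussianReal m v 2).add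
    (((integrable_id_gaussianReal m v).const_mul _).add (integrable_const _))

lemma integral_sub_sq_gaussianReal (m : ℝ) (v : NNReal) :
    ∫ x, (x - m) ^ 2 ∂(gaussianReal m v) = v := by
  have h := variance_fun_id_gaussianReal (μ := m) (v := v)
  rw [variance_eq_integral (by fun_prop)] at h
  simpa using h

/-! ### The expected positive part of a normal variable -/

/-- `φ(w) + w Φ(w)`, the mean of the positive part of an `N(w, 1)` variable. -/
noncomputable def normalGain (w : ℝ) : ℝ := stdNormalPDF w + w * stdNormalCDF w

lemma lossG_eq (w β : ℝ) : lossG w β = normalGain w - β * w := rfl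

lemma hasDerivAt_normalGain (w : ℝ) : HasDerivAt normalGain (stdNormalCDF w) w := by
  have h := (hasDerivAt_stdNormalPDF w).add ((hasDerivAt_id w).mul (hasDerivAt_stdNormalCDF w))
  exact h.congr_deriv (by simp)

lemma continuous_normalGain : Continuous normalGain :=
  continuous_iff_continuousAt.2 fun w => (hasDerivAt_normalGain w).continuousAt

lemma tendsto_stdNormalPDF_atTop : Tendsto stdNormalPDF atTop (𝓝 0) := by
  have h : Tendsto (fun x : ℝ => Real.exp (-x ^ 2 / 2)) atTop (𝓝 0) := by
    refine Real.tendsto_exp_atBot.comp ?_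
    have : (fun x : ℝ => -x ^ 2 / 2) = fun x : ℝ => -(x ^ 2 / 2) := by ext; ring
    rw [this]
    exact tendsto_neg_atTop_atBot.comp
      ((tendsto_pow_atTop two_ne_zero).atTop_div_const two_pos)
  exact squeeze_zero stdNormalPDF_nonneg stdNormalPDF_le_exp h

lemma integral_max_std (w : ℝ) : ∫ z, max (w + z) 0 ∂(gaussianReal 0 1) = normalGain w := by
  have hid : Integrable (fun z : ℝ => w + z) (gaussianReal 0 1) :=
    (integrable_const _).add (integrable_id_gaussianReal 0 1)
  have h1 : (fun z : ℝ => max (w + z) 0) = (Set.Ioi (-w)).indicator (fun z => w + z) := by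
    ext z
    by_cases hz : z ∈ Set.Ioi (-w)
    · rw [Set.indicator_of_mem hz, max_eq_left]
      have := Set.mem_Ioi.1 hz
      linarith
    · rw [Set.indicator_of_notMem hz, max_eq_right]
      have := not_lt.1 (Set.mem_Ioi.not.1 hz)
      linarith
  rw [h1, integral_indicator measurableSet_Ioi,
    integral_add (integrable_const _).integrableOn (integrable_id_gaussianReal 0 1).integrableOn]
  have h2 : ∫ z in Set.Ioi (-w), z ∂(gaussianReal 0 1) = stdNormalPDF w := by
    rw [← integral_indicator measurableSet_Ioi, integral_gaussianReal_eq_integral_smul one_ne_zero]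
    have e : (fun x : ℝ => gaussianPDFReal 0 1 x • (Set.Ioi (-w)).indicator (fun z => z) x)
        = (Set.Ioi (-w)).indicator (fun x => x * stdNormalPDF x) := by
      ext x
      by_cases hx : x ∈ Set.Ioi (-w) <;> simp [hx, stdNormalPDF, mul_comm]
    rw [e, integral_indicator measurableSet_Ioi]
    have hd : ∀ x ∈ Set.Ici (-w), HasDerivAt (fun x => -stdNormalPDF x) (x * stdNormalPDF x) x := by
      intro x _
      exact (hasDerivAt_stdNormalPDF x).neg.congr_deriv (by ring)
    have hint : Integrable (fun x : ℝ => x * stdNormalPDF x) := by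
      have := integrable_mul_exp_neg_mul_sq (b := 1 / 2) (by norm_num)
      refine (this.const_mul (√(2 * Real.pi))⁻¹).congr (ae_of_all _ fun x => ?_)
      simp only [stdNormalPDF_eq]
      rw [show -(1 / 2) * x ^ 2 = -x ^ 2 / 2 by ring]
      ring
    rw [integral_Ioi_of_hasDerivAt_of_tendsto' hd hint.integrableOn
      (by simpa using tendsto_stdNormalPDF_atTop.neg), stdNormalPDF_neg]
    ring
  rw [h2, setIntegral_const, gaussianReal_real_Ioi, stdNormalCDF_neg, normalGain, smul_eq_mul]
  ring

lemma normalGain_nonneg (w : ℝ) : 0 ≤ normalGain w := by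
  rw [← integral_max_std]
  exact integral_nonneg fun z => le_max_right _ _

lemma normalGain_sub_self (w : ℝ) : normalGain w - w = normalGain (-w) := by
  rw [normalGain, normalGain, stdNormalPDF_neg, stdNormalCDF_neg]
  ring

lemma normalGain_le (w : ℝ) : normalGain w ≤ 1 + |w| := by
  have h1 := stdNormalPDF_le_one w
  have h2 : w * stdNormalCDF w ≤ |w| * 1 :=
    mul_le_mul (le_abs_self w) (stdNormalCDF_le_one w) (stdNormalCDF_nonneg w) (abs_nonneg w)
  rw [normalGain]
  linarith

lemma normalGain_le_exp {w : ℝ} (hw : w ≤ 0) : normalGain w ≤ Real.exp (-w ^ 2 / 2) := by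
  have h1 := stdNormalPDF_le_exp w
  have h2 : w * stdNormalCDF w ≤ 0 := mul_nonpos_of_nonpos_of_nonneg hw (stdNormalCDF_nonneg w)
  rw [normalGain]
  linarith

/-- `G(w, β)` is the convex combination of `normalGain w` and `normalGain (-w)` with weights `1 - β`
and `β`. -/
lemma abs_lossG_le (w : ℝ) {β : ℝ} (h0 : 0 ≤ β) (h1 : β ≤ 1) : |lossG w β| ≤ 1 + |w| := by
  have e : lossG w β = (1 - β) * normalGain w + β * normalGain (-w) := by
    rw [lossG_eq, ← normalGain_sub_self]; ring
  have a := normalGain_nonneg w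
  have b := normalGain_nonneg (-w)
  have c := normalGain_le w
  have d := normalGain_le (-w)
  rw [abs_neg] at d
  rw [e, abs_of_nonneg (by nlinarith)]
  nlinarith

/-- Mills' bound on the normal tail. -/
lemma stdNormalCDF_neg_le {t : ℝ} (ht : 0 < t) :
    stdNormalCDF (-t) ≤ Real.exp (-t ^ 2 / 2) / t := by
  -- Nonnegativity of the gain at `-t` says exactly `t Φ(-t) ≤ φ(t)`.
  have h := normalGain_nonneg (-t)
  have h1 := stdNormalPDF_le_exp (-t)
  rw [neg_sq] at h1
  rw [normalGain] at h
  rw [le_div_iff₀ ht]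
  linarith

lemma integral_max_gaussianReal (m : ℝ) {v : ℝ} (hv : 0 < v) :
    ∫ x, max x 0 ∂(gaussianReal m v.toNNReal) = √v * normalGain (m / √v) := by
  have hs := Real.sqrt_pos.2 hv
  rw [integral_gaussianReal_eq_std m hv.le (by fun_prop), ← integral_max_std,
    ← integral_const_mul]
  congr 1
  ext z
  rw [mul_max_of_nonneg _ _ hs.le, mul_zero]
  congr 1
  field_simp

/-! ### Hermite polynomials and Stein's identity -/

lemma integrable_eval_gaussianReal (m : ℝ) (v : NNReal) (P : Polynomial ℝ) :
    Integrable (fun x => P.eval x) (gaussianReal m v) := by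
  induction P using Polynomial.induction_on' with
  | add p q hp hq =>
    simp only [Polynomial.eval_add]
    exact hp.add hq
  | monomial k a => simpa using (integrable_pow_gaussianReal m v k).const_mul a

lemma integrable_stdNormalPDF_mul_eval (P : Polynomial ℝ) :
    Integrable (fun x => stdNormalPDF x * P.eval x) := by
  have h := integrable_eval_gaussianReal 0 1 P
  rw [gaussianReal_of_var_ne_zero 0 one_ne_zero, integrable_withDensity_iff_integrable_smul'
    (measurable_gaussianPDF 0 1) (ae_of_all _ fun _ => gaussianPDF_lt_top)] at h
  simpa [stdNormalPDF] using h

lemma integral_stein_std (Q : Polynomial ℝ) :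
    ∫ z, (z * Q.eval z - Q.derivative.eval z) ∂(gaussianReal 0 1) = 0 := by
  rw [integral_gaussianReal_eq_integral_smul one_ne_zero]
  have hd : ∀ x, HasDerivAt (fun x => -(stdNormalPDF x * Q.eval x))
      (gaussianPDFReal 0 1 x • (x * Q.eval x - Q.derivative.eval x)) x := by
    intro x
    refine ((hasDerivAt_stdNormalPDF x).mul (Q.hasDerivAt x)).neg.congr_deriv ?_
    simp only [smul_eq_mul, stdNormalPDF]
    ring
  refine integral_eq_zero_of_hasDerivAt_of_integrable hd ?_
    (integrable_stdNormalPDF_mul_eval Q).neg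
  have := integrable_stdNormalPDF_mul_eval (Polynomial.X * Q - Q.derivative)
  simpa [stdNormalPDF] using this

lemma integral_eval_gaussianReal_one (m : ℝ) (P : Polynomial ℝ) :
    ∫ x, P.eval x ∂(gaussianReal m 1)
      = ∫ z, (P.comp (Polynomial.X + Polynomial.C m)).eval z ∂(gaussianReal 0 1) := by
  have h := integral_gaussianReal_eq_std m zero_le_one (f := fun x => P.eval x)
    (by fun_prop)
  simp only [Real.toNNReal_one, Real.sqrt_one, one_mul] at h
  rw [h]
  simp [add_comm]

lemma integral_stein (m : ℝ) (P : Polynomial ℝ) :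
    ∫ x, (Polynomial.X * P - P.derivative).eval x ∂(gaussianReal m 1)
      = m * ∫ x, P.eval x ∂(gaussianReal m 1) := by
  rw [integral_eval_gaussianReal_one m (Polynomial.X * P - P.derivative),
    integral_eval_gaussianReal_one m P]
  set Q := P.comp (Polynomial.X + Polynomial.C m) with hQ
  have h1 : (Polynomial.X * P - P.derivative).comp (Polynomial.X + Polynomial.C m)
      = (Polynomial.X * Q - Q.derivative) + Polynomial.C m * Q := by
    simp only [hQ, Polynomial.sub_comp, Polynomial.mul_comp, Polynomial.X_comp,
      Polynomial.derivative_comp, Polynomial.derivative_add, Polynomial.derivative_X,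
      Polynomial.derivative_C]
    ring
  have h2 : ∫ z, (Polynomial.X * Q - Q.derivative).eval z ∂(gaussianReal 0 1) = 0 := by
    simpa using integral_stein_std Q
  have h3 : ∀ z, ((Polynomial.X * Q - Q.derivative) + Polynomial.C m * Q).eval z
      = (Polynomial.X * Q - Q.derivative).eval z + m * Q.eval z := fun z => by
    rw [Polynomial.eval_add, Polynomial.eval_C_mul]
  rw [h1]
  simp_rw [h3]
  rw [integral_add (integrable_eval_gaussianReal _ _ _)
    ((integrable_eval_gaussianReal _ _ _).const_mul _), integral_const_mul]
  rw [h2, zero_add]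

/-- The `k`-th probabilists' Hermite polynomial with real coefficients. -/
noncomputable def hermiteReal (k : ℕ) : Polynomial ℝ :=
  (Polynomial.hermite k).map (Int.castRingHom ℝ)

lemma aeval_hermite (k : ℕ) (x : ℝ) :
    Polynomial.aeval x (Polynomial.hermite k) = (hermiteReal k).eval x := by
  rw [hermiteReal, Polynomial.eval_map, Polynomial.aeval_def]
  rfl

lemma hermiteReal_zero : hermiteReal 0 = 1 := by simp [hermiteReal]

lemma hermiteReal_succ (k : ℕ) :
    hermiteReal (k + 1) = Polynomial.X * hermiteReal k - (hermiteReal k).derivative := by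
  simp [hermiteReal, Polynomial.hermite_succ, Polynomial.derivative_map]

lemma derivative_hermiteReal_succ (k : ℕ) :
    (hermiteReal (k + 1)).derivative = ((k + 1 : ℕ) : Polynomial ℝ) * hermiteReal k := by
  induction k with
  | zero => simp [hermiteReal_succ, hermiteReal_zero]
  | succ k ih =>
    rw [hermiteReal_succ (k + 1), Polynomial.derivative_sub, ih, Polynomial.derivative_mul, ih,
      Polynomial.derivative_mul, Polynomial.derivative_natCast, Polynomial.derivative_X,
      hermiteReal_succ k]
    push_cast
    ring

/-- The Hermite recursion `H_{k+1} = x H_k - H_k'` is the left side of Stein's identity, so each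
step multiplies the mean by `m`. -/
lemma integral_hermiteReal (m : ℝ) (k : ℕ) :
    ∫ x, (hermiteReal k).eval x ∂(gaussianReal m 1) = m ^ k := by
  induction k with
  | zero => simp [hermiteReal_zero]
  | succ k ih => rw [hermiteReal_succ, integral_stein, ih, pow_succ']

/-- With `P = H_k H_{k+1}` one has `H_{k+1}² = (x P - P') + (k + 1) H_k²`. Stein's identity turns
the bracket into `m E[P]`, and the arithmetic-geometric inequality splits this into `m²/2 E[H_k²]`
and half of the left side, which is absorbed. -/
lemma integral_hermiteReal_sq_succ_le (m : ℝ) (k : ℕ) :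
    ∫ x, (hermiteReal (k + 1) ^ 2).eval x ∂(gaussianReal m 1)
      ≤ (m ^ 2 + 2 * (k + 1)) * ∫ x, (hermiteReal k ^ 2).eval x ∂(gaussianReal m 1) := by
  have h1 : hermiteReal (k + 1) ^ 2
      = (Polynomial.X * (hermiteReal k * hermiteReal (k + 1))
          - (hermiteReal k * hermiteReal (k + 1)).derivative)
        + Polynomial.C ((k : ℝ) + 1) * hermiteReal k ^ 2 := by
    rw [Polynomial.derivative_mul, derivative_hermiteReal_succ, hermiteReal_succ k]
    simp only [map_add, Polynomial.C_1, map_natCast]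
    push_cast
    ring
  have h2 : ∫ x, (hermiteReal (k + 1) ^ 2).eval x ∂(gaussianReal m 1)
      = m * ∫ x, (hermiteReal k * hermiteReal (k + 1)).eval x ∂(gaussianReal m 1)
        + (k + 1) * ∫ x, (hermiteReal k ^ 2).eval x ∂(gaussianReal m 1) := by
    conv_lhs => rw [h1]
    simp only [Polynomial.eval_add, Polynomial.eval_C_mul]
    rw [integral_add (integrable_eval_gaussianReal _ _ _)
      ((integrable_eval_gaussianReal _ _ _).const_mul _), integral_stein, integral_const_mul]
  have h3 : m * ∫ x, (hermiteReal k * hermiteReal (k + 1)).eval x ∂(gaussianReal m 1)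
      ≤ ∫ x, (Polynomial.C (m ^ 2 / 2) * hermiteReal k ^ 2
          + Polynomial.C (1 / 2) * hermiteReal (k + 1) ^ 2).eval x ∂(gaussianReal m 1) := by
    rw [← integral_const_mul]
    refine integral_mono ((integrable_eval_gaussianReal _ _ _).const_mul _)
      (integrable_eval_gaussianReal _ _ _) fun x => ?_
    simp only [Polynomial.eval_add, Polynomial.eval_mul, Polynomial.eval_pow, Polynomial.eval_C]
    nlinarith [sq_nonneg (m * (hermiteReal k).eval x - (hermiteReal (k + 1)).eval x)]
  simp only [Polynomial.eval_add, Polynomial.eval_C_mul] at h3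
  rw [integral_add ((integrable_eval_gaussianReal _ _ _).const_mul _)
      ((integrable_eval_gaussianReal _ _ _).const_mul _), integral_const_mul,
      integral_const_mul] at h3
  linarith

lemma integral_hermiteReal_sq_le (m : ℝ) (k : ℕ) :
    ∫ x, (hermiteReal k ^ 2).eval x ∂(gaussianReal m 1) ≤ (m ^ 2 + 2 * k) ^ k := by
  induction k with
  | zero => simp [hermiteReal_zero]
  | succ k ih =>
    refine (integral_hermiteReal_sq_succ_le m k).trans ?_
    push_cast
    rw [pow_succ' (m ^ 2 + 2 * ((k : ℝ) + 1)) k]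
    have h0 : 0 ≤ m ^ 2 + 2 * (k : ℝ) := by positivity
    have h1 : (m ^ 2 + 2 * (k : ℝ)) ^ k ≤ (m ^ 2 + 2 * (k + 1)) ^ k :=
      pow_le_pow_left₀ h0 (by linarith) k
    have h2 : 0 ≤ m ^ 2 + 2 * ((k : ℝ) + 1) := by positivity
    have h3 := ih.trans h1
    exact mul_le_mul_of_nonneg_left h3 h2

/-! ### Homogenized Hermite polynomials under a normal law -/

lemma scaledHermite_eq_eval (k : ℕ) {s : ℝ} (hs : s ≠ 0) (u : ℝ) :
    scaledHermite k s u = s ^ k * (hermiteReal k).eval (u / s) := by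
  rw [scaledHermite_eq k hs, aeval_hermite]

@[fun_prop]
lemma continuous_scaledHermite (k : ℕ) (s : ℝ) : Continuous (scaledHermite k s) := by
  unfold scaledHermite
  fun_prop

lemma gaussianReal_eq_map_unit (ω : ℝ) {s : ℝ} (hs : 0 < s) :
    gaussianReal ω (s ^ 2).toNNReal = (gaussianReal (ω / s) 1).map (fun x => s * x) := by
  rw [gaussianReal_map_const_mul, mul_one]
  congr 1
  · field_simp
  · ext
    simp [sq_nonneg]

lemma integral_gaussianReal_eq_unit (ω : ℝ) {s : ℝ} (hs : 0 < s) {f : ℝ → ℝ}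
    (hf : Continuous f) :
    ∫ u, f u ∂(gaussianReal ω (s ^ 2).toNNReal)
      = ∫ x, f (s * x) ∂(gaussianReal (ω / s) 1) := by
  rw [gaussianReal_eq_map_unit ω hs, integral_map (by fun_prop) (by fun_prop)]

lemma integral_scaledHermite (k : ℕ) (ω : ℝ) {s : ℝ} (hs : 0 < s) :
    ∫ u, scaledHermite k s u ∂(gaussianReal ω (s ^ 2).toNNReal) = ω ^ k := by
  rw [integral_gaussianReal_eq_unit ω hs (by fun_prop)]
  simp only [scaledHermite_eq_eval k hs.ne', mul_div_cancel_left₀ _ hs.ne']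
  rw [integral_const_mul, integral_hermiteReal, ← mul_pow]
  congr 1
  field_simp

/-- Rescaling gives at most `(ω² + 2 k s²)^k`. The condition on `s` replaces `2 s²` by `1/e`, so
this is at most `e^(-k) (e ω² + k)^k`, and `y^k ≤ k! e^y` cancels the factor `e^(-k)`. The growth in
`k` is then only `k!`, which the Taylor coefficients can offset. -/
lemma integral_scaledHermite_sq_le (k : ℕ) (ω : ℝ) {s : ℝ} (hs : 0 < s)
    (hs2 : 2 * s ^ 2 ≤ Real.exp (-1)) :
    ∫ u, scaledHermite k s u ^ 2 ∂(gaussianReal ω (s ^ 2).toNNReal)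
      ≤ k.factorial * Real.exp (Real.exp 1 * ω ^ 2) := by
  rw [integral_gaussianReal_eq_unit ω hs (by fun_prop)]
  simp only [scaledHermite_eq_eval k hs.ne', mul_div_cancel_left₀ _ hs.ne', mul_pow]
  rw [integral_const_mul]
  have h1 := integral_hermiteReal_sq_le (ω / s) k
  simp only [Polynomial.eval_pow] at h1
  have h2 : (s ^ k) ^ 2 * ((ω / s) ^ 2 + 2 * k) ^ k = (ω ^ 2 + k * (2 * s ^ 2)) ^ k := by
    rw [← pow_mul, mul_comm k 2, pow_mul, ← mul_pow]
    congr 1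
    field_simp
  have h3 : (ω ^ 2 + k * (2 * s ^ 2)) ^ k
      ≤ (Real.exp (-1) * (Real.exp 1 * ω ^ 2 + k)) ^ k := by
    have : Real.exp (-1) * (Real.exp 1 * ω ^ 2 + k) = ω ^ 2 + k * Real.exp (-1) := by
      rw [mul_add, ← mul_assoc, ← Real.exp_add]
      simp [mul_comm]
    rw [this]
    gcongr
  have h4 := Real.pow_div_factorial_le_exp (x := Real.exp 1 * ω ^ 2 + k) (by positivity) k
  rw [div_le_iff₀ (by positivity)] at h4
  calc (s ^ k) ^ 2 * ∫ x, (hermiteReal k).eval x ^ 2 ∂(gaussianReal (ω / s) 1)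
      ≤ (s ^ k) ^ 2 * ((ω / s) ^ 2 + 2 * k) ^ k := by gcongr
    _ ≤ (Real.exp (-1) * (Real.exp 1 * ω ^ 2 + k)) ^ k := by rw [h2]; exact h3
    _ = Real.exp (-1) ^ k * (Real.exp 1 * ω ^ 2 + k) ^ k := mul_pow _ _ _
    _ ≤ Real.exp (-1) ^ k * (Real.exp (Real.exp 1 * ω ^ 2 + k) * k.factorial) := by gcongr
    _ = k.factorial * Real.exp (Real.exp 1 * ω ^ 2) := by
      rw [← Real.exp_nat_mul, ← mul_assoc, ← Real.exp_add]
      rw [mul_comm]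
      congr 2
      ring

/-! ### Taylor approximation of the expected positive part -/

/-- In the tail every index is at least `J`, so inserting the factor `e^(j - J) ≥ 1` dominates it by
`e^(-J)` times the tail of the series of `exp(e x)`. -/
lemma exp_sub_sum_le_exp {x : ℝ} (hx : 0 ≤ x) (J : ℕ) :
    Real.exp x - ∑ j ∈ Finset.range J, x ^ j / (j.factorial : ℝ)
      ≤ Real.exp (Real.exp 1 * x - J) := by
  have hf : HasSum (fun j : ℕ => x ^ j / (j.factorial : ℝ)) (Real.exp x) := by
    simpa [Real.exp_eq_exp_ℝ] using NormedSpace.expSeries_div_hasSum_exp x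
  have hg : HasSum (fun j : ℕ => (Real.exp 1 * x) ^ j / (j.factorial : ℝ))
      (Real.exp (Real.exp 1 * x)) := by
    simpa [Real.exp_eq_exp_ℝ] using NormedSpace.expSeries_div_hasSum_exp (Real.exp 1 * x)
  have h1 := hf.summable.sum_add_tsum_nat_add J
  have h2 := hg.summable.sum_add_tsum_nat_add J
  rw [hf.tsum_eq] at h1
  rw [hg.tsum_eq] at h2
  have h3 : ∑' j, x ^ (j + J) / ((j + J).factorial : ℝ)
      ≤ ∑' j, Real.exp (-J) * ((Real.exp 1 * x) ^ (j + J) / ((j + J).factorial : ℝ)) := by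
    refine Summable.tsum_le_tsum (fun j => ?_) ((summable_nat_add_iff J).2 hf.summable)
      (((summable_nat_add_iff J).2 hg.summable).mul_left _)
    have h4 : (1 : ℝ) ≤ Real.exp (-J) * Real.exp 1 ^ (j + J) := by
      rw [← Real.exp_nat_mul, ← Real.exp_add]
      refine Real.one_le_exp ?_
      push_cast
      linarith [Nat.cast_nonneg (α := ℝ) j]
    have h5 : 0 ≤ x ^ (j + J) / ((j + J).factorial : ℝ) := by positivity
    calc x ^ (j + J) / ((j + J).factorial : ℝ)
        ≤ (Real.exp (-J) * Real.exp 1 ^ (j + J)) * (x ^ (j + J) / ((j + J).factorial : ℝ)) :=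
          le_mul_of_one_le_left h5 h4
      _ = _ := by rw [mul_pow]; ring
  rw [tsum_mul_left] at h3
  have h6 : 0 ≤ ∑ j ∈ Finset.range J, (Real.exp 1 * x) ^ j / (j.factorial : ℝ) :=
    Finset.sum_nonneg fun j _ => by positivity
  have h7 : Real.exp (Real.exp 1 * x - J) = Real.exp (-J) * Real.exp (Real.exp 1 * x) := by
    rw [← Real.exp_add]; ring_nf
  rw [h7]
  have h8 : Real.exp (-J) * ∑' j, (Real.exp 1 * x) ^ (j + J) / ((j + J).factorial : ℝ)
      ≤ Real.exp (-J) * Real.exp (Real.exp 1 * x) :=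
    mul_le_mul_of_nonneg_left (by linarith) (Real.exp_pos _).le
  linarith

lemma abs_exp_neg_sub_sum_le {x : ℝ} (hx : 0 ≤ x) (J : ℕ) :
    |Real.exp (-x) - ∑ j ∈ Finset.range J, (-x) ^ j / (j.factorial : ℝ)|
      ≤ Real.exp (Real.exp 1 * x - J) := by
  have h := Complex.norm_exp_sub_sum_le_exp_norm_sub_sum ((-x : ℝ) : ℂ) J
  have e : Complex.exp ((-x : ℝ) : ℂ) - ∑ m ∈ Finset.range J, ((-x : ℝ) : ℂ) ^ m / (m.factorial : ℂ)
      = ((Real.exp (-x) - ∑ j ∈ Finset.range J, (-x) ^ j / (j.factorial : ℝ) : ℝ) : ℂ) := by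
    push_cast
    rfl
  rw [e, Complex.norm_real, Complex.norm_real, Real.norm_eq_abs, Real.norm_eq_abs, abs_neg,
    abs_of_nonneg hx] at h
  exact h.trans (exp_sub_sum_le_exp hx J)

/-- The `k`-th derivative of `exp (-t ^ 2 / 2)` at `0`. -/
noncomputable def gaussianJet (k : ℕ) : ℝ :=
  (-1 : ℝ) ^ k * Polynomial.aeval (0 : ℝ) (Polynomial.hermite k)

lemma gaussianJet_zero : gaussianJet 0 = 1 := by simp [gaussianJet]

lemma gaussianJet_one : gaussianJet 1 = 0 := by simp [gaussianJet]

lemma gaussianJet_add_two (k : ℕ) : gaussianJet (k + 2) = -(k + 1) * gaussianJet k := by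
  simp only [gaussianJet, aeval_hermite]
  rw [hermiteReal_succ (k + 1), derivative_hermiteReal_succ]
  simp
  ring

lemma gaussianJet_odd (j : ℕ) : gaussianJet (2 * j + 1) = 0 := by
  induction j with
  | zero => exact gaussianJet_one
  | succ j ih => rw [show 2 * (j + 1) + 1 = 2 * j + 1 + 2 by ring, gaussianJet_add_two, ih, mul_zero]

lemma gaussianJet_even (j : ℕ) :
    gaussianJet (2 * j) / ((2 * j).factorial : ℝ) = (-1 / 2) ^ j / (j.factorial : ℝ) := by
  induction j with
  | zero => simp [gaussianJet_zero]
  | succ j ih =>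
    rw [show 2 * (j + 1) = 2 * j + 1 + 1 by ring, gaussianJet_add_two, Nat.factorial_succ,
      Nat.factorial_succ, Nat.factorial_succ, pow_succ]
    have h : gaussianJet (2 * j) = (-1 / 2) ^ j / (j.factorial : ℝ) * ((2 * j).factorial : ℝ) := by
      rw [← ih]; field_simp
    rw [h]
    push_cast
    field_simp
    ring

/-- The two-step recursion multiplies the left side by `(k + 1)²` and the right side by the larger
`(k + 2)(k + 1)`. -/
lemma abs_gaussianJet_sq_le (k : ℕ) : gaussianJet k ^ 2 ≤ k.factorial := by
  induction k using Nat.twoStepInduction with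
  | zero => simp [gaussianJet_zero]
  | one => simp [gaussianJet_one]
  | more k ih _ =>
    rw [gaussianJet_add_two, mul_pow, Nat.factorial_succ, Nat.factorial_succ]
    push_cast
    have h : (0 : ℝ) ≤ k.factorial := by positivity
    nlinarith [mul_le_mul_of_nonneg_left ih (sq_nonneg ((k : ℝ) + 1)),
      mul_nonneg h (Nat.cast_nonneg (α := ℝ) k)]

lemma sum_gaussianJet_even (t : ℝ) (J : ℕ) :
    ∑ k ∈ Finset.range (2 * J), gaussianJet k / (k.factorial : ℝ) * t ^ k
      = ∑ j ∈ Finset.range J, (-(t ^ 2 / 2)) ^ j / (j.factorial : ℝ) := by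
  induction J with
  | zero => simp
  | succ J ih =>
    rw [show 2 * (J + 1) = 2 * J + 1 + 1 by ring, Finset.sum_range_succ, Finset.sum_range_succ, ih,
      Finset.sum_range_succ, gaussianJet_odd, gaussianJet_even]
    rw [show -(t ^ 2 / 2) = (-1 / 2) * t ^ 2 by ring, mul_pow, pow_mul]
    ring

/-- Odd jets vanish, so `N` may be rounded up to an even `2 J`; the sum is then a partial
exponential series at `-t²/2` with `J ≥ N/2` terms. -/
lemma abs_exp_sub_sum_gaussianJet_le (t : ℝ) (N : ℕ) :
    |Real.exp (-t ^ 2 / 2) - ∑ k ∈ Finset.range N, gaussianJet k / (k.factorial : ℝ) * t ^ k|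
      ≤ Real.exp ((Real.exp 1 * t ^ 2 - N) / 2) := by
  obtain ⟨J, hJ, hN⟩ : ∃ J : ℕ, (N : ℝ) ≤ 2 * J ∧
      ∑ k ∈ Finset.range N, gaussianJet k / (k.factorial : ℝ) * t ^ k
        = ∑ k ∈ Finset.range (2 * J), gaussianJet k / (k.factorial : ℝ) * t ^ k := by
    obtain ⟨J, hJ | hJ⟩ := Nat.even_or_odd' N
    · exact ⟨J, by simp [hJ], by rw [hJ]⟩
    · refine ⟨J + 1, by rw [hJ]; push_cast; linarith, ?_⟩
      rw [show 2 * (J + 1) = N + 1 by omega, Finset.sum_range_succ, hJ, gaussianJet_odd]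
      simp
  rw [hN, sum_gaussianJet_even, show -t ^ 2 / 2 = -(t ^ 2 / 2) by ring]
  refine (abs_exp_neg_sub_sum_le (by positivity) J).trans (Real.exp_le_exp.2 ?_)
  linarith

/-- Taylor polynomial at `0`, of order `N + 1`, of `G(·, β)`. -/
noncomputable def taylorG (N : ℕ) (β ω : ℝ) : ℝ :=
  lossG 0 β + (stdNormalCDF 0 - β) * ω
    + stdNormalPDF 0 * ∑ k ∈ Finset.range N, gaussianJet k / ((k + 2).factorial : ℝ) * ω ^ (k + 2)

lemma hasDerivAt_sum_pow_succ (N : ℕ) (c : ℕ → ℝ) (p : ℕ) (t : ℝ) :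
    HasDerivAt (fun t => ∑ k ∈ Finset.range N, c k / ((k + (p + 1)).factorial : ℝ) * t ^ (k + (p + 1)))
      (∑ k ∈ Finset.range N, c k / ((k + p).factorial : ℝ) * t ^ (k + p)) t := by
  refine HasDerivAt.fun_sum fun k _ => ?_
  refine ((hasDerivAt_pow (k + (p + 1)) t).const_mul _).congr_deriv ?_
  rw [← add_assoc, Nat.factorial_succ, Nat.add_sub_cancel]
  push_cast
  have : (k : ℝ) + p + 1 ≠ 0 := by positivity
  field_simp

/-- The second derivative of the error is the Taylor error of the normal density, which is at most
the exponential factor on `[-|ω|, |ω|]`. The error and its first derivative vanish at `0`, so two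
applications of the mean value inequality contribute `|ω|` each. -/
lemma abs_lossG_sub_taylorG_le (N : ℕ) (β ω : ℝ) :
    |lossG ω β - taylorG N β ω| ≤ ω ^ 2 * Real.exp ((Real.exp 1 * ω ^ 2 - N) / 2) := by
  set δ := Real.exp ((Real.exp 1 * ω ^ 2 - N) / 2) with hδ
  have hδ0 : 0 < δ := Real.exp_pos _
  let f : ℝ → ℝ := fun t => lossG t β - taylorG N β t
  let f1 : ℝ → ℝ := fun t => stdNormalCDF t - stdNormalCDF 0
    - stdNormalPDF 0 * ∑ k ∈ Finset.range N, gaussianJet k / ((k + 1).factorial : ℝ) * t ^ (k + 1)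
  let f2 : ℝ → ℝ := fun t => stdNormalPDF t
    - stdNormalPDF 0 * ∑ k ∈ Finset.range N, gaussianJet k / (k.factorial : ℝ) * t ^ k
  have hf : ∀ t, HasDerivAt f (f1 t) t := by
    intro t
    have h1 := (hasDerivAt_normalGain t).sub ((hasDerivAt_id t).const_mul β)
    have h2 := (((hasDerivAt_id t).const_mul (stdNormalCDF 0 - β)).const_add (lossG 0 β)).add
      ((hasDerivAt_sum_pow_succ N gaussianJet 1 t).const_mul (stdNormalPDF 0))
    refine (h1.sub h2).congr_deriv ?_
    simp only [f1]
    ring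
  have hf1 : ∀ t, HasDerivAt f1 (f2 t) t := by
    intro t
    exact ((hasDerivAt_stdNormalCDF t).sub_const _).sub
      ((hasDerivAt_sum_pow_succ N gaussianJet 0 t).const_mul (stdNormalPDF 0))
  have hb2 : ∀ t ∈ Set.Icc (-|ω|) |ω|, ‖f2 t‖ ≤ δ := by
    intro t ht
    have ht2 : t ^ 2 ≤ ω ^ 2 := sq_le_sq.2 (abs_le.2 ht)
    have h1 : f2 t = stdNormalPDF 0 * (Real.exp (-t ^ 2 / 2)
        - ∑ k ∈ Finset.range N, gaussianJet k / (k.factorial : ℝ) * t ^ k) := by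
      simp only [f2]
      rw [stdNormalPDF_eq_zero_mul_exp t]
      ring
    rw [h1, norm_mul, Real.norm_eq_abs, Real.norm_eq_abs, abs_of_nonneg (stdNormalPDF_nonneg 0)]
    refine (mul_le_of_le_one_left (abs_nonneg _) stdNormalPDF_zero_le_one).trans ?_
    refine (abs_exp_sub_sum_gaussianJet_le t N).trans (Real.exp_le_exp.2 ?_)
    gcongr
  have h0 : (0 : ℝ) ∈ Set.Icc (-|ω|) |ω| := ⟨by simp, abs_nonneg _⟩
  have hb1 : ∀ t ∈ Set.Icc (-|ω|) |ω|, ‖f1 t‖ ≤ δ * |ω| := by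
    intro t ht
    have h := (convex_Icc (-|ω|) |ω|).norm_image_sub_le_of_norm_hasDerivWithin_le
      (fun x _ => (hf1 x).hasDerivWithinAt) hb2 h0 ht
    have e : f1 0 = 0 := by simp [f1]
    rw [e, sub_zero, sub_zero] at h
    exact h.trans (mul_le_mul_of_nonneg_left (abs_le.2 ht) hδ0.le)
  have h := (convex_Icc (-|ω|) |ω|).norm_image_sub_le_of_norm_hasDerivWithin_le
    (fun x _ => (hf x).hasDerivWithinAt) hb1 h0 (y := ω) ⟨neg_abs_le ω, le_abs_self ω⟩
  have e : f 0 = 0 := by simp [f, taylorG]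
  rw [e, sub_zero, sub_zero, Real.norm_eq_abs, Real.norm_eq_abs] at h
  refine h.trans (le_of_eq ?_)
  rw [mul_assoc, ← sq, sq_abs, mul_comm]

/-! ### The unbiased estimate of the Taylor polynomial -/

lemma exists_polynomial_scaledHermite (k : ℕ) (s : ℝ) :
    ∃ P : Polynomial ℝ, ∀ u, scaledHermite k s u = P.eval u := by
  refine ⟨∑ j ∈ Finset.range (k + 1), Polynomial.C ((Polynomial.hermite k).coeff j : ℝ)
    * Polynomial.X ^ j * Polynomial.C (s ^ (k - j)), fun u => ?_⟩
  simp [scaledHermite, Polynomial.eval_finsetSum]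

/-- The estimate of `taylorG N β ω` from one observation `u ~ N(ω, s ^ 2)`. -/
noncomputable def hermiteEstimate (N : ℕ) (β s u : ℝ) : ℝ :=
  lossG 0 β + (stdNormalCDF 0 - β) * u
    + stdNormalPDF 0 * ∑ k ∈ Finset.range N,
        gaussianJet k / ((k + 2).factorial : ℝ) * scaledHermite (k + 2) s u

lemma exists_polynomial_hermiteEstimate (N : ℕ) (β s : ℝ) :
    ∃ P : Polynomial ℝ, ∀ u, hermiteEstimate N β s u = P.eval u := by
  choose P hP using fun k => exists_polynomial_scaledHermite k s
  refine ⟨Polynomial.C (lossG 0 β) + Polynomial.C (stdNormalCDF 0 - β) * Polynomial.X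
    + Polynomial.C (stdNormalPDF 0) * ∑ k ∈ Finset.range N,
      Polynomial.C (gaussianJet k / ((k + 2).factorial : ℝ)) * P (k + 2), fun u => ?_⟩
  simp [hermiteEstimate, Polynomial.eval_finsetSum, hP]

lemma integrable_scaledHermite (k : ℕ) (s ω : ℝ) (v : NNReal) :
    Integrable (scaledHermite k s) (gaussianReal ω v) := by
  obtain ⟨P, hP⟩ := exists_polynomial_scaledHermite k s
  rw [funext hP]
  exact integrable_eval_gaussianReal ω v P

lemma integrable_scaledHermite_sq (k : ℕ) (s ω : ℝ) (v : NNReal) :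
    Integrable (fun u => scaledHermite k s u ^ 2) (gaussianReal ω v) := by
  obtain ⟨P, hP⟩ := exists_polynomial_scaledHermite k s
  simp_rw [hP, ← Polynomial.eval_pow]
  exact integrable_eval_gaussianReal ω v (P ^ 2)

lemma continuous_hermiteEstimate (N : ℕ) (β s : ℝ) : Continuous (hermiteEstimate N β s) := by
  obtain ⟨P, hP⟩ := exists_polynomial_hermiteEstimate N β s
  rw [funext hP]
  fun_prop

lemma integrable_hermiteEstimate (N : ℕ) (β s ω : ℝ) (v : NNReal) :
    Integrable (hermiteEstimate N β s) (gaussianReal ω v) := by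
  obtain ⟨P, hP⟩ := exists_polynomial_hermiteEstimate N β s
  rw [funext hP]
  exact integrable_eval_gaussianReal ω v P

lemma integrable_hermiteEstimate_sq (N : ℕ) (β s ω : ℝ) (v : NNReal) :
    Integrable (fun u => hermiteEstimate N β s u ^ 2) (gaussianReal ω v) := by
  obtain ⟨P, hP⟩ := exists_polynomial_hermiteEstimate N β s
  simp_rw [hP, ← Polynomial.eval_pow]
  exact integrable_eval_gaussianReal ω v (P ^ 2)

lemma integral_hermiteEstimate (N : ℕ) (β ω : ℝ) {s : ℝ} (hs : 0 < s) :
    ∫ u, hermiteEstimate N β s u ∂(gaussianReal ω (s ^ 2).toNNReal) = taylorG N β ω := by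
  have hi : ∀ k ∈ Finset.range N, Integrable
      (fun u => gaussianJet k / ((k + 2).factorial : ℝ) * scaledHermite (k + 2) s u)
      (gaussianReal ω (s ^ 2).toNNReal) := fun k _ =>
    (integrable_scaledHermite (k + 2) s ω _).const_mul _
  have hl := (integrable_id_gaussianReal ω (s ^ 2).toNNReal).const_mul (stdNormalCDF 0 - β)
  have hl' : Integrable (fun u => lossG 0 β + (stdNormalCDF 0 - β) * u)
      (gaussianReal ω (s ^ 2).toNNReal) := (integrable_const _).add hl
  simp only [hermiteEstimate]
  rw [integral_add hl' ((integrable_finsetSum _ hi).const_mul _),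
    integral_add (integrable_const _) hl, integral_const_mul, integral_const_mul,
    integral_finsetSum _ hi]
  simp only [integral_const_mul, integral_scaledHermite _ ω hs, integral_id_gaussianReal]
  simp [taylorG]

lemma integral_sq_gaussianReal (ω : ℝ) (s : ℝ) :
    ∫ u, u ^ 2 ∂(gaussianReal ω (s ^ 2).toNNReal) = ω ^ 2 + s ^ 2 := by
  have h := integral_sub_sq_gaussianReal ω (s ^ 2).toNNReal
  have e : (fun u : ℝ => u ^ 2) = fun u => (u - ω) ^ 2 + (2 * ω * u - ω ^ 2) := by
    ext u; ring
  have hi := (integrable_id_gaussianReal ω (s ^ 2).toNNReal).const_mul (2 * ω)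
  have hi' : Integrable (fun u => 2 * ω * u - ω ^ 2) (gaussianReal ω (s ^ 2).toNNReal) :=
    hi.sub (integrable_const _)
  rw [e, integral_add (integrable_sub_sq_gaussianReal _ _ _) hi', h,
    integral_sub hi (integrable_const _), integral_const_mul, integral_id_gaussianReal,
    Real.coe_toNNReal _ (sq_nonneg s)]
  simp
  ring

/-- The squared coefficient of each Hermite term is at most `k! / (k + 2)!²`, which offsets the
factor `(k + 2)!` in its second moment; every term then costs at most `exp(e ω²)`. Cauchy–Schwarz
over the `N` terms gives the `N²`. -/
lemma integral_hermiteEstimate_sq_le (N : ℕ) {β : ℝ} (h0 : 0 ≤ β) (h1 : β ≤ 1) (ω : ℝ) {s : ℝ}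
    (hs : 0 < s) (hs2 : 2 * s ^ 2 ≤ Real.exp (-1)) :
    ∫ u, hermiteEstimate N β s u ^ 2 ∂(gaussianReal ω (s ^ 2).toNNReal)
      ≤ (8 + 2 * (N : ℝ) ^ 2) * Real.exp (Real.exp 1 * ω ^ 2) := by
  set μ := gaussianReal ω (s ^ 2).toNNReal with hμ
  set q : ℕ → ℝ → ℝ := fun k u =>
    gaussianJet k / ((k + 2).factorial : ℝ) * scaledHermite (k + 2) s u with hq
  have hi : ∀ k, Integrable (fun u => q k u ^ 2) μ := fun k => by
    simp only [hq, mul_pow]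
    exact (integrable_scaledHermite_sq (k + 2) s ω _).const_mul _
  have hsum : ∀ k, ∫ u, q k u ^ 2 ∂μ ≤ Real.exp (Real.exp 1 * ω ^ 2) := fun k => by
    simp only [hq, mul_pow]
    rw [integral_const_mul]
    have h2 := integral_scaledHermite_sq_le (k + 2) ω hs hs2
    have h3 := abs_gaussianJet_sq_le k
    have h4 : (k.factorial : ℝ) ≤ ((k + 2).factorial : ℝ) := by
      exact_mod_cast Nat.factorial_le (by omega)
    have h5 : (gaussianJet k / ((k + 2).factorial : ℝ)) ^ 2 * ((k + 2).factorial : ℝ) ≤ 1 := by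
      rw [div_pow, sq ((k + 2).factorial : ℝ), div_mul_eq_mul_div, div_le_one (by positivity)]
      exact mul_le_mul_of_nonneg_right (h3.trans h4) (by positivity)
    calc _ ≤ (gaussianJet k / ((k + 2).factorial : ℝ)) ^ 2
          * (((k + 2).factorial : ℝ) * Real.exp (Real.exp 1 * ω ^ 2)) := by gcongr
      _ = ((gaussianJet k / ((k + 2).factorial : ℝ)) ^ 2 * ((k + 2).factorial : ℝ))
          * Real.exp (Real.exp 1 * ω ^ 2) := by ring
      _ ≤ _ := mul_le_of_le_one_left (Real.exp_pos _).le h5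
  have hpt : ∀ u, hermiteEstimate N β s u ^ 2
      ≤ 4 + 4 * u ^ 2 + 2 * N * ∑ k ∈ Finset.range N, q k u ^ 2 := by
    intro u
    have c1 := sq_sum_le_card_mul_sum_sq (s := Finset.range N) (f := fun k => q k u)
    rw [Finset.card_range] at c1
    have p0 := stdNormalPDF_nonneg 0
    have p1 := stdNormalPDF_zero_le_one
    have d : |stdNormalCDF 0 - β| ≤ 1 := by
      rw [abs_le]
      constructor <;> linarith [stdNormalCDF_nonneg 0, stdNormalCDF_le_one 0]
    have e : hermiteEstimate N β s u
        = lossG 0 β + (stdNormalCDF 0 - β) * u + stdNormalPDF 0 * ∑ k ∈ Finset.range N, q k u := rfl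
    have a1 : lossG 0 β ^ 2 ≤ 1 := by
      have : lossG 0 β = stdNormalPDF 0 := by simp [lossG]
      rw [this]; nlinarith
    have a2 : ((stdNormalCDF 0 - β) * u) ^ 2 ≤ u ^ 2 := by
      rw [mul_pow]
      exact mul_le_of_le_one_left (sq_nonneg u) ((sq_le_one_iff_abs_le_one _).2 d)
    have a3 : (stdNormalPDF 0 * ∑ k ∈ Finset.range N, q k u) ^ 2
        ≤ N * ∑ k ∈ Finset.range N, q k u ^ 2 := by
      rw [mul_pow]
      exact (mul_le_of_le_one_left (sq_nonneg _) (by nlinarith)).trans c1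
    rw [e]
    nlinarith [sq_nonneg (lossG 0 β - (stdNormalCDF 0 - β) * u),
      sq_nonneg (lossG 0 β + (stdNormalCDF 0 - β) * u
        - stdNormalPDF 0 * ∑ k ∈ Finset.range N, q k u)]
  have hu2 : Integrable (fun u : ℝ => u ^ 2) μ := integrable_pow_gaussianReal _ _ 2
  have hS : Integrable (fun u => ∑ k ∈ Finset.range N, q k u ^ 2) μ :=
    integrable_finsetSum _ fun k _ => hi k
  have hI : Integrable (fun u => 4 + 4 * u ^ 2) μ := (integrable_const _).add (hu2.const_mul _)
  refine (integral_mono (integrable_hermiteEstimate_sq N β s ω _)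
    (hI.add (hS.const_mul _)) hpt).trans ?_
  simp only [Pi.add_apply]
  rw [integral_add hI (hS.const_mul _), integral_add (integrable_const _) (hu2.const_mul _),
    integral_const_mul, integral_const_mul, hμ, integral_sq_gaussianReal,
    integral_finsetSum _ fun k _ => hi k]
  have h6 : ∑ k ∈ Finset.range N, ∫ u, q k u ^ 2 ∂μ ≤ N * Real.exp (Real.exp 1 * ω ^ 2) := by
    refine (Finset.sum_le_sum fun k _ => hsum k).trans ?_
    simp
  have h7 : Real.exp 1 * ω ^ 2 + 1 ≤ Real.exp (Real.exp 1 * ω ^ 2) := Real.add_one_le_exp _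
  have h8 : (1 : ℝ) ≤ Real.exp 1 := Real.one_le_exp zero_le_one
  have h9 : s ^ 2 ≤ 1 := by
    have : Real.exp (-1) ≤ 1 := Real.exp_le_one_iff.2 (by norm_num)
    linarith
  have h10 : 2 * (N : ℝ) * ∑ k ∈ Finset.range N, ∫ u, q k u ^ 2 ∂μ
      ≤ 2 * (N : ℝ) * (N * Real.exp (Real.exp 1 * ω ^ 2)) := by gcongr
  have h11 : ω ^ 2 ≤ Real.exp 1 * ω ^ 2 := le_mul_of_one_le_left (sq_nonneg ω) h8
  simp only [integral_const, probReal_univ, smul_eq_mul, one_mul]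
  nlinarith

/-! ### Clipping and selection by a threshold -/

/-- Truncation of `x` to `[-n, n]`. -/
noncomputable def clip (n x : ℝ) : ℝ := max (-n) (min n x)

@[fun_prop]
lemma continuous_clip (n : ℝ) : Continuous (clip n) := by
  unfold clip
  fun_prop

lemma abs_clip_le {n : ℝ} (hn : 0 ≤ n) (x : ℝ) : |clip n x| ≤ n := by
  rw [abs_le]
  exact ⟨le_max_left _ _, max_le (by linarith) (min_le_left _ _)⟩

lemma clip_sq_le {n : ℝ} (hn : 0 ≤ n) (x : ℝ) : clip n x ^ 2 ≤ x ^ 2 := by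
  refine sq_le_sq.2 ?_
  unfold clip
  rcases le_total 0 x with hx | hx
  · rw [max_eq_right (by have := le_min hn hx; linarith), abs_of_nonneg (le_min hn hx),
      abs_of_nonneg hx]
    exact min_le_right _ _
  · rw [min_eq_right (by linarith), abs_of_nonpos (max_le (by linarith) hx), abs_of_nonpos hx]
    exact neg_le_neg (le_max_right _ _)

/-- Clipping acts only where `|x| > n`, and there `|x| ≤ x² / n`. This bounds the bias due to
clipping by a second moment. -/
lemma abs_clip_sub_le {n : ℝ} (hn : 0 < n) (x : ℝ) : |clip n x - x| ≤ x ^ 2 / n := by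
  rw [le_div_iff₀ hn]
  by_cases h : |x| ≤ n
  · obtain ⟨h1, h2⟩ := abs_le.1 h
    rw [clip, min_eq_right h2, max_eq_right h1, sub_self, abs_zero, zero_mul]
    positivity
  · push Not at h
    rw [clip, ← sq_abs x]
    rcases le_total 0 x with hx | hx
    · rw [abs_of_nonneg hx] at h ⊢
      rw [min_eq_left h.le, max_eq_right (by linarith), abs_of_nonpos (by linarith)]
      nlinarith
    · rw [abs_of_nonpos hx] at h ⊢
      rw [min_eq_right (by linarith), max_eq_left (by linarith), abs_of_nonneg (by linarith)]
      nlinarith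

/-- `a`, `b` or `c` according to whether `v < -l`, `|v| ≤ l` or `v > l`. -/
noncomputable def selectBy (l v a b c : ℝ) : ℝ := if v < -l then a else if v ≤ l then b else c

/-- As a sum of products with indicators of `v`, the selection integrates factor by factor against a
product measure. -/
lemma selectBy_eq_indicator {l : ℝ} (hl : 0 ≤ l) (v a b c : ℝ) :
    selectBy l v a b c = a * (Set.Iio (-l)).indicator 1 v
      + b * (Set.Icc (-l) l).indicator 1 v + c * (Set.Ioi l).indicator 1 v := by
  unfold selectBy
  split_ifs with h1 h2
  · have h3 : ¬ (-l ≤ v) := not_le.2 h1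
    have h4 : ¬ (l < v) := by linarith
    simp [h1, h3, h4]
  · have h3 : -l ≤ v := not_lt.1 h1
    have h4 : ¬ (l < v) := not_lt.2 h2
    simp [h1, h2, h3, h4]
  · have h4 : l < v := not_le.1 h2
    simp [h1, h2, h4]

lemma map_selectBy (f : ℝ → ℝ) (l v a b c : ℝ) :
    f (selectBy l v a b c) = selectBy l v (f a) (f b) (f c) := by
  unfold selectBy
  split_ifs <;> rfl

lemma integrable_selectBy {μ ν : Measure ℝ} [IsProbabilityMeasure μ] [IsProbabilityMeasure ν]
    {l : ℝ} (hl : 0 ≤ l) {F₁ F₂ F₃ : ℝ → ℝ} (h₁ : Integrable F₁ μ) (h₂ : Integrable F₂ μ)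
    (h₃ : Integrable F₃ μ) :
    Integrable (fun p : ℝ × ℝ => selectBy l p.2 (F₁ p.1) (F₂ p.1) (F₃ p.1)) (μ.prod ν) := by
  simp only [selectBy_eq_indicator hl]
  have hi : ∀ s : Set ℝ, MeasurableSet s → Integrable (s.indicator (1 : ℝ → ℝ)) ν := fun s hs =>
    (integrable_const (1 : ℝ)).indicator hs
  exact ((h₁.mul_prod (hi _ measurableSet_Iio)).add (h₂.mul_prod (hi _ measurableSet_Icc))).add
    (h₃.mul_prod (hi _ measurableSet_Ioi))

lemma integral_selectBy {μ ν : Measure ℝ} [IsProbabilityMeasure μ] [IsProbabilityMeasure ν]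
    {l : ℝ} (hl : 0 ≤ l) {F₁ F₂ F₃ : ℝ → ℝ} (h₁ : Integrable F₁ μ) (h₂ : Integrable F₂ μ)
    (h₃ : Integrable F₃ μ) :
    ∫ p : ℝ × ℝ, selectBy l p.2 (F₁ p.1) (F₂ p.1) (F₃ p.1) ∂(μ.prod ν)
      = (∫ u, F₁ u ∂μ) * ν.real (Set.Iio (-l)) + (∫ u, F₂ u ∂μ) * ν.real (Set.Icc (-l) l)
        + (∫ u, F₃ u ∂μ) * ν.real (Set.Ioi l) := by
  simp only [selectBy_eq_indicator hl]
  have hi : ∀ s : Set ℝ, MeasurableSet s → Integrable (s.indicator (1 : ℝ → ℝ)) ν := fun s hs =>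
    (integrable_const (1 : ℝ)).indicator hs
  have e₁ := h₁.mul_prod (hi _ (measurableSet_Iio (a := -l)))
  have e₂ := h₂.mul_prod (hi _ (measurableSet_Icc (a := -l) (b := l)))
  have e₃ := h₃.mul_prod (hi _ (measurableSet_Ioi (a := l)))
  have e₁₂ : Integrable (fun p : ℝ × ℝ => F₁ p.1 * (Set.Iio (-l)).indicator 1 p.2
      + F₂ p.1 * (Set.Icc (-l) l).indicator 1 p.2) (μ.prod ν) := e₁.add e₂
  rw [integral_add e₁₂ e₃, integral_add e₁ e₂, integral_prod_mul, integral_prod_mul,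
    integral_prod_mul, integral_indicator_one measurableSet_Iio,
    integral_indicator_one measurableSet_Icc, integral_indicator_one measurableSet_Ioi]

lemma measureReal_threshold_add {ν : Measure ℝ} [IsProbabilityMeasure ν] {l : ℝ} (hl : 0 ≤ l) :
    ν.real (Set.Iio (-l)) + ν.real (Set.Icc (-l) l) + ν.real (Set.Ioi l) = 1 := by
  have h := integral_selectBy (μ := ν) (ν := ν) hl (F₁ := fun _ => 1) (F₂ := fun _ => 1)
    (F₃ := fun _ => 1) (integrable_const _) (integrable_const _) (integrable_const _)
  have e : ∀ v : ℝ, selectBy l v 1 1 1 = 1 := fun v => by simp [selectBy]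
  simpa [e] using h.symm

/-! ### Tail terms -/

/-- The product is the probability of falling below `-l` times the error of the asymptote used
there. If `ω ≤ -l/2`, the gain itself is a Gaussian tail. If `ω > -l/2`, the point `-l` lies at
least `l` standard deviations below `ω` because `s ≤ 1/2`, and the probability is small enough to
absorb the linear growth of the gain. -/
lemma stdNormalCDF_mul_normalGain_le {l s ω : ℝ} (hl : 1 ≤ l) (hs : 0 < s) (hs2 : s ≤ 1 / 2) :
    stdNormalCDF ((-l - ω) / s) * normalGain ω ≤ 16 * Real.exp (-l ^ 2 / 8) ∧
    stdNormalCDF ((-l - ω) / s) * normalGain ω ^ 2 ≤ 16 * Real.exp (-l ^ 2 / 8) := by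
  have g0 := normalGain_nonneg ω
  have c0 := stdNormalCDF_nonneg ((-l - ω) / s)
  have c1 := stdNormalCDF_le_one ((-l - ω) / s)
  have E0 := Real.exp_pos (-l ^ 2 / 8)
  rcases le_or_gt ω (-l / 2) with h | h
  · have hg : normalGain ω ≤ Real.exp (-l ^ 2 / 8) :=
      (normalGain_le_exp (by linarith)).trans (Real.exp_le_exp.2 (by nlinarith))
    have hE : Real.exp (-l ^ 2 / 8) ≤ 1 := Real.exp_le_one_iff.2 (by nlinarith)
    constructor
    · calc _ ≤ 1 * normalGain ω := mul_le_mul_of_nonneg_right c1 g0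
        _ ≤ _ := by linarith
    · calc _ ≤ 1 * normalGain ω ^ 2 := mul_le_mul_of_nonneg_right c1 (sq_nonneg _)
        _ ≤ _ := by nlinarith
  · set t := (l + ω) / s with ht
    have htl : 2 * (l + ω) ≤ t := by
      rw [ht, le_div_iff₀ hs]
      nlinarith
    have ht1 : l ≤ t := by linarith
    have hω : |ω| ≤ t := abs_le.2 ⟨by linarith, by linarith⟩
    have hg : normalGain ω ≤ 1 + t := (normalGain_le ω).trans (by linarith)
    have hc : stdNormalCDF ((-l - ω) / s) ≤ Real.exp (-t ^ 2 / 2) := by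
      rw [show (-l - ω) / s = -t by rw [ht]; ring]
      refine (stdNormalCDF_neg_le (by linarith)).trans ?_
      exact div_le_self (Real.exp_pos _).le (by linarith)
    have h16 : (1 + t) ^ 2 * Real.exp (-t ^ 2 / 2) ≤ 16 * Real.exp (-l ^ 2 / 8) := by
      have e1 : Real.exp (-t ^ 2 / 2) = Real.exp (-t ^ 2 / 4) * Real.exp (-t ^ 2 / 4) := by
        rw [← Real.exp_add]; ring_nf
      have e2 : (1 + t) ^ 2 * Real.exp (-t ^ 2 / 4) ≤ 16 := by
        have := Real.add_one_le_exp (t ^ 2 / 4)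
        have e3 : Real.exp (-t ^ 2 / 4) = (Real.exp (t ^ 2 / 4))⁻¹ := by
          rw [← Real.exp_neg]; ring_nf
        rw [e3, ← div_eq_mul_inv, div_le_iff₀ (Real.exp_pos _)]
        nlinarith [sq_nonneg (t - 1), sq_nonneg t]
      have e4 : Real.exp (-t ^ 2 / 4) ≤ Real.exp (-l ^ 2 / 8) := Real.exp_le_exp.2 (by nlinarith)
      rw [e1, ← mul_assoc]
      exact mul_le_mul e2 e4 (Real.exp_pos _).le (by norm_num)
    have hsq : stdNormalCDF ((-l - ω) / s) * (1 + t) ^ 2 ≤ 16 * Real.exp (-l ^ 2 / 8) := by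
      rw [mul_comm]
      exact (mul_le_mul_of_nonneg_left hc (sq_nonneg _)).trans h16
    constructor
    · refine (mul_le_mul_of_nonneg_left ?_ c0).trans hsq
      nlinarith
    · refine (mul_le_mul_of_nonneg_left ?_ c0).trans hsq
      nlinarith

lemma gaussianReal_real_Iio_le (ω : ℝ) {s : ℝ} (hs : 0 < s) (l : ℝ) :
    (gaussianReal ω (s ^ 2).toNNReal).real (Set.Iio (-l)) ≤ stdNormalCDF ((-l - ω) / s) := by
  have h := gaussianReal_real_Iic ω (pow_pos hs 2) (-l)
  rw [Real.sqrt_sq hs.le] at h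
  rw [← h]
  exact measureReal_mono Set.Iio_subset_Iic_self

lemma gaussianReal_real_Ioi_eq' (ω : ℝ) {s : ℝ} (hs : 0 < s) (l : ℝ) :
    (gaussianReal ω (s ^ 2).toNNReal).real (Set.Ioi l) = stdNormalCDF ((ω - l) / s) := by
  rw [gaussianReal_real_Ioi_eq ω (pow_pos hs 2), Real.sqrt_sq hs.le]

/-- Enlarging the interval to the half-line ending at `l` or at `-l`, on the side towards `ω`,
leaves a single tail. -/
lemma gaussianReal_real_Icc_le (ω : ℝ) {s : ℝ} (hs : 0 < s) (l : ℝ) :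
    (gaussianReal ω (s ^ 2).toNNReal).real (Set.Icc (-l) l)
      ≤ stdNormalCDF (-((|ω| - l) / s)) := by
  have : NullSingletonClass (gaussianReal ω (s ^ 2).toNNReal) :=
    nullSingletonClass_gaussianReal (by simpa using (pow_pos hs 2).ne')
  rcases le_total 0 ω with hω | hω
  · rw [abs_of_nonneg hω]
    have h1 := gaussianReal_real_Iic ω (pow_pos hs 2) l
    rw [Real.sqrt_sq hs.le] at h1
    rw [show -((ω - l) / s) = (l - ω) / s by ring, ← h1]
    exact measureReal_mono Set.Icc_subset_Iic_self
  · rw [abs_of_nonpos hω]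
    have h1 := gaussianReal_real_Ioi_eq' ω hs (-l)
    rw [show -((-ω - l) / s) = (ω - -l) / s by ring, ← h1, measureReal_congr Ioi_ae_eq_Ici]
    exact measureReal_mono Set.Icc_subset_Ici_self

/-! ### Bias and second moment of the randomized estimate -/

/-- The randomized estimate of `G(ω, β)` from independent `u, v ~ N(ω, s ^ 2)`. -/
noncomputable def selectEstimate (n l : ℝ) (N : ℕ) (β s : ℝ) (p : ℝ × ℝ) : ℝ :=
  selectBy l p.2 (-β * p.1) (clip n (hermiteEstimate N β s p.1)) ((1 - β) * p.1)

section

variable {n l β s : ℝ} (N : ℕ) (ω : ℝ)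

lemma integrable_clip_hermiteEstimate (hn : 0 ≤ n) (v : NNReal) :
    Integrable (fun u => clip n (hermiteEstimate N β s u)) (gaussianReal ω v) := by
  have := continuous_hermiteEstimate N β s
  refine (integrable_const n).mono' (by fun_prop) (ae_of_all _ fun u => ?_)
  exact abs_clip_le hn _

lemma integrable_clip_hermiteEstimate_sub_sq (hn : 0 ≤ n) (v : NNReal) (c : ℝ) :
    Integrable (fun u => (clip n (hermiteEstimate N β s u) - c) ^ 2) (gaussianReal ω v) := by
  have := continuous_hermiteEstimate N β s
  refine (integrable_const ((n + |c|) ^ 2)).mono' (by fun_prop) (ae_of_all _ fun u => ?_)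
  rw [Real.norm_eq_abs, abs_of_nonneg (sq_nonneg _)]
  refine sq_le_sq' ?_ ?_ <;>
  linarith [abs_le.1 (abs_clip_le hn (hermiteEstimate N β s u)), neg_abs_le c, le_abs_self c]

lemma integrable_selectEstimate (hn : 0 ≤ n) (hl : 0 ≤ l) (v : NNReal) :
    Integrable (selectEstimate n l N β s) ((gaussianReal ω v).prod (gaussianReal ω v)) :=
  integrable_selectBy hl ((integrable_id_gaussianReal ω v).const_mul _)
    (integrable_clip_hermiteEstimate N ω hn v) ((integrable_id_gaussianReal ω v).const_mul _)

lemma integrable_affine_sub_sq (v : NNReal) (a c : ℝ) :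
    Integrable (fun u : ℝ => (a * u - c) ^ 2) (gaussianReal ω v) := by
  have e : (fun u : ℝ => (a * u - c) ^ 2) = fun u =>
      (Polynomial.C (a ^ 2) * Polynomial.X ^ 2 - Polynomial.C (2 * a * c) * Polynomial.X
        + Polynomial.C (c ^ 2)).eval u := by
    ext u
    simp
    ring
  rw [e]
  exact integrable_eval_gaussianReal ω v _

lemma integrable_selectEstimate_sub_sq (hn : 0 ≤ n) (hl : 0 ≤ l) (v : NNReal) (c : ℝ) :
    Integrable (fun p => (selectEstimate n l N β s p - c) ^ 2)
      ((gaussianReal ω v).prod (gaussianReal ω v)) := by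
  simp only [selectEstimate, map_selectBy fun x => (x - c) ^ 2]
  exact integrable_selectBy hl (integrable_affine_sub_sq ω v _ c)
    (integrable_clip_hermiteEstimate_sub_sq N ω hn v c) (integrable_affine_sub_sq ω v _ c)

lemma integral_affine_sub_sq_le (hs : s ^ 2 ≤ 1) {a : ℝ} (ha : |a| ≤ 1) (c : ℝ) :
    ∫ u, (a * u - c) ^ 2 ∂(gaussianReal ω (s ^ 2).toNNReal) ≤ 2 + 2 * (a * ω - c) ^ 2 := by
  have h : ∀ u : ℝ, (a * u - c) ^ 2 ≤ 2 * (u - ω) ^ 2 + 2 * (a * ω - c) ^ 2 := fun u => by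
    have : a ^ 2 * (u - ω) ^ 2 ≤ (u - ω) ^ 2 :=
      mul_le_of_le_one_left (sq_nonneg _) ((sq_le_one_iff_abs_le_one a).2 ha)
    nlinarith [sq_nonneg (a * (u - ω) - (a * ω - c))]
  have hi := (integrable_sub_sq_gaussianReal ω (s ^ 2).toNNReal ω).const_mul 2
  refine (integral_mono (integrable_affine_sub_sq ω _ a c) (hi.add (integrable_const _)) h).trans ?_
  simp only [Pi.add_apply]
  rw [integral_add hi (integrable_const _), integral_const_mul, integral_sub_sq_gaussianReal,
    Real.coe_toNNReal _ (sq_nonneg s), integral_const, probReal_univ, one_smul]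
  linarith

/-- The error of the clipped estimate, used when `|v| ≤ l`. -/
lemma abs_integral_selectEstimate_sub_le (hn : 0 ≤ n) (hl : 1 ≤ l) (hs : 0 < s) (hs2 : s ≤ 1 / 2)
    {ε : ℝ} (hε : |(∫ u, clip n (hermiteEstimate N β s u) ∂(gaussianReal ω (s ^ 2).toNNReal))
        - lossG ω β| * (gaussianReal ω (s ^ 2).toNNReal).real (Set.Icc (-l) l) ≤ ε) :
    |(∫ p, selectEstimate n l N β s p
        ∂((gaussianReal ω (s ^ 2).toNNReal).prod (gaussianReal ω (s ^ 2).toNNReal))) - lossG ω β|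
      ≤ 32 * Real.exp (-l ^ 2 / 8) + ε := by
  set μ := gaussianReal ω (s ^ 2).toNNReal with hμ
  have hl0 : 0 ≤ l := by linarith
  have h1 := integral_selectBy (μ := μ) (ν := μ) hl0 (F₁ := fun u => -β * u)
    (F₂ := fun u => clip n (hermiteEstimate N β s u)) (F₃ := fun u => (1 - β) * u)
    ((integrable_id_gaussianReal ω _).const_mul _)
    (integrable_clip_hermiteEstimate N ω hn _) ((integrable_id_gaussianReal ω _).const_mul _)
  have h2 := measureReal_threshold_add (ν := μ) hl0
  have hid : ∫ u, u ∂μ = ω := integral_id_gaussianReal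
  rw [integral_const_mul, integral_const_mul, hid] at h1
  -- On the outer regions the two asymptotes miss `G(ω)` by one gain each: `-β ω - G(ω) =
  -- -normalGain ω` and `(1 - β) ω - G(ω) = -normalGain (-ω)`.
  have e : (∫ p, selectEstimate n l N β s p ∂(μ.prod μ)) - lossG ω β
      = -(μ.real (Set.Iio (-l)) * normalGain ω)
        + ((∫ u, clip n (hermiteEstimate N β s u) ∂μ) - lossG ω β) * μ.real (Set.Icc (-l) l)
        - μ.real (Set.Ioi l) * normalGain (-ω) := by
    have : ∫ p, selectEstimate n l N β s p ∂(μ.prod μ) = _ := h1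
    rw [this, ← normalGain_sub_self, lossG_eq]
    have h3 : μ.real (Set.Icc (-l) l) = 1 - μ.real (Set.Iio (-l)) - μ.real (Set.Ioi l) := by
      linarith
    rw [h3]
    ring
  have t1 := (stdNormalCDF_mul_normalGain_le (ω := ω) hl hs hs2).1
  have t2 := (stdNormalCDF_mul_normalGain_le (ω := -ω) hl hs hs2).1
  have m1 := gaussianReal_real_Iio_le ω hs l
  have m2 := gaussianReal_real_Ioi_eq' ω hs l
  rw [show (-l - -ω) / s = (ω - l) / s by ring, ← m2] at t2
  have t3 := (mul_le_mul_of_nonneg_right m1 (normalGain_nonneg ω)).trans t1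
  have z1 : 0 ≤ μ.real (Set.Iio (-l)) * normalGain ω :=
    mul_nonneg measureReal_nonneg (normalGain_nonneg _)
  have z2 : 0 ≤ μ.real (Set.Ioi l) * normalGain (-ω) :=
    mul_nonneg measureReal_nonneg (normalGain_nonneg _)
  rw [e]
  have z3 : |((∫ u, clip n (hermiteEstimate N β s u) ∂μ) - lossG ω β)
      * μ.real (Set.Icc (-l) l)| ≤ ε := by
    rw [abs_mul, abs_of_nonneg (measureReal_nonneg (μ := μ))]
    exact hε
  obtain ⟨z4, z5⟩ := abs_le.1 z3
  rw [abs_le]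
  constructor <;> linarith

lemma integral_selectEstimate_sub_sq_le (hn : 0 ≤ n) (hl : 1 ≤ l) (hs : 0 < s) (hs2 : s ≤ 1 / 2)
    (h0 : 0 ≤ β) (h1 : β ≤ 1) {ε : ℝ}
    (hε : (∫ u, (clip n (hermiteEstimate N β s u) - lossG ω β) ^ 2
        ∂(gaussianReal ω (s ^ 2).toNNReal))
        * (gaussianReal ω (s ^ 2).toNNReal).real (Set.Icc (-l) l) ≤ ε) :
    ∫ p, (selectEstimate n l N β s p - lossG ω β) ^ 2
        ∂((gaussianReal ω (s ^ 2).toNNReal).prod (gaussianReal ω (s ^ 2).toNNReal))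
      ≤ 4 + 64 * Real.exp (-l ^ 2 / 8) + ε := by
  set μ := gaussianReal ω (s ^ 2).toNNReal with hμ
  have hl0 : 0 ≤ l := by linarith
  have e1 := integral_selectBy (μ := μ) (ν := μ) hl0 (F₁ := fun u => (-β * u - lossG ω β) ^ 2)
    (F₂ := fun u => (clip n (hermiteEstimate N β s u) - lossG ω β) ^ 2)
    (F₃ := fun u => ((1 - β) * u - lossG ω β) ^ 2)
    (integrable_affine_sub_sq ω _ _ _) (integrable_clip_hermiteEstimate_sub_sq N ω hn _ _)
    (integrable_affine_sub_sq ω _ _ _)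
  simp only [selectEstimate, map_selectBy fun x => (x - lossG ω β) ^ 2]
  rw [e1]
  have hs1 : s ^ 2 ≤ 1 := by nlinarith
  have f1 := integral_affine_sub_sq_le (s := s) ω hs1 (a := -β)
    (abs_le.2 ⟨by linarith, by linarith⟩) (lossG ω β)
  have f2 := integral_affine_sub_sq_le (s := s) ω hs1 (a := 1 - β)
    (abs_le.2 ⟨by linarith, by linarith⟩) (lossG ω β)
  have g1 : (-β * ω - lossG ω β) ^ 2 = normalGain ω ^ 2 := by rw [lossG_eq]; ring
  have g2 : ((1 - β) * ω - lossG ω β) ^ 2 = normalGain (-ω) ^ 2 := by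
    rw [lossG_eq, ← normalGain_sub_self]; ring
  rw [g1] at f1
  rw [g2] at f2
  have t1 := (stdNormalCDF_mul_normalGain_le (ω := ω) hl hs hs2).2
  have t2 := (stdNormalCDF_mul_normalGain_le (ω := -ω) hl hs hs2).2
  have m1 := gaussianReal_real_Iio_le ω hs l
  have m2 := gaussianReal_real_Ioi_eq' ω hs l
  rw [show (-l - -ω) / s = (ω - l) / s by ring, ← m2] at t2
  have t3 := (mul_le_mul_of_nonneg_right m1 (sq_nonneg (normalGain ω))).trans t1
  have p1 : μ.real (Set.Iio (-l)) ≤ 1 := measureReal_le_one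
  have p2 : μ.real (Set.Ioi l) ≤ 1 := measureReal_le_one
  have q1 : 0 ≤ μ.real (Set.Iio (-l)) := measureReal_nonneg
  have q2 : 0 ≤ μ.real (Set.Ioi l) := measureReal_nonneg
  have r1 := mul_le_mul_of_nonneg_right f1 q1
  have r2 := mul_le_mul_of_nonneg_right f2 q2
  nlinarith

end

section

variable {n β s : ℝ} (N : ℕ) (ω : ℝ)

/-- Two sources of bias: clipping, paid for by the second moment over `n`, and the Taylor remainder.
-/
lemma abs_integral_clip_sub_le_of_small (hn : 0 < n) (h0 : 0 ≤ β) (h1 : β ≤ 1) (hs : 0 < s)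
    (hs2 : 2 * s ^ 2 ≤ Real.exp (-1)) :
    |(∫ u, clip n (hermiteEstimate N β s u) ∂(gaussianReal ω (s ^ 2).toNNReal)) - lossG ω β|
      ≤ (8 + 2 * (N : ℝ) ^ 2) * Real.exp (Real.exp 1 * ω ^ 2) / n
        + ω ^ 2 * Real.exp ((Real.exp 1 * ω ^ 2 - N) / 2) := by
  set μ := gaussianReal ω (s ^ 2).toNNReal with hμ
  have i1 : Integrable (fun u => clip n (hermiteEstimate N β s u)) μ :=
    integrable_clip_hermiteEstimate N ω hn.le _
  have i2 := integrable_hermiteEstimate N β s ω (s ^ 2).toNNReal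
  have i3 := integrable_hermiteEstimate_sq N β s ω (s ^ 2).toNNReal
  have e1 := integral_hermiteEstimate N β ω hs
  have e2 := integral_hermiteEstimate_sq_le N h0 h1 ω hs hs2
  have e3 := abs_lossG_sub_taylorG_le N β ω
  have e4 : |(∫ u, clip n (hermiteEstimate N β s u) ∂μ) - taylorG N β ω|
      ≤ (8 + 2 * (N : ℝ) ^ 2) * Real.exp (Real.exp 1 * ω ^ 2) / n := by
    rw [← e1, ← integral_sub i1 i2]
    refine (norm_integral_le_of_norm_le
      (f := fun u => clip n (hermiteEstimate N β s u) - hermiteEstimate N β s u)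
      (i3.div_const n) (ae_of_all _ fun u => abs_clip_sub_le hn _)).trans ?_
    rw [integral_div]
    gcongr
  have e5 := abs_sub_le (∫ u, clip n (hermiteEstimate N β s u) ∂μ) (taylorG N β ω) (lossG ω β)
  rw [abs_sub_comm] at e3
  linarith

lemma integral_clip_sub_sq_le_of_small (hn : 0 ≤ n) (h0 : 0 ≤ β) (h1 : β ≤ 1) (hs : 0 < s)
    (hs2 : 2 * s ^ 2 ≤ Real.exp (-1)) :
    ∫ u, (clip n (hermiteEstimate N β s u) - lossG ω β) ^ 2 ∂(gaussianReal ω (s ^ 2).toNNReal)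
      ≤ 2 * ((8 + 2 * (N : ℝ) ^ 2) * Real.exp (Real.exp 1 * ω ^ 2)) + 2 * (1 + |ω|) ^ 2 := by
  have i3 := integrable_hermiteEstimate_sq N β s ω (s ^ 2).toNNReal
  have e2 := integral_hermiteEstimate_sq_le N h0 h1 ω hs hs2
  have hG : lossG ω β ^ 2 ≤ (1 + |ω|) ^ 2 := by
    rw [← sq_abs (lossG ω β)]
    exact pow_le_pow_left₀ (abs_nonneg _) (abs_lossG_le ω h0 h1) 2
  refine (integral_mono (integrable_clip_hermiteEstimate_sub_sq N ω hn _ _)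
    ((i3.const_mul 2).add (integrable_const (2 * (1 + |ω|) ^ 2))) fun u => ?_).trans ?_
  · have := clip_sq_le hn (hermiteEstimate N β s u)
    simp only [Pi.add_apply]
    nlinarith [sq_nonneg (clip n (hermiteEstimate N β s u) + lossG ω β)]
  · simp only [Pi.add_apply]
    rw [integral_add (i3.const_mul 2) (integrable_const _), integral_const_mul, integral_const,
      probReal_univ, one_smul]
    linarith

/-- Uses nothing but the clipping level. It serves for `|ω|` so large that the middle region is
improbable. -/
lemma abs_integral_clip_sub_le_of_large (hn : 0 ≤ n) (h0 : 0 ≤ β) (h1 : β ≤ 1) (v : NNReal) :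
    |(∫ u, clip n (hermiteEstimate N β s u) ∂(gaussianReal ω v)) - lossG ω β|
      ≤ n + (1 + |ω|) := by
  have e1 : |∫ u, clip n (hermiteEstimate N β s u) ∂(gaussianReal ω v)| ≤ n := by
    refine (norm_integral_le_of_norm_le (f := fun u => clip n (hermiteEstimate N β s u))
      (integrable_const n) (ae_of_all _ fun u => abs_clip_le hn _)).trans ?_
    simp
  exact (abs_sub _ _).trans (add_le_add e1 (abs_lossG_le ω h0 h1))

lemma integral_clip_sub_sq_le_of_large (hn : 0 ≤ n) (h0 : 0 ≤ β) (h1 : β ≤ 1) (v : NNReal) :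
    ∫ u, (clip n (hermiteEstimate N β s u) - lossG ω β) ^ 2 ∂(gaussianReal ω v)
      ≤ 2 * n ^ 2 + 2 * (1 + |ω|) ^ 2 := by
  have hG : lossG ω β ^ 2 ≤ (1 + |ω|) ^ 2 := by
    rw [← sq_abs (lossG ω β)]
    exact pow_le_pow_left₀ (abs_nonneg _) (abs_lossG_le ω h0 h1) 2
  refine (integral_mono (integrable_clip_hermiteEstimate_sub_sq N ω hn _ _)
    (integrable_const (2 * n ^ 2 + 2 * (1 + |ω|) ^ 2)) fun u => ?_).trans ?_
  · have h2 : clip n (hermiteEstimate N β s u) ^ 2 ≤ n ^ 2 := by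
      rw [← sq_abs (clip _ _)]
      exact pow_le_pow_left₀ (abs_nonneg _) (abs_clip_le hn _) 2
    simp only
    nlinarith [sq_nonneg (clip n (hermiteEstimate N β s u) + lossG ω β)]
  · simp

end

set_option maxHeartbeats 1000000 in
/-- Bias and second moment of the randomized estimate, in terms of `L = log n`. -/
lemma selectEstimate_error_of_log {γ₀ W₀ c L γ r s β : ℝ} (hγ₀ : 0 < γ₀)
    (hc0 : 0 ≤ c) (hc1 : c ≤ γ₀ ^ 2 / 4) (hc2 : c ≤ 1 - 2 * Real.exp 1 * W₀ ^ 2)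
    (hL : 1 ≤ L) (hL1 : 1 ≤ γ₀ * √(2 * L)) (hLx : L ^ 3 * Real.exp (-c * L) ≤ 1)
    (hγ : γ₀ ≤ γ) (hW : γ + √(2 * r) ≤ W₀) (hs : 0 < s) (hsr : s ^ 2 ≤ 2 * r)
    (hs2 : 2 * s ^ 2 ≤ Real.exp (-1)) (h0 : 0 ≤ β) (h1 : β ≤ 1) (ω : ℝ) (N : ℕ)
    (hN : N = ⌈Real.exp 1 ^ 2 * (γ + √(2 * r)) ^ 2 * (2 * L)⌉₊) :
    |(∫ p, selectEstimate (Real.exp L) (γ * √(2 * L)) N β s p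
        ∂((gaussianReal ω (s ^ 2).toNNReal).prod (gaussianReal ω (s ^ 2).toNNReal))) - lossG ω β|
      ≤ 100 / √L ∧
    ∫ p, (selectEstimate (Real.exp L) (γ * √(2 * L)) N β s p - lossG ω β) ^ 2
        ∂((gaussianReal ω (s ^ 2).toNNReal).prod (gaussianReal ω (s ^ 2).toNNReal))
      ≤ 200 * Real.exp L / √L := by
  set l := γ * √(2 * L) with hl
  set W := γ + √(2 * r) with hWdef
  set x := Real.exp (-c * L) with hx
  set n := Real.exp L with hn
  have hn0 : 0 < n := Real.exp_pos _
  have hx0 : 0 < x := Real.exp_pos _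
  have hsL : 0 < √L := Real.sqrt_pos.2 (by linarith)
  have hsL2 : √L ^ 2 = L := Real.sq_sqrt (by linarith)
  have hsLL : √L ≤ L := Real.sqrt_le_iff.2 ⟨by linarith, by nlinarith⟩
  have hy : L ^ 2 * x ≤ 1 / √L := by
    rw [le_div_iff₀ hsL]
    have : L ^ 2 * x * √L ≤ L ^ 2 * x * L := mul_le_mul_of_nonneg_left hsLL (by positivity)
    rw [show L ^ 2 * x * L = L ^ 3 * x by ring] at this
    exact this.trans hLx
  set y := 1 / √L with hydef
  have hL2 : L ≤ L ^ 2 := by nlinarith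
  have hLxy : L * x ≤ y := (mul_le_mul_of_nonneg_right hL2 hx0.le).trans hy
  have hxy : x ≤ y := (le_mul_of_one_le_left hx0.le hL).trans hLxy
  have he1 : (2.7 : ℝ) ≤ Real.exp 1 := by linarith [Real.exp_one_gt_d9]
  have he2 : Real.exp 1 ≤ 2.72 := by linarith [Real.exp_one_lt_d9]
  have hsq2r : 0 ≤ √(2 * r) := Real.sqrt_nonneg _
  have hWγ : γ ≤ W := by linarith
  have hW0 : 0 < W := by linarith
  have hWW : W ^ 2 ≤ W₀ ^ 2 := pow_le_pow_left₀ hW0.le hW 2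
  have hc1' : c ≤ 1 := by
    have : 0 ≤ 2 * Real.exp 1 * W₀ ^ 2 := by positivity
    linarith
  -- Decisive for the moderate range: it yields `exp(e ω²) ≤ exp((1 - c) L) = n x` whenever `ω² ≤ 2
  -- W² L`.
  have hW1 : 2 * Real.exp 1 * W ^ 2 ≤ 1 - c := by
    have : 2 * Real.exp 1 * W ^ 2 ≤ 2 * Real.exp 1 * W₀ ^ 2 := by gcongr
    linarith
  have hW12 : W ^ 2 ≤ 1 / 4 := by
    have : 5.4 * W ^ 2 ≤ 2 * Real.exp 1 * W ^ 2 := by gcongr; linarith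
    linarith
  have hW11 : W ≤ 1 := (sq_le_one_iff₀ hW0.le).1 (by linarith)
  have hnx : n * x = Real.exp ((1 - c) * L) := by
    rw [hn, hx, ← Real.exp_add]; ring_nf
  have hnx1 : 1 ≤ n * x := by
    rw [hnx]
    exact Real.one_le_exp (mul_nonneg (by linarith) (by linarith))
  have hcL : c * L ≤ L := mul_le_of_le_one_left (by linarith) hc1'
  have hninv : Real.exp (-L) ≤ x := Real.exp_le_exp.2 (by linarith)
  have hsqrt2L : √(2 * L) ^ 2 = 2 * L := Real.sq_sqrt (by linarith)
  have hs2L0 : 0 < √(2 * L) := Real.sqrt_pos.2 (by linarith)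
  have hl1 : 1 ≤ l := hL1.trans (mul_le_mul_of_nonneg_right hγ hs2L0.le)
  have hγsq : γ₀ ^ 2 ≤ γ ^ 2 := pow_le_pow_left₀ hγ₀.le hγ 2
  have hl8 : Real.exp (-l ^ 2 / 8) ≤ x := by
    refine Real.exp_le_exp.2 ?_
    rw [hl, mul_pow, hsqrt2L]
    have : c * L ≤ γ ^ 2 / 4 * L := mul_le_mul_of_nonneg_right (by linarith) (by linarith)
    linarith
  have hshalf : s ≤ 1 / 2 := by
    have : Real.exp (-1) ≤ 1 / 2 := by
      rw [Real.exp_neg, ← one_div]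
      exact one_div_le_one_div_of_le (by norm_num) (by linarith)
    exact (sq_le_sq₀ hs.le (by norm_num)).1 (by linarith)
  have hp0 : 0 ≤ (gaussianReal ω (s ^ 2).toNNReal).real (Set.Icc (-l) l) := measureReal_nonneg
  have hp1 : (gaussianReal ω (s ^ 2).toNNReal).real (Set.Icc (-l) l) ≤ 1 := measureReal_le_one
  have hx1 : x ≤ 1 := Real.exp_le_one_iff.2 (by linarith [mul_nonneg hc0 (by linarith : 0 ≤ L)])
  have hnE : n * Real.exp (-L) = 1 := by rw [hn, ← Real.exp_add]; simp
  have hy0 : 0 < y := by positivity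
  clear_value n x y W l
  -- Only the region `|v| ≤ l` remains. The outer regions cost `32 x ≤ 32 y` in bias and `4 + 64 x ≤
  -- 68 n y` in second moment, since `n y ≥ 1`.
  suffices hmain : (|(∫ u, clip n (hermiteEstimate N β s u) ∂(gaussianReal ω (s ^ 2).toNNReal))
        - lossG ω β| * (gaussianReal ω (s ^ 2).toNNReal).real (Set.Icc (-l) l) ≤ 41 * y) ∧
      (∫ u, (clip n (hermiteEstimate N β s u) - lossG ω β) ^ 2
        ∂(gaussianReal ω (s ^ 2).toNNReal))
        * (gaussianReal ω (s ^ 2).toNNReal).real (Set.Icc (-l) l) ≤ 92 * (n * y) by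
    have a1 := abs_integral_selectEstimate_sub_le N ω hn0.le hl1 hs hshalf hmain.1
    have a2 := integral_selectEstimate_sub_sq_le N ω hn0.le hl1 hs hshalf h0 h1 hmain.2
    have b1 : (100 : ℝ) / √L = 100 * y := by rw [hydef]; ring
    have b2 : 200 * n / √L = 200 * (n * y) := by rw [hydef]; ring
    have b3 : 1 ≤ n * y := hnx1.trans (mul_le_mul_of_nonneg_left hxy hn0.le)
    rw [b1, b2]
    exact ⟨by linarith, by linarith⟩
  have hny : n * x ≤ n * y := mul_le_mul_of_nonneg_left hxy hn0.le
  rcases le_or_gt |ω| (W * √(2 * L)) with hω | hω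
  · have hω2 : ω ^ 2 ≤ W ^ 2 * (2 * L) := by
      rw [← sq_abs, ← hsqrt2L, ← mul_pow]
      exact pow_le_pow_left₀ (abs_nonneg _) hω 2
    have hω3 : ω ^ 2 ≤ L := by
      have : W ^ 2 * (2 * L) ≤ 1 / 4 * (2 * L) := by gcongr
      linarith
    have hNle : (N : ℝ) ≤ 4 * L := by
      have h := Nat.ceil_lt_add_one (a := Real.exp 1 ^ 2 * W ^ 2 * (2 * L)) (by positivity)
      rw [← hN] at h
      have : Real.exp 1 ^ 2 * W ^ 2 * (2 * L) ≤ 2.72 * L := by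
        have h2 : Real.exp 1 * (2 * Real.exp 1 * W ^ 2) ≤ 2.72 * 1 :=
          mul_le_mul he2 (by linarith) (by positivity) (by norm_num)
        have h3 := mul_le_mul_of_nonneg_right h2 (by linarith : 0 ≤ L)
        linarith
      linarith
    have hNge : Real.exp 1 ^ 2 * W ^ 2 * (2 * L) ≤ N := by
      rw [hN]; exact Nat.le_ceil _
    have hE : Real.exp (Real.exp 1 * ω ^ 2) ≤ n * x := by
      rw [hnx]
      refine Real.exp_le_exp.2 ?_
      calc Real.exp 1 * ω ^ 2 ≤ Real.exp 1 * (W ^ 2 * (2 * L)) := by gcongr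
        _ = (2 * Real.exp 1 * W ^ 2) * L := by ring
        _ ≤ _ := mul_le_mul_of_nonneg_right hW1 (by linarith)
    have hES : (8 + 2 * (N : ℝ) ^ 2) * Real.exp (Real.exp 1 * ω ^ 2) ≤ 40 * L ^ 2 * (n * x) := by
      have h8 : 8 + 2 * (N : ℝ) ^ 2 ≤ 40 * L ^ 2 := by
        have : (N : ℝ) ^ 2 ≤ (4 * L) ^ 2 := pow_le_pow_left₀ (Nat.cast_nonneg _) hNle 2
        have h9 : 1 ≤ L ^ 2 := by linarith
        linarith
      exact mul_le_mul h8 hE (Real.exp_pos _).le (by positivity)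
    -- Since `N ≥ 2 e² W² L` while `e ω² ≤ 2 e W² L`, the exponent is at most `-(e² - e) W² L`,
    -- hence at most `-c L`.
    have hT : ω ^ 2 * Real.exp ((Real.exp 1 * ω ^ 2 - N) / 2) ≤ L * x := by
      rw [hx]
      refine mul_le_mul hω3 (Real.exp_le_exp.2 ?_) (Real.exp_pos _).le (by linarith)
      have h2 : Real.exp 1 * ω ^ 2 ≤ Real.exp 1 * (W ^ 2 * (2 * L)) := by gcongr
      have h3 : c ≤ W ^ 2 := by
        have : γ ^ 2 ≤ W ^ 2 := pow_le_pow_left₀ (by linarith) hWγ 2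
        linarith [sq_nonneg γ₀]
      have h10 : 1 ≤ Real.exp 1 ^ 2 - Real.exp 1 := by
        have : 2.7 * Real.exp 1 ≤ Real.exp 1 * Real.exp 1 :=
          mul_le_mul_of_nonneg_right he1 (by linarith)
        rw [sq]
        linarith
      have h4 : W ^ 2 * L ≤ (Real.exp 1 ^ 2 - Real.exp 1) * (W ^ 2 * L) :=
        le_mul_of_one_le_left (by positivity) h10
      have h11 : c * L ≤ W ^ 2 * L := mul_le_mul_of_nonneg_right h3 (by linarith)
      linarith
    have a1 := abs_integral_clip_sub_le_of_small N ω hn0 h0 h1 hs hs2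
    have a2 := integral_clip_sub_sq_le_of_small N ω hn0.le h0 h1 hs hs2
    constructor
    · refine (mul_le_of_le_one_right (abs_nonneg _) hp1).trans (a1.trans ?_)
      have : (8 + 2 * (N : ℝ) ^ 2) * Real.exp (Real.exp 1 * ω ^ 2) / n ≤ 40 * (L ^ 2 * x) := by
        rw [div_le_iff₀ hn0]
        linarith
      linarith
    · refine (mul_le_of_le_one_right (integral_nonneg fun _ => sq_nonneg _) hp1).trans
        (a2.trans ?_)
      have h5 : (1 + |ω|) ^ 2 ≤ 2 + 2 * L := by
        have h14 := add_sq_le (a := 1) (b := |ω|)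
        rw [sq_abs] at h14
        linarith
      have h6 : L ^ 2 * (n * x) ≤ n * y := by
        have := mul_le_mul_of_nonneg_left hy hn0.le
        linarith
      have h7 : L ≤ n * y := by
        have h12 := mul_le_mul_of_nonneg_left hLxy hn0.le
        have h13 : L * 1 ≤ L * (n * x) := mul_le_mul_of_nonneg_left hnx1 (by linarith)
        linarith
      have h8 : 1 ≤ n * y := hnx1.trans hny
      linarith
  -- Beyond `W √(2L)` the mean lies at least `√(2L)` standard deviations outside `[-l, l]`, because
  -- `W √(2L) - l = √(2r) √(2L)` and `s ≤ √(2r)`. The middle region therefore has probability at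
  -- most `1 / (n √L)`.
  · set t := (|ω| - l) / s with ht
    have ht1 : √(2 * L) ≤ t := by
      rw [ht, le_div_iff₀ hs]
      have : s ≤ √(2 * r) := Real.le_sqrt_of_sq_le hsr
      have h2 : √(2 * L) * s ≤ √(2 * L) * √(2 * r) := by gcongr
      rw [hWdef, add_mul, ← hl] at hω
      linarith
    have htL : √L ≤ t := (Real.sqrt_le_sqrt (by linarith)).trans ht1
    have ht2 : 1 ≤ t := (Real.one_le_sqrt.2 hL).trans htL
    have ht0 : 0 < t := by linarith
    have ht3 : 2 * L ≤ t ^ 2 := by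
      rw [← hsqrt2L]; exact pow_le_pow_left₀ hs2L0.le ht1 2
    have hE : Real.exp (-t ^ 2 / 2) ≤ Real.exp (-L) := Real.exp_le_exp.2 (by linarith)
    have hp : (gaussianReal ω (s ^ 2).toNNReal).real (Set.Icc (-l) l) ≤ Real.exp (-t ^ 2 / 2) / t :=
      (gaussianReal_real_Icc_le ω hs l).trans (stdNormalCDF_neg_le ht0)
    set p := (gaussianReal ω (s ^ 2).toNNReal).real (Set.Icc (-l) l) with hpdef
    have hnp : n * p ≤ y := by
      calc n * p ≤ n * (Real.exp (-L) / √L) := by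
            refine mul_le_mul_of_nonneg_left (hp.trans ?_) hn0.le
            exact div_le_div₀ (Real.exp_pos _).le hE hsL htL
        _ = y := by rw [← mul_div_assoc, hnE, hydef]
    have hωt : 1 + |ω| ≤ 3 * t := by
      have h2 : |ω| = t * s + l := by rw [ht]; field_simp; ring
      have h3 : l ≤ t := by
        refine le_trans ?_ ht1
        exact hl.le.trans (mul_le_of_le_one_left hs2L0.le (hWγ.trans hW11))
      have h4 : t * s ≤ t * (1 / 2) := mul_le_mul_of_nonneg_left hshalf ht0.le
      linarith
    have hpt : t * p ≤ Real.exp (-t ^ 2 / 2) := by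
      rw [le_div_iff₀ ht0] at hp
      linarith
    have q1 : (1 + |ω|) * p ≤ 3 * y := by
      have := mul_le_mul_of_nonneg_right hωt hp0
      linarith
    have q2 : (1 + |ω|) ^ 2 * p ≤ 9 := by
      have h2 : (1 + |ω|) ^ 2 ≤ (3 * t) ^ 2 := pow_le_pow_left₀ (by positivity) hωt 2
      have h3 : t * Real.exp (-t ^ 2 / 2) ≤ 1 := by
        have h4 := Real.add_one_le_exp (t ^ 2 / 2)
        have h5 : Real.exp (-t ^ 2 / 2) = (Real.exp (t ^ 2 / 2))⁻¹ := by
          rw [← Real.exp_neg]; ring_nf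
        rw [h5, ← div_eq_mul_inv, div_le_one (Real.exp_pos _)]
        nlinarith [sq_nonneg (t - 1)]
      calc (1 + |ω|) ^ 2 * p ≤ (3 * t) ^ 2 * p := by gcongr
        _ = 9 * (t * (t * p)) := by ring
        _ ≤ 9 * (t * Real.exp (-t ^ 2 / 2)) := by gcongr
        _ ≤ 9 := by linarith
    have a1 := abs_integral_clip_sub_le_of_large (s := s) N ω hn0.le h0 h1 (s ^ 2).toNNReal
    have a2 := integral_clip_sub_sq_le_of_large (s := s) N ω hn0.le h0 h1 (s ^ 2).toNNReal
    have b1 := mul_le_mul_of_nonneg_right a1 hp0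
    have b2 := mul_le_mul_of_nonneg_right a2 hp0
    have h8 : 1 ≤ n * y := hnx1.trans hny
    constructor
    · linarith
    · have b3 : n * (n * p) ≤ n * y := mul_le_mul_of_nonneg_left hnp hn0.le
      linarith

/-! ### Independence of the two noisy copies of an observation -/

/-- Sum and difference are jointly Gaussian, and they are uncorrelated because the two variances
agree; for a Gaussian pair this is independence. -/
lemma map_add_sub_std :
    ((gaussianReal 0 1).prod (gaussianReal 0 1)).map (fun p : ℝ × ℝ => (p.1 + p.2, p.1 - p.2))
      = (gaussianReal 0 2).prod (gaussianReal 0 2) := by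
  set P := (gaussianReal 0 1).prod (gaussianReal 0 1) with hP
  have h1 : P.map (fun p : ℝ × ℝ => p.1) = gaussianReal 0 1 := by
    rw [hP]; exact measurePreserving_fst.map_eq
  have h2 : P.map (fun p : ℝ × ℝ => p.2) = gaussianReal 0 1 := by
    rw [hP]; exact measurePreserving_snd.map_eq
  have h3 : P.map (fun p : ℝ × ℝ => -p.2) = gaussianReal 0 1 := by
    have : (fun p : ℝ × ℝ => -p.2) = (fun x : ℝ => -x) ∘ fun p : ℝ × ℝ => p.2 := rfl
    rw [this, ← Measure.map_map (by fun_prop) (by fun_prop), h2, gaussianReal_map_neg, neg_zero]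
  have hI : IndepFun (fun p : ℝ × ℝ => p.1) (fun p : ℝ × ℝ => p.2) P :=
    indepFun_prod measurable_id measurable_id
  have hI' : IndepFun (fun p : ℝ × ℝ => p.1) (fun p : ℝ × ℝ => -p.2) P :=
    hI.comp measurable_id measurable_neg
  have hA : P.map (fun p : ℝ × ℝ => p.1 + p.2) = gaussianReal 0 2 := by
    have := gaussianReal_add_gaussianReal_of_indepFun hI h1 h2
    rw [add_zero, one_add_one_eq_two] at this
    exact this
  have hB : P.map (fun p : ℝ × ℝ => p.1 - p.2) = gaussianReal 0 2 := by
    have := gaussianReal_add_gaussianReal_of_indepFun hI' h1 h3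
    rw [add_zero, one_add_one_eq_two] at this
    exact this
  have m1 : MemLp (fun p : ℝ × ℝ => p.1) 2 P :=
    (memLp_id_gaussianReal' 2 (by simp)).comp_fst _
  have m2 : MemLp (fun p : ℝ × ℝ => p.2) 2 P :=
    (memLp_id_gaussianReal' 2 (by simp)).comp_snd _
  have hG : HasGaussianLaw (fun p : ℝ × ℝ => (p.1, p.2)) P :=
    IsGaussian.hasGaussianLaw_id
  have hG2 : HasGaussianLaw (fun p : ℝ × ℝ => (p.1 + p.2, p.1 - p.2)) P :=
    hG.map_fun (((ContinuousLinearMap.fst ℝ ℝ ℝ) + (ContinuousLinearMap.snd ℝ ℝ ℝ)).prod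
      ((ContinuousLinearMap.fst ℝ ℝ ℝ) - (ContinuousLinearMap.snd ℝ ℝ ℝ)))
  have v1 : Var[fun p : ℝ × ℝ => p.1; P] = 1 := by
    have := variance_map (X := fun x : ℝ => x) (Y := fun p : ℝ × ℝ => p.1) (μ := P)
      (by fun_prop) (by fun_prop)
    rw [h1, variance_fun_id_gaussianReal] at this
    exact this.symm
  have v2 : Var[fun p : ℝ × ℝ => p.2; P] = 1 := by
    have := variance_map (X := fun x : ℝ => x) (Y := fun p : ℝ × ℝ => p.2) (μ := P)
      (by fun_prop) (by fun_prop)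
    rw [h2, variance_fun_id_gaussianReal] at this
    exact this.symm
  have hc : cov[fun p : ℝ × ℝ => p.1 + p.2, fun p : ℝ × ℝ => p.1 - p.2; P] = 0 := by
    have e1 : (fun p : ℝ × ℝ => p.1 + p.2) = (fun p : ℝ × ℝ => p.1) + fun p => p.2 := rfl
    have e2 : (fun p : ℝ × ℝ => p.1 - p.2) = (fun p : ℝ × ℝ => p.1) - fun p => p.2 := rfl
    rw [e1, e2, covariance_add_left m1 m2 (m1.sub m2), covariance_sub_right m1 m1 m2,
      covariance_sub_right m2 m1 m2, covariance_self (by fun_prop), covariance_self (by fun_prop),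
      covariance_comm (fun p : ℝ × ℝ => p.2), v1, v2]
    ring
  have := (hG2.indepFun_of_covariance_eq_zero hc).map_prod_eq_prod_map_map
    (by fun_prop) (by fun_prop)
  rw [this, hA, hB]

/-- The pair of affine functions of `x + a z` and `x - a z`. -/
noncomputable def noisyPair (c d a : ℝ) (p : ℝ × ℝ) : ℝ × ℝ :=
  (c + d * (p.1 + a * p.2), c + d * (p.1 - a * p.2))

@[fun_prop]
lemma measurable_noisyPair (c d a : ℝ) : Measurable (noisyPair c d a) := by
  unfold noisyPair
  fun_prop

lemma map_noisyPair (c d m : ℝ) {σ : ℝ} (hσ : 0 ≤ σ) :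
    ((gaussianReal m σ.toNNReal).prod (gaussianReal 0 1)).map (noisyPair c d √σ)
      = (gaussianReal (c + d * m) (√(2 * σ * d ^ 2) ^ 2).toNNReal).prod
        (gaussianReal (c + d * m) (√(2 * σ * d ^ 2) ^ 2).toNNReal) := by
  have e1 : (gaussianReal m σ.toNNReal).prod (gaussianReal 0 1)
      = ((gaussianReal 0 1).prod (gaussianReal 0 1)).map
        (Prod.map (fun z => m + √σ * z) id) := by
    rw [← Measure.map_prod_map _ _ (by fun_prop) measurable_id, ← gaussianReal_eq_map_std m σ hσ,
      Measure.map_id]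
  have e2 : noisyPair c d √σ ∘ Prod.map (fun z => m + √σ * z) id
      = Prod.map (fun y => (c + d * m) + d * √σ * y) (fun y => (c + d * m) + d * √σ * y)
        ∘ fun p : ℝ × ℝ => (p.1 + p.2, p.1 - p.2) := by
    ext p
    · simp [noisyPair]; ring
    · simp [noisyPair]; ring
  have e3 : (gaussianReal 0 2).map (fun y => (c + d * m) + d * √σ * y)
      = gaussianReal (c + d * m) (√(2 * σ * d ^ 2) ^ 2).toNNReal := by
    have : (fun y => (c + d * m) + d * √σ * y) = (fun y => (c + d * m) + y) ∘ (fun y => d * √σ * y) :=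
      rfl
    rw [this, ← Measure.map_map (by fun_prop) (by fun_prop), gaussianReal_map_const_mul,
      gaussianReal_map_const_add, mul_zero, zero_add]
    congr 1
    ext
    rw [Real.sq_sqrt (by positivity), Real.coe_toNNReal _ (by positivity)]
    push_cast
    rw [mul_pow, Real.sq_sqrt hσ]
    ring
  rw [e1, Measure.map_map (by fun_prop) (by fun_prop), e2, ← Measure.map_map (by fun_prop)
    (by fun_prop), map_add_sub_std, ← Measure.map_prod_map _ _ (by fun_prop) (by fun_prop), e3]

/-! ### Averaging over auxiliary randomness -/

lemma sq_integral_le_integral_sq {α : Type*} [MeasurableSpace α] {μ : Measure α}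
    [IsProbabilityMeasure μ] {f : α → ℝ} (hf : MemLp f 2 μ) :
    (∫ a, f a ∂μ) ^ 2 ≤ ∫ a, f a ^ 2 ∂μ := by
  have h := variance_nonneg f μ
  rw [variance_eq_sub hf] at h
  simpa using h

/-- Jensen's inequality on each fibre, followed by Fubini: Rao–Blackwellization does not increase a
second moment. -/
lemma integral_sq_average_le {α β : Type*} [MeasurableSpace α] [MeasurableSpace β] {μ : Measure α}
    {ν : Measure β} [IsProbabilityMeasure μ] [IsProbabilityMeasure ν] {f : α × β → ℝ}
    (hf : Measurable f) (hf2 : Integrable (fun p => f p ^ 2) (μ.prod ν)) :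
    MemLp (fun x => ∫ y, f (x, y) ∂ν) 2 μ ∧
      ∫ x, (∫ y, f (x, y) ∂ν) ^ 2 ∂μ ≤ ∫ p, f p ^ 2 ∂(μ.prod ν) := by
  have hm : StronglyMeasurable (fun x => ∫ y, f (x, y) ∂ν) :=
    hf.stronglyMeasurable.integral_prod_right'
  have hae : ∀ᵐ x ∂μ, (∫ y, f (x, y) ∂ν) ^ 2 ≤ ∫ y, f (x, y) ^ 2 ∂ν := by
    filter_upwards [hf2.prod_right_ae] with x hx
    exact sq_integral_le_integral_sq ((memLp_two_iff_integrable_sq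
      (hf.comp measurable_prodMk_left).aestronglyMeasurable).2 hx)
  have hi : Integrable (fun x => (∫ y, f (x, y) ∂ν) ^ 2) μ := by
    refine hf2.integral_prod_left.mono' (hm.pow 2).aestronglyMeasurable ?_
    filter_upwards [hae] with x hx
    rw [Real.norm_eq_abs, abs_of_nonneg (sq_nonneg _)]
    exact hx
  refine ⟨(memLp_two_iff_integrable_sq hm.aestronglyMeasurable).2 hi, ?_⟩
  rw [integral_prod _ hf2]
  exact integral_mono_ae hi hf2.integral_prod_left hae

/-! ### The coordinatewise predictive loss -/

lemma abs_normalGain_sub_le (w w' : ℝ) : |normalGain w - normalGain w'| ≤ |w - w'| := by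
  have hi : ∀ w : ℝ, Integrable (fun z : ℝ => max (w + z) 0) (gaussianReal 0 1) := fun w =>
    ((integrable_const w).add (integrable_id_gaussianReal 0 1)).pos_part
  rw [← integral_max_std, ← integral_max_std, ← integral_sub (hi w) (hi w')]
  refine (norm_integral_le_of_norm_le (f := fun z : ℝ => max (w + z) 0 - max (w' + z) 0)
    (integrable_const |w - w'|) (ae_of_all _ fun z => ?_)).trans (by simp)
  have := abs_max_sub_max_le_abs (w + z) (w' + z) 0
  rwa [add_sub_add_right_eq_sub] at this

lemma integral_max_add_gaussianReal (a : ℝ) {v : ℝ} (hv : 0 < v) :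
    ∫ y, max (a + y) 0 ∂(gaussianReal 0 v.toNNReal) = √v * normalGain (a / √v) := by
  rw [← integral_max_gaussianReal a hv]
  have : gaussianReal a v.toNNReal = (gaussianReal 0 v.toNNReal).map (fun y => a + y) := by
    rw [gaussianReal_map_const_add, zero_add]
  rw [this, integral_map (by fun_prop) (by fun_prop)]

namespace PredModel

variable (M : PredModel)

lemma coordLoss_eq (i : ℕ) (t q : ℝ) :
    M.coordLoss i t q = (M.b i + M.h i) * (√(M.σf i) * normalGain ((q - t) / √(M.σf i)))
      - M.b i * (q - t) := by
  have hv := M.σf_pos i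
  -- The check loss is one positive part minus a linear term, so a single gain function describes
  -- its mean.
  have e : ∀ y : ℝ, M.b i * max (y - q) 0 + M.h i * max (q - y) 0
      = (M.b i + M.h i) * max (q - y) 0 - M.b i * (q - y) := by
    intro y
    rcases le_total y q with h | h
    · rw [max_eq_right (by linarith), max_eq_left (by linarith)]; ring
    · rw [max_eq_left (by linarith), max_eq_right (by linarith)]; ring
  have i2 : Integrable (fun y : ℝ => q - y) (gaussianReal t (M.σf i).toNNReal) :=
    (integrable_const q).sub (integrable_id_gaussianReal t _)
  have i1 : Integrable (fun y : ℝ => max (q - y) 0) (gaussianReal t (M.σf i).toNNReal) :=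
    i2.pos_part
  unfold coordLoss
  simp_rw [e]
  rw [integral_sub (i1.const_mul _) (i2.const_mul _), integral_const_mul, integral_const_mul,
    integral_sub (integrable_const q) (integrable_id_gaussianReal t _), integral_id_gaussianReal,
    ← integral_max_gaussianReal _ hv, ← gaussianReal_map_const_sub,
    integral_map (by fun_prop) (by fun_prop)]
  simp

lemma coordLoss_nonneg (i : ℕ) (t q : ℝ) : 0 ≤ M.coordLoss i t q :=
  integral_nonneg fun _ => add_nonneg (mul_nonneg (M.b_pos i).le (le_max_right _ _))
    (mul_nonneg (M.h_pos i).le (le_max_right _ _))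

lemma abs_coordLoss_sub_le (i : ℕ) (t q q' : ℝ) :
    |M.coordLoss i t q - M.coordLoss i t q'| ≤ 2 * (M.b i + M.h i) * |q - q'| := by
  have hb := M.b_pos i
  have hh := M.h_pos i
  have hs := Real.sqrt_pos.2 (M.σf_pos i)
  rw [coordLoss_eq, coordLoss_eq]
  have h := abs_normalGain_sub_le ((q - t) / √(M.σf i)) ((q' - t) / √(M.σf i))
  rw [← sub_div, abs_div, abs_of_pos hs, le_div_iff₀ hs, show q - t - (q' - t) = q - q' by ring] at h
  have e : (M.b i + M.h i) * (√(M.σf i) * normalGain ((q - t) / √(M.σf i))) - M.b i * (q - t)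
      - ((M.b i + M.h i) * (√(M.σf i) * normalGain ((q' - t) / √(M.σf i))) - M.b i * (q' - t))
      = (M.b i + M.h i) * ((normalGain ((q - t) / √(M.σf i)) - normalGain ((q' - t) / √(M.σf i)))
        * √(M.σf i)) - M.b i * (q - q') := by ring
  rw [e]
  refine (abs_sub _ _).trans ?_
  rw [abs_mul, abs_mul, abs_mul, abs_of_pos hs, abs_of_pos hb, abs_of_pos (add_pos hb hh)]
  have h2 := mul_le_mul_of_nonneg_left h (add_pos hb hh).le
  have h3 := mul_nonneg hh.le (abs_nonneg (q - q'))
  linarith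

lemma coordLoss_le (i : ℕ) (t q : ℝ) :
    M.coordLoss i t q ≤ (M.b i + M.h i) * (√(M.σf i) + 2 * |q - t|) := by
  have hb := M.b_pos i
  have hh := M.h_pos i
  have hs := Real.sqrt_pos.2 (M.σf_pos i)
  have h1 : M.coordLoss i t t ≤ (M.b i + M.h i) * √(M.σf i) := by
    rw [coordLoss_eq]
    have := normalGain_le 0
    rw [abs_zero, add_zero] at this
    simp only [sub_self, zero_div, mul_zero, sub_zero]
    have h2 : √(M.σf i) * normalGain 0 ≤ √(M.σf i) := mul_le_of_le_one_right hs.le this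
    exact mul_le_mul_of_nonneg_left h2 (add_pos hb hh).le
  have h2 := (abs_le.1 (M.abs_coordLoss_sub_le i t q t)).2
  linarith

lemma continuous_coordLoss (i : ℕ) (t : ℝ) : Continuous (M.coordLoss i t) := by
  rw [funext (M.coordLoss_eq i t)]
  have := continuous_normalGain
  fun_prop

/-- An affine predictor has a normal error, and convolving it with the future noise adds the
variances. The mean loss is again the expected positive part of a normal variable, now with variance
`v`. -/
lemma integral_coordLoss_affine (i : ℕ) (t α a : ℝ) {v : ℝ} (hv : v = M.σf i + M.σp i * α ^ 2) :
    ∫ x, M.coordLoss i t (α * x + a) ∂(gaussianReal t (M.σp i).toNNReal)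
      = (M.b i + M.h i) * √v * lossG ((α * t + a - t) / √v) (M.ratio i) := by
  have hb := M.b_pos i
  have hh := M.h_pos i
  have hf := M.σf_pos i
  have hp := M.σp_pos i
  have hv0 : 0 < v := by rw [hv]; positivity
  have hs := Real.sqrt_pos.2 hv0
  set μ := gaussianReal t (M.σp i).toNNReal with hμ
  have hlaw : μ.map (fun x => α * x + (a - t))
      = gaussianReal (α * t + (a - t)) (α ^ 2 * M.σp i).toNNReal := by
    have : (fun x => α * x + (a - t)) = (fun x => x + (a - t)) ∘ (fun x => α * x) := rfl
    rw [this, ← Measure.map_map (by fun_prop) (by fun_prop), hμ, gaussianReal_map_const_mul,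
      gaussianReal_map_add_const]
    congr 1
    ext
    rw [Real.coe_toNNReal _ (by positivity)]
    push_cast
    rw [Real.coe_toNNReal _ hp.le]
  have hconv : gaussianReal (α * t + (a - t)) (α ^ 2 * M.σp i).toNNReal
      ∗ gaussianReal 0 (M.σf i).toNNReal = gaussianReal (α * t + (a - t)) v.toNNReal := by
    rw [gaussianReal_conv_gaussianReal, add_zero, ← Real.toNNReal_add (by positivity) hf.le, hv]
    congr 2
    ring
  have hgain : ∫ x, √(M.σf i) * normalGain ((α * x + a - t) / √(M.σf i)) ∂μ
      = √v * normalGain ((α * t + a - t) / √v) := by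
    have h1 := integral_max_gaussianReal (α * t + (a - t)) hv0
    have hi : Integrable (fun y : ℝ => max y 0) (gaussianReal (α * t + (a - t)) v.toNNReal) :=
      (integrable_id_gaussianReal _ _).pos_part
    rw [← hconv] at h1 hi
    rw [integral_conv hi, ← hlaw] at h1
    simp_rw [integral_max_add_gaussianReal _ hf] at h1
    have := continuous_normalGain
    rw [integral_map (by fun_prop) (by fun_prop)] at h1
    simp only [add_sub_assoc]
    exact h1
  have i0 : Integrable (fun x : ℝ => α * x + a - t) μ :=
    (((integrable_id_gaussianReal t _).const_mul α).add (integrable_const a)).sub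
      (integrable_const t)
  have i1 : Integrable (fun x => √(M.σf i) * normalGain ((α * x + a - t) / √(M.σf i))) μ := by
    have := continuous_normalGain
    refine ((integrable_const (√(M.σf i))).add i0.abs).mono' (by fun_prop)
      (ae_of_all _ fun x => ?_)
    have hsf := Real.sqrt_pos.2 hf
    have h := normalGain_le ((α * x + a - t) / √(M.σf i))
    rw [Real.norm_eq_abs, abs_of_nonneg (mul_nonneg hsf.le (normalGain_nonneg _))]
    refine (mul_le_mul_of_nonneg_left h hsf.le).trans (le_of_eq ?_)
    rw [abs_div, abs_of_pos hsf]
    simp only [Pi.add_apply]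
    field_simp
  simp_rw [coordLoss_eq]
  rw [integral_sub (i1.const_mul _) (i0.const_mul _), integral_const_mul (M.b i + M.h i),
    integral_const_mul (M.b i), hgain, lossG_eq, ratio]
  have e : ∫ x, (α * x + a - t) ∂μ = α * t + a - t := by
    have i3 : Integrable (fun x : ℝ => α * x + a) μ :=
      ((integrable_id_gaussianReal t _).const_mul α).add (integrable_const a)
    rw [integral_sub i3 (integrable_const t), integral_add ((integrable_id_gaussianReal t _).const_mul α)
      (integrable_const a), integral_const_mul, integral_id_gaussianReal]
    simp
  rw [e]
  have : M.b i + M.h i ≠ 0 := (add_pos hb hh).ne'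
  field_simp

end PredModel

/-! ### The risk estimate as a Rao–Blackwellized threshold estimate -/

@[fun_prop]
lemma measurable_selectEstimate (n l : ℝ) (N : ℕ) (β s : ℝ) :
    Measurable (selectEstimate n l N β s) := by
  have := continuous_hermiteEstimate N β s
  unfold selectEstimate selectBy
  refine Measurable.ite (measurableSet_lt (by fun_prop) (by fun_prop)) (by fun_prop)
    (Measurable.ite (measurableSet_le (by fun_prop) (by fun_prop)) (by fun_prop) (by fun_prop))

lemma abs_selectEstimate_le {n l β : ℝ} (N : ℕ) (s : ℝ) (hn : 0 ≤ n) (h0 : 0 ≤ β) (h1 : β ≤ 1)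
    (p : ℝ × ℝ) : |selectEstimate n l N β s p| ≤ |p.1| + n := by
  unfold selectEstimate selectBy
  split_ifs
  · rw [abs_mul, abs_neg, abs_of_nonneg h0]
    nlinarith [abs_nonneg p.1]
  · linarith [abs_clip_le hn (hermiteEstimate N β s p.1), abs_nonneg p.1]
  · rw [abs_mul, abs_of_nonneg (by linarith : 0 ≤ 1 - β)]
    nlinarith [abs_nonneg p.1]

namespace PredModel

variable (M : PredModel)

/-- `K` bounds the parameters of the model. -/
structure BoundedBy (K : ℝ) : Prop where
  one_le : 1 ≤ K
  weight_le : ∀ i, M.b i + M.h i ≤ K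
  σp_le : ∀ i, M.σp i ≤ K
  σf_le : ∀ i, M.σf i ≤ K
  inv_σp_le : ∀ i, (M.σp i)⁻¹ ≤ K
  σp_le_σf : ∀ i, M.σp i ≤ M.σf i
  quantile_le : ∀ i, |stdNormalQuantile (M.ratio i)| ≤ K

lemma ratio_nonneg (i : ℕ) : 0 ≤ M.ratio i :=
  div_nonneg (M.b_pos i).le (add_pos (M.b_pos i) (M.h_pos i)).le

lemma ratio_le_one (i : ℕ) : M.ratio i ≤ 1 :=
  div_le_one_of_le₀ (by linarith [M.h_pos i]) (add_pos (M.b_pos i) (M.h_pos i)).le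

lemma shrink_nonneg (i : ℕ) (τ : ℝ≥0∞) : 0 ≤ M.shrink i τ := by
  unfold shrink
  have := M.σp_pos i
  split_ifs
  · exact zero_le_one
  · positivity

lemma shrink_le_one (i : ℕ) (τ : ℝ≥0∞) : M.shrink i τ ≤ 1 := by
  unfold shrink
  have := M.σp_pos i
  split_ifs
  · exact le_rfl
  · exact div_le_one_of_le₀ (by linarith) (by positivity)

lemma shrink_lt_one (i : ℕ) {τ : ℝ≥0∞} (hτ : τ ≠ ⊤) : M.shrink i τ < 1 := by
  unfold shrink
  have := M.σp_pos i
  rw [if_neg hτ, div_lt_one (by positivity)]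
  linarith

/-- Variance of the prediction error in coordinate `i`. -/
noncomputable def errVar (i : ℕ) (τ : ℝ≥0∞) : ℝ := M.σf i + M.σp i * M.shrink i τ ^ 2

lemma errVar_pos (i : ℕ) (τ : ℝ≥0∞) : 0 < M.errVar i τ := by
  have := M.σp_pos i
  have := M.σf_pos i
  unfold errVar
  positivity

lemma σf_le_errVar (i : ℕ) (τ : ℝ≥0∞) : M.σf i ≤ M.errVar i τ := by
  have := M.σp_pos i
  unfold errVar
  have : 0 ≤ M.σp i * M.shrink i τ ^ 2 := by positivity
  linarith

/-- Coordinate `i` of the shrinkage predictor as a function of the observation. -/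
noncomputable def coordPredictor (i : ℕ) (p : ℝ × ℝ≥0∞) (x : ℝ) : ℝ :=
  M.shrink i p.2 * x + (1 - M.shrink i p.2) * p.1
    + √(M.σf i + M.shrink i p.2 * M.σp i) * stdNormalQuantile (M.ratio i)

/-- Standard deviation of the argument of the Hermite polynomials. -/
noncomputable def noiseScale (i : ℕ) (τ : ℝ≥0∞) : ℝ := √(2 * M.σp i * M.slopeD i τ ^ 2)

/-- Standardized bias of the shrinkage predictor. -/
noncomputable def stdBias (i : ℕ) (t : ℝ) (p : ℝ × ℝ≥0∞) : ℝ :=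
  (M.interceptC i p.2 - M.slopeD i p.2 * p.1) + M.slopeD i p.2 * t

lemma slopeD_sq (i : ℕ) (τ : ℝ≥0∞) :
    M.slopeD i τ ^ 2 = (1 - M.shrink i τ) ^ 2 / M.errVar i τ := by
  unfold slopeD
  rw [div_pow, neg_sq, ← errVar, Real.sq_sqrt (M.errVar_pos i τ).le]

lemma noiseScale_sq (i : ℕ) (τ : ℝ≥0∞) :
    M.noiseScale i τ ^ 2 = 2 * M.σp i * M.slopeD i τ ^ 2 :=
  Real.sq_sqrt (by have := M.σp_pos i; positivity)

lemma noiseScale_sq_le (i : ℕ) (τ : ℝ≥0∞) :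
    M.noiseScale i τ ^ 2 ≤ 2 * (M.σp i / M.σf i) := by
  have hp := M.σp_pos i
  have hf := M.σf_pos i
  have h0 := M.shrink_nonneg i τ
  have h1 := M.shrink_le_one i τ
  rw [noiseScale_sq, slopeD_sq, mul_assoc, div_eq_mul_inv, div_eq_mul_inv]
  have h2 : (M.errVar i τ)⁻¹ ≤ (M.σf i)⁻¹ := inv_anti₀ hf (M.σf_le_errVar i τ)
  have h3 : (1 - M.shrink i τ) ^ 2 ≤ 1 := pow_le_one₀ (by linarith) (by linarith)
  have h4 : (1 - M.shrink i τ) ^ 2 * (M.errVar i τ)⁻¹ ≤ 1 * (M.σf i)⁻¹ :=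
    mul_le_mul h3 h2 (inv_nonneg.2 (M.errVar_pos i τ).le) zero_le_one
  rw [one_mul] at h4
  gcongr

/-- The Hermite moment formulas need a nondegenerate normal law, which fails at `τ = ∞`; all scales
of the grid are finite. -/
lemma noiseScale_pos (i : ℕ) {τ : ℝ≥0∞} (hτ : τ ≠ ⊤) : 0 < M.noiseScale i τ := by
  have hp := M.σp_pos i
  have h1 : 0 < 1 - M.shrink i τ := by linarith [M.shrink_lt_one i hτ]
  refine Real.sqrt_pos.2 ?_
  rw [slopeD_sq]
  have := M.errVar_pos i τ
  positivity

lemma coordPredictor_sub_div (i : ℕ) (t : ℝ) (p : ℝ × ℝ≥0∞) :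
    (M.coordPredictor i p t - t) / √(M.errVar i p.2) = M.stdBias i t p := by
  have hv := M.errVar_pos i p.2
  have hs := Real.sqrt_pos.2 hv
  have e : M.σf i + M.shrink i p.2 ^ 2 * M.σp i = M.errVar i p.2 := by unfold errVar; ring
  have e' : M.σf i + M.σp i * M.shrink i p.2 ^ 2 = M.errVar i p.2 := rfl
  unfold stdBias interceptC slopeD coordPredictor
  rw [e, e', Real.sqrt_div' _ hv.le]
  field_simp
  ring

lemma integral_coordLoss_coordPredictor (i : ℕ) (t : ℝ) (p : ℝ × ℝ≥0∞) :
    ∫ x, M.coordLoss i t (M.coordPredictor i p x) ∂(gaussianReal t (M.σp i).toNNReal)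
      = (M.b i + M.h i) * √(M.errVar i p.2) * lossG (M.stdBias i t p) (M.ratio i) := by
  have h := M.integral_coordLoss_affine i t (M.shrink i p.2)
    ((1 - M.shrink i p.2) * p.1
      + √(M.σf i + M.shrink i p.2 * M.σp i) * stdNormalQuantile (M.ratio i))
    (v := M.errVar i p.2) rfl
  simp only [← add_assoc] at h
  rw [← coordPredictor_sub_div]
  exact h

variable (γ : ℕ → ℝ)

/-- Shifting the data by `η` only changes the intercept to `c - d η`. -/
lemma randomizedT_eq (n i : ℕ) (η : ℝ) (τ : ℝ≥0∞) (x z : ℝ) :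
    M.randomizedT γ n i τ (x - η) z
      = selectEstimate n (threshold γ n i) (M.truncOrder γ n i - 1) (M.ratio i)
          (M.noiseScale i τ)
          (noisyPair (M.interceptC i τ - M.slopeD i τ * η) (M.slopeD i τ) √(M.σp i) (x, z)) := by
  have e : noisyPair (M.interceptC i τ - M.slopeD i τ * η) (M.slopeD i τ) √(M.σp i) (x, z)
      = (M.interceptC i τ + M.slopeD i τ * ((x - η) + √(M.σp i) * z),
        M.interceptC i τ + M.slopeD i τ * ((x - η) - √(M.σp i) * z)) := by
    ext <;> simp [noisyPair] <;> ring
  rw [e]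
  rfl

/-- Moments of the Rao-Blackwellized estimate, from those of the randomized one. -/
lemma coordT_moments (n i : ℕ) (t : ℝ) (p : ℝ × ℝ≥0∞) (hl : 0 ≤ threshold γ n i) {ε₁ ε₂ : ℝ}
    (h₁ : |(∫ q, selectEstimate n (threshold γ n i) (M.truncOrder γ n i - 1) (M.ratio i)
        (M.noiseScale i p.2) q ∂((gaussianReal (M.stdBias i t p) (M.noiseScale i p.2 ^ 2).toNNReal).prod
          (gaussianReal (M.stdBias i t p) (M.noiseScale i p.2 ^ 2).toNNReal)))
        - lossG (M.stdBias i t p) (M.ratio i)| ≤ ε₁)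
    (h₂ : ∫ q, (selectEstimate n (threshold γ n i) (M.truncOrder γ n i - 1) (M.ratio i)
        (M.noiseScale i p.2) q - lossG (M.stdBias i t p) (M.ratio i)) ^ 2
        ∂((gaussianReal (M.stdBias i t p) (M.noiseScale i p.2 ^ 2).toNNReal).prod
          (gaussianReal (M.stdBias i t p) (M.noiseScale i p.2 ^ 2).toNNReal)) ≤ ε₂) :
    MemLp (fun x => M.coordT γ n i p.2 (x - p.1)) 2 (gaussianReal t (M.σp i).toNNReal) ∧
    |(∫ x, M.coordT γ n i p.2 (x - p.1) ∂(gaussianReal t (M.σp i).toNNReal))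
      - lossG (M.stdBias i t p) (M.ratio i)| ≤ ε₁ ∧
    ∫ x, (M.coordT γ n i p.2 (x - p.1) - lossG (M.stdBias i t p) (M.ratio i)) ^ 2
      ∂(gaussianReal t (M.σp i).toNNReal) ≤ ε₂ := by
  set g := lossG (M.stdBias i t p) (M.ratio i) with hg
  set s := M.noiseScale i p.2 with hs
  set S := selectEstimate n (threshold γ n i) (M.truncOrder γ n i - 1) (M.ratio i) s with hS
  set T := noisyPair (M.interceptC i p.2 - M.slopeD i p.2 * p.1) (M.slopeD i p.2) √(M.σp i) with hT
  set μ := gaussianReal t (M.σp i).toNNReal with hμ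
  have hlaw := map_noisyPair (M.interceptC i p.2 - M.slopeD i p.2 * p.1) (M.slopeD i p.2) t
    (M.σp_pos i).le
  rw [← stdBias, ← noiseScale, ← hs, ← hT, ← hμ] at hlaw
  have hTm : Measurable T := measurable_noisyPair _ _ _
  have hSm : Measurable S := measurable_selectEstimate _ _ _ _ _
  have i1 : Integrable S ((μ.prod (gaussianReal 0 1)).map T) := by
    rw [hlaw]
    exact integrable_selectEstimate _ _ (Nat.cast_nonneg n) hl _
  have i2 : Integrable (fun q => (S q - g) ^ 2) ((μ.prod (gaussianReal 0 1)).map T) := by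
    rw [hlaw]
    exact integrable_selectEstimate_sub_sq _ _ (Nat.cast_nonneg n) hl _ _
  have j1 : Integrable (fun q => S (T q)) (μ.prod (gaussianReal 0 1)) :=
    (integrable_map_measure hSm.aestronglyMeasurable hTm.aemeasurable).1 i1
  have j2 : Integrable (fun q => (S (T q) - g) ^ 2) (μ.prod (gaussianReal 0 1)) :=
    (integrable_map_measure (by fun_prop) hTm.aemeasurable).1 i2
  -- Required for every `x`, not merely almost every, so that `g` can be moved under the integral as
  -- an identity of functions.
  have hz : ∀ x, Integrable (fun z => S (T (x, z))) (gaussianReal 0 1) := by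
    intro x
    have k1 : Integrable (fun z : ℝ => (T (x, z)).1) (gaussianReal 0 1) := by
      simp only [hT, noisyPair]
      exact (integrable_const _).add (((integrable_const x).add
        ((integrable_id_gaussianReal 0 1).const_mul _)).const_mul _)
    refine (k1.abs.add (integrable_const (n : ℝ))).mono'
      (hSm.comp (hTm.comp measurable_prodMk_left)).aestronglyMeasurable (ae_of_all _ fun z => ?_)
    exact abs_selectEstimate_le _ _ (Nat.cast_nonneg n) (M.ratio_nonneg i) (M.ratio_le_one i) _
  have hc : ∀ x, M.coordT γ n i p.2 (x - p.1) = ∫ z, S (T (x, z)) ∂(gaussianReal 0 1) := by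
    intro x
    unfold coordT
    simp_rw [randomizedT_eq]
    rfl
  have hc2 : ∀ x, M.coordT γ n i p.2 (x - p.1) - g
      = ∫ z, (S (T (x, z)) - g) ∂(gaussianReal 0 1) := by
    intro x
    rw [hc, integral_sub (hz x) (integrable_const g)]
    simp
  obtain ⟨r1, r2⟩ := integral_sq_average_le (f := fun q => S (T q) - g) (by fun_prop) j2
  simp_rw [← hc2] at r1 r2
  have e1 : ∫ x, M.coordT γ n i p.2 (x - p.1) ∂μ = ∫ q, S q ∂((μ.prod (gaussianReal 0 1)).map T) := by
    rw [integral_map hTm.aemeasurable hSm.aestronglyMeasurable, integral_prod _ j1]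
    simp_rw [hc]
  have e2 : ∫ q, (S (T q) - g) ^ 2 ∂(μ.prod (gaussianReal 0 1))
      = ∫ q, (S q - g) ^ 2 ∂((μ.prod (gaussianReal 0 1)).map T) := by
    rw [integral_map hTm.aemeasurable (by fun_prop)]
  rw [hlaw] at e1 e2
  refine ⟨?_, by rw [e1]; exact h₁, r2.trans (by rw [e2]; exact h₂)⟩
  have := r1.add (memLp_const (μ := μ) (p := 2) g)
  refine this.ae_eq (ae_of_all _ fun x => ?_)
  simp

end PredModel

/-! ### Mean and variance of the coordinatewise errors -/

lemma variance_le_integral_sub_sq {α : Type*} [MeasurableSpace α] {μ : Measure α}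
    [IsProbabilityMeasure μ] {f : α → ℝ} (hf : AEStronglyMeasurable f μ) (c : ℝ) :
    Var[f; μ] ≤ ∫ a, (f a - c) ^ 2 ∂μ := by
  rw [← variance_sub_const hf c]
  exact variance_le_expectation_sq (hf.sub aestronglyMeasurable_const)

lemma tendsto_log_natCast_atTop : Tendsto (fun n : ℕ => Real.log n) atTop atTop :=
  Real.tendsto_log_atTop.comp tendsto_natCast_atTop_atTop

lemma eventually_pow_mul_exp_neg_le {c : ℝ} (hc : 0 < c) :
    ∀ᶠ L : ℝ in atTop, L ^ 3 * Real.exp (-c * L) ≤ 1 := by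
  have h := (Real.tendsto_pow_mul_exp_neg_atTop_nhds_zero 3).comp
    (tendsto_id.const_mul_atTop hc)
  filter_upwards [h.eventually (gt_mem_nhds (by positivity : 0 < c ^ 3))] with L hL
  simp only [Function.comp, id, mul_pow] at hL
  rw [neg_mul]
  have hc3 : 0 < c ^ 3 := by positivity
  nlinarith [Real.exp_pos (-(c * L))]

namespace PredModel

variable (M : PredModel) (γ : ℕ → ℝ)

/-- Difference between the estimated and the actual loss in coordinate `i`. -/
noncomputable def coordError (n i : ℕ) (t : ℝ) (p : ℝ × ℝ≥0∞) (x : ℝ) : ℝ :=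
  (M.b i + M.h i) * √(M.errVar i p.2) * M.coordT γ n i p.2 (x - p.1)
    - M.coordLoss i t (M.coordPredictor i p x)

@[fun_prop]
lemma continuous_coordPredictor (i : ℕ) (p : ℝ × ℝ≥0∞) : Continuous (M.coordPredictor i p) := by
  unfold coordPredictor
  fun_prop

lemma abs_coordLoss_coordPredictor_sub_le (i : ℕ) (t : ℝ) (p : ℝ × ℝ≥0∞) (x y : ℝ) :
    |M.coordLoss i t (M.coordPredictor i p x) - M.coordLoss i t (M.coordPredictor i p y)|
      ≤ 2 * (M.b i + M.h i) * |x - y| := by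
  have hw := add_pos (M.b_pos i) (M.h_pos i)
  refine (M.abs_coordLoss_sub_le i t _ _).trans (mul_le_mul_of_nonneg_left ?_ (by positivity))
  have e : M.coordPredictor i p x - M.coordPredictor i p y = M.shrink i p.2 * (x - y) := by
    unfold coordPredictor; ring
  rw [e, abs_mul, abs_of_nonneg (M.shrink_nonneg i p.2)]
  exact mul_le_of_le_one_left (abs_nonneg _) (M.shrink_le_one i p.2)

lemma memLp_coordLoss_coordPredictor (i : ℕ) (t : ℝ) (p : ℝ × ℝ≥0∞) :
    MemLp (fun x => M.coordLoss i t (M.coordPredictor i p x)) 2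
      (gaussianReal t (M.σp i).toNNReal) := by
  have hc := M.continuous_coordLoss i t
  have hid : MemLp (fun x : ℝ => x) 2 (gaussianReal t (M.σp i).toNNReal) :=
    memLp_id_gaussianReal' 2 (by simp)
  have hd : MemLp (fun x : ℝ => M.coordLoss i t (M.coordPredictor i p x)
      - M.coordLoss i t (M.coordPredictor i p t)) 2 (gaussianReal t (M.σp i).toNNReal) := by
    refine ((hid.sub (memLp_const t)).const_mul (2 * (M.b i + M.h i))).mono (by fun_prop)
      (ae_of_all _ fun x => ?_)
    have hw := add_pos (M.b_pos i) (M.h_pos i)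
    rw [Real.norm_eq_abs, Real.norm_eq_abs, abs_mul,
      abs_of_pos (by positivity : 0 < 2 * (M.b i + M.h i))]
    exact M.abs_coordLoss_coordPredictor_sub_le i t p x t
  refine (hd.add (memLp_const (M.coordLoss i t (M.coordPredictor i p t)))).ae_eq
    (ae_of_all _ fun x => ?_)
  simp

/-- The loss itself is not bounded in `t` and `η`, but it is Lipschitz in the observation with a
constant free of both, so its fluctuation is of the order of the noise variance. -/
lemma integral_coordLoss_sub_sq_le {K : ℝ} (hK : M.BoundedBy K) (i : ℕ) (t : ℝ)
    (p : ℝ × ℝ≥0∞) :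
    ∫ x, (M.coordLoss i t (M.coordPredictor i p x) - M.coordLoss i t (M.coordPredictor i p t)) ^ 2
      ∂(gaussianReal t (M.σp i).toNNReal) ≤ 4 * K ^ 3 := by
  have hw := add_pos (M.b_pos i) (M.h_pos i)
  have hwK := hK.weight_le i
  have hK0 := hK.one_le
  have hσ := M.σp_pos i
  have hpt : ∀ x, (M.coordLoss i t (M.coordPredictor i p x)
      - M.coordLoss i t (M.coordPredictor i p t)) ^ 2 ≤ 4 * K ^ 2 * (x - t) ^ 2 := by
    intro x
    have h := M.abs_coordLoss_coordPredictor_sub_le i t p x t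
    rw [← sq_abs, ← sq_abs (x - t)]
    refine (pow_le_pow_left₀ (abs_nonneg _) h 2).trans ?_
    rw [mul_pow, mul_pow]
    have : (M.b i + M.h i) ^ 2 ≤ K ^ 2 := pow_le_pow_left₀ hw.le hwK 2
    have h2 := sq_nonneg |x - t|
    nlinarith
  refine (integral_mono_of_nonneg (ae_of_all _ fun x => sq_nonneg _)
    ((integrable_sub_sq_gaussianReal t _ t).const_mul (4 * K ^ 2)) (ae_of_all _ hpt)).trans ?_
  rw [integral_const_mul, integral_sub_sq_gaussianReal, Real.coe_toNNReal _ hσ.le]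
  have := hK.σp_le i
  calc 4 * K ^ 2 * M.σp i ≤ 4 * K ^ 2 * K := by gcongr
    _ = 4 * K ^ 3 := by ring

lemma sqrt_errVar_le {K : ℝ} (hK : M.BoundedBy K) (i : ℕ) (τ : ℝ≥0∞) :
    √(M.errVar i τ) ≤ 2 * K := by
  have hK0 := hK.one_le
  have h1 : M.shrink i τ ^ 2 ≤ 1 := pow_le_one₀ (M.shrink_nonneg i τ) (M.shrink_le_one i τ)
  have h2 : M.σp i * M.shrink i τ ^ 2 ≤ M.σp i := mul_le_of_le_one_right (M.σp_pos i).le h1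
  refine Real.sqrt_le_iff.2 ⟨by linarith, ?_⟩
  unfold errVar
  nlinarith [hK.σp_le i, hK.σf_le i]

lemma coordError_moments_of_coordT {K : ℝ} (hK : M.BoundedBy K) (n i : ℕ) (t : ℝ)
    (p : ℝ × ℝ≥0∞) {ε₁ ε₂ : ℝ}
    (h₀ : MemLp (fun x => M.coordT γ n i p.2 (x - p.1)) 2 (gaussianReal t (M.σp i).toNNReal))
    (h₁ : |(∫ x, M.coordT γ n i p.2 (x - p.1) ∂(gaussianReal t (M.σp i).toNNReal))
      - lossG (M.stdBias i t p) (M.ratio i)| ≤ ε₁)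
    (h₂ : ∫ x, (M.coordT γ n i p.2 (x - p.1) - lossG (M.stdBias i t p) (M.ratio i)) ^ 2
      ∂(gaussianReal t (M.σp i).toNNReal) ≤ ε₂) :
    MemLp (M.coordError γ n i t p) 2 (gaussianReal t (M.σp i).toNNReal) ∧
    |∫ x, M.coordError γ n i t p x ∂(gaussianReal t (M.σp i).toNNReal)| ≤ 2 * K ^ 2 * ε₁ ∧
    Var[M.coordError γ n i t p; gaussianReal t (M.σp i).toNNReal]
      ≤ 8 * K ^ 4 * ε₂ + 8 * K ^ 3 := by
  set μ := gaussianReal t (M.σp i).toNNReal with hμ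
  set g := lossG (M.stdBias i t p) (M.ratio i) with hg
  set A := (M.b i + M.h i) * √(M.errVar i p.2) with hA
  have hK0 := hK.one_le
  have hw := add_pos (M.b_pos i) (M.h_pos i)
  have hA0 : 0 ≤ A := mul_nonneg hw.le (Real.sqrt_nonneg _)
  have hAK : A ≤ 2 * K ^ 2 := by
    calc A ≤ K * (2 * K) :=
          mul_le_mul (hK.weight_le i) (M.sqrt_errVar_le hK i p.2) (Real.sqrt_nonneg _) (by linarith)
      _ = 2 * K ^ 2 := by ring
  have hL := M.memLp_coordLoss_coordPredictor i t p
  have m1 : MemLp (fun x => A * M.coordT γ n i p.2 (x - p.1)) 2 μ := h₀.const_mul A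
  have hD : MemLp (M.coordError γ n i t p) 2 μ := m1.sub hL
  have e1 : ∫ x, M.coordError γ n i t p x ∂μ
      = A * ((∫ x, M.coordT γ n i p.2 (x - p.1) ∂μ) - g) := by
    have : ∫ x, M.coordError γ n i t p x ∂μ = _ :=
      integral_sub (m1.integrable one_le_two) (hL.integrable one_le_two)
    rw [this, integral_const_mul, integral_coordLoss_coordPredictor]
    ring
  refine ⟨hD, ?_, ?_⟩
  · rw [e1, abs_mul, abs_of_nonneg hA0]
    exact mul_le_mul hAK h₁ (abs_nonneg _) (by positivity)
  -- The centering splits the deviation into that of the estimate from `g` and that of the loss from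
  -- its value at `x = t`; both are bounded uniformly in `t` and `p`.
  · refine (variance_le_integral_sub_sq hD.aestronglyMeasurable
      (A * g - M.coordLoss i t (M.coordPredictor i p t))).trans ?_
    have i1 : Integrable (fun x => (M.coordT γ n i p.2 (x - p.1) - g) ^ 2) μ :=
      (h₀.sub (memLp_const g)).integrable_sq
    have i2 : Integrable (fun x => (M.coordLoss i t (M.coordPredictor i p x)
        - M.coordLoss i t (M.coordPredictor i p t)) ^ 2) μ :=
      (hL.sub (memLp_const _)).integrable_sq
    refine (integral_mono_of_nonneg (ae_of_all _ fun x => sq_nonneg _)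
      ((i1.const_mul (2 * A ^ 2)).add (i2.const_mul 2)) (ae_of_all _ fun x => ?_)).trans ?_
    · simp only [coordError, ← hA, Pi.add_apply]
      nlinarith [sq_nonneg (A * (M.coordT γ n i p.2 (x - p.1) - g)
        + (M.coordLoss i t (M.coordPredictor i p x) - M.coordLoss i t (M.coordPredictor i p t)))]
    · simp only [Pi.add_apply]
      rw [integral_add (i1.const_mul _) (i2.const_mul _), integral_const_mul, integral_const_mul]
      have h3 := M.integral_coordLoss_sub_sq_le hK i t p
      have h4 : A ^ 2 ≤ (2 * K ^ 2) ^ 2 := pow_le_pow_left₀ hA0 hAK 2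
      have h5 : 0 ≤ ∫ x, (M.coordT γ n i p.2 (x - p.1) - g) ^ 2 ∂μ :=
        integral_nonneg fun _ => sq_nonneg _
      have h6 : A ^ 2 * ∫ x, (M.coordT γ n i p.2 (x - p.1) - g) ^ 2 ∂μ ≤ (2 * K ^ 2) ^ 2 * ε₂ :=
        mul_le_mul h4 h₂ h5 (by positivity)
      linarith

/-- Uniform bounds on the mean and the variance of the coordinatewise errors. -/
lemma exists_coordError_moments {K : ℝ} (hK : M.BoundedBy K) (hA3 : M.SufficientHistory)
    (hγ : M.ThresholdConstants γ) :
    ∃ C : ℝ, 0 ≤ C ∧ ∀ᶠ n : ℕ in atTop, ∀ (i : ℕ) (t : ℝ) (p : ℝ × ℝ≥0∞), p.2 ≠ ⊤ →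
      MemLp (M.coordError γ n i t p) 2 (gaussianReal t (M.σp i).toNNReal) ∧
      |∫ x, M.coordError γ n i t p x ∂(gaussianReal t (M.σp i).toNNReal)| ≤ C / √(Real.log n) ∧
      Var[M.coordError γ n i t p; gaussianReal t (M.σp i).toNNReal]
        ≤ C * n / √(Real.log n) := by
  obtain ⟨⟨r₀, hr₀, hr⟩, -, -⟩ := hA3
  obtain ⟨⟨γ₀, hγ₀, hγ₁⟩, hγ₂⟩ := hγ
  have he : 0 < Real.exp 1 := Real.exp_pos 1
  have hri : ∀ i, 0 < M.σp i / M.σf i := fun i => div_pos (M.σp_pos i) (M.σf_pos i)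
  have hr₀0 : 0 < r₀ := (hri 0).trans_le (hr 0)
  set q := 1 / √(4 * Real.exp 1) with hq
  have hq2 : q ^ 2 = 1 / (4 * Real.exp 1) := by
    rw [hq, div_pow, Real.sq_sqrt (by positivity), one_pow]
  have hq0 : 0 < q := by positivity
  have hrq : √r₀ < q := by
    rw [Real.sqrt_lt' hq0, hq2]; exact hr₀
  have h2 : 1 < √2 := by rw [Real.lt_sqrt zero_le_one]; norm_num
  have h22 : √2 ^ 2 = 2 := Real.sq_sqrt (by norm_num)
  -- Since `γ < q - √r`, the sum `γ + √(2r)` is at most `q + (√2 - 1) √r`, uniformly bounded by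
  -- `W₀`. The strict inequality `√r₀ < q` gives `W₀ < √2 q`, that is, `2 e W₀² < 1`.
  set W₀ := q + (√2 - 1) * √r₀ with hW₀
  have hW₀0 : 0 < W₀ := add_pos_of_pos_of_nonneg hq0
    (mul_nonneg (by linarith) (Real.sqrt_nonneg _))
  have hW₀lt : W₀ < √2 * q := by
    have : (√2 - 1) * √r₀ < (√2 - 1) * q := mul_lt_mul_of_pos_left hrq (by linarith)
    linarith
  have hW₀2 : 2 * Real.exp 1 * W₀ ^ 2 < 1 := by
    have h3 : W₀ ^ 2 < (√2 * q) ^ 2 := pow_lt_pow_left₀ hW₀lt hW₀0.le two_ne_zero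
    rw [mul_pow, h22, hq2] at h3
    calc 2 * Real.exp 1 * W₀ ^ 2 < 2 * Real.exp 1 * (2 * (1 / (4 * Real.exp 1))) := by gcongr
      _ = 1 := by field_simp; norm_num
  set c := min (γ₀ ^ 2 / 4) (1 - 2 * Real.exp 1 * W₀ ^ 2) with hc
  have hc0 : 0 < c := lt_min (by positivity) (by linarith)
  have hK0 := hK.one_le
  refine ⟨2 * K ^ 2 * 100 + (8 * K ^ 4 * 200 + 8 * K ^ 3), by positivity, ?_⟩
  have ev1 : ∀ᶠ n : ℕ in atTop, 1 ≤ Real.log n := tendsto_log_natCast_atTop.eventually_ge_atTop 1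
  have ev2 : ∀ᶠ n : ℕ in atTop, Real.log n ^ 3 * Real.exp (-c * Real.log n) ≤ 1 :=
    tendsto_log_natCast_atTop.eventually (eventually_pow_mul_exp_neg_le hc0)
  have ev3 : ∀ᶠ n : ℕ in atTop, (γ₀⁻¹) ^ 2 ≤ Real.log n :=
    tendsto_log_natCast_atTop.eventually_ge_atTop _
  filter_upwards [ev1, ev2, ev3, eventually_gt_atTop 0] with n hn1 hn2 hn3 hn4 i t p hp
  have hn0 : (0 : ℝ) < n := Nat.cast_pos.2 hn4
  have hsL : 0 < √(Real.log n) := Real.sqrt_pos.2 (by linarith)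
  have hL1 : 1 ≤ γ₀ * √(2 * Real.log n) := by
    have : γ₀⁻¹ ≤ √(2 * Real.log n) := Real.le_sqrt_of_sq_le (by linarith)
    calc 1 = γ₀ * γ₀⁻¹ := (mul_inv_cancel₀ hγ₀.ne').symm
      _ ≤ _ := by gcongr
  have hW : γ i + √(2 * (M.σp i / M.σf i)) ≤ W₀ := by
    rw [Real.sqrt_mul (by norm_num)]
    have h3 : √(M.σp i / M.σf i) ≤ √r₀ := Real.sqrt_le_sqrt (hr i)
    have h4 : (√2 - 1) * √(M.σp i / M.σf i) ≤ (√2 - 1) * √r₀ :=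
      mul_le_mul_of_nonneg_left h3 (by linarith)
    linarith [hγ₂ i]
  have hs2 : 2 * M.noiseScale i p.2 ^ 2 ≤ Real.exp (-1) := by
    have h3 := M.noiseScale_sq_le i p.2
    have h4 : 4 * (1 / (4 * Real.exp 1)) = Real.exp (-1) := by
      rw [Real.exp_neg]; field_simp
    linarith [hr i]
  -- The Hermite degrees `2, …, K_n(i)` make `K_n(i) - 1` terms, so the number of terms is exactly
  -- the ceiling in the truncation order.
  have key := selectEstimate_error_of_log (L := Real.log n) hγ₀ hc0.le (min_le_left _ _)
    (min_le_right _ _) hn1 hL1 hn2 (hγ₁ i) hW (M.noiseScale_pos i hp) (M.noiseScale_sq_le i p.2) hs2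
    (M.ratio_nonneg i) (M.ratio_le_one i) (M.stdBias i t p) (M.truncOrder γ n i - 1)
    (by unfold truncOrder; rw [Nat.add_sub_cancel_left])
  rw [Real.exp_log hn0] at key
  have hl : 0 ≤ threshold γ n i :=
    mul_nonneg (hγ₀.le.trans (hγ₁ i)) (Real.sqrt_nonneg _)
  obtain ⟨k0, k1, k2⟩ := M.coordT_moments γ n i t p hl key.1 key.2
  obtain ⟨d0, d1, d2⟩ := M.coordError_moments_of_coordT γ hK n i t p k0 k1 k2
  refine ⟨d0, d1.trans ?_, d2.trans ?_⟩
  · rw [← mul_div_assoc]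
    gcongr
    have : 0 ≤ 8 * K ^ 4 * 200 + 8 * K ^ 3 := by positivity
    linarith
  -- Lets the bounded fluctuation `8 K³` of the loss be absorbed into the rate `n / √(log n)`.
  · have h3 : 1 ≤ n / √(Real.log n) := by
      rw [one_le_div hsL]
      have h5 : √(Real.log n) ≤ Real.log n := Real.sqrt_le_iff.2 ⟨by linarith, by nlinarith⟩
      linarith [Real.log_le_sub_one_of_pos hn0]
    rw [mul_div_assoc, mul_div_assoc]
    set y := (n : ℝ) / √(Real.log n) with hy
    have h4 : 0 ≤ 2 * K ^ 2 * 100 * y := by positivity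
    have h5 : 8 * K ^ 3 * 1 ≤ 8 * K ^ 3 * y := by gcongr
    linarith

end PredModel

/-! ### Averaging independent coordinates -/

/-- Second moment equals variance plus squared mean, and independence makes the variance of the
average at most `v / n`. A coordinate variance almost as large as `n` is therefore affordable. -/
lemma integral_average_sq_le {n : ℕ} (hn : 0 < n) {μ : Fin n → Measure ℝ}
    [∀ i, IsProbabilityMeasure (μ i)] {f : Fin n → ℝ → ℝ} (hf : ∀ i, MemLp (f i) 2 (μ i))
    {m v : ℝ} (hm : ∀ i, |∫ x, f i x ∂(μ i)| ≤ m) (hv : ∀ i, Var[f i; μ i] ≤ v) :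
    MemLp (fun x : Fin n → ℝ => (1 / (n : ℝ)) * ∑ i, f i (x i)) 2 (Measure.pi μ) ∧
    ∫ x, ((1 / (n : ℝ)) * ∑ i, f i (x i)) ^ 2 ∂(Measure.pi μ) ≤ v / n + m ^ 2 := by
  have hn0 : (0 : ℝ) < n := Nat.cast_pos.2 hn
  have hfi : ∀ i, MemLp (fun x : Fin n → ℝ => f i (x i)) 2 (Measure.pi μ) := fun i =>
    (hf i).comp_measurePreserving (measurePreserving_eval μ i)
  have hS : MemLp (fun x : Fin n → ℝ => ∑ i, f i (x i)) 2 (Measure.pi μ) :=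
    memLp_finsetSum _ fun i _ => hfi i
  have hD := hS.const_mul (1 / (n : ℝ))
  refine ⟨hD, ?_⟩
  have e1 : (fun x : Fin n → ℝ => ∑ i, f i (x i)) = ∑ i, fun x : Fin n → ℝ => f i (x i) := by
    ext x; simp
  have hvar := variance_sum_pi hf
  rw [← e1] at hvar
  have hvar2 := variance_const_mul (1 / (n : ℝ)) (fun x : Fin n → ℝ => ∑ i, f i (x i))
    (Measure.pi μ)
  rw [variance_eq_sub hD, hvar] at hvar2
  have hmean : |∫ x, ((1 / (n : ℝ)) * ∑ i, f i (x i)) ∂(Measure.pi μ)| ≤ m := by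
    rw [integral_const_mul, integral_finsetSum _ fun i _ => (hfi i).integrable one_le_two]
    have e2 : ∀ i, ∫ x : Fin n → ℝ, f i (x i) ∂(Measure.pi μ) = ∫ x, f i x ∂(μ i) := fun i => by
      conv_rhs => rw [← (measurePreserving_eval μ i).map_eq]
      rw [integral_map (measurable_pi_apply i).aemeasurable]
      rw [(measurePreserving_eval μ i).map_eq]
      exact (hf i).aestronglyMeasurable
    simp_rw [e2]
    rw [abs_mul, abs_of_pos (by positivity : 0 < 1 / (n : ℝ)), one_div_mul_eq_div,
      div_le_iff₀ hn0]
    refine (Finset.abs_sum_le_sum_abs _ _).trans ((Finset.sum_le_sum fun i _ => hm i).trans ?_)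
    simp [mul_comm]
  have hmean2 : (∫ x, ((1 / (n : ℝ)) * ∑ i, f i (x i)) ∂(Measure.pi μ)) ^ 2 ≤ m ^ 2 := by
    rw [← sq_abs]
    exact pow_le_pow_left₀ (abs_nonneg _) hmean 2
  have hsum : ∑ i, Var[f i; μ i] ≤ n * v := by
    refine (Finset.sum_le_sum fun i _ => hv i).trans ?_
    simp
  have h3 : (1 / (n : ℝ)) ^ 2 * ∑ i, Var[f i; μ i] ≤ v / n := by
    refine (mul_le_mul_of_nonneg_left hsum (sq_nonneg _)).trans (le_of_eq ?_)
    field_simp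
  simp only [Pi.pow_apply] at hvar2
  linarith

namespace PredModel

variable (M : PredModel) (γ θ : ℕ → ℝ)

instance (n : ℕ) : IsProbabilityMeasure (M.pastLaw θ n) := by
  unfold pastLaw
  infer_instance

lemma loss_predictor_eq {n : ℕ} (p : ℝ × ℝ≥0∞) (x : Fin n → ℝ) :
    M.loss θ (M.predictor p x)
      = (1 / (n : ℝ)) * ∑ i : Fin n, M.coordLoss i (θ i) (M.coordPredictor i p (x i)) := rfl

lemma areD_sub_loss_eq {n : ℕ} (p : ℝ × ℝ≥0∞) (x : Fin n → ℝ) :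
    M.areD γ x p - M.loss θ (M.predictor p x)
      = (1 / (n : ℝ)) * ∑ i : Fin n, M.coordError γ n i (θ i) p (x i) := by
  rw [loss_predictor_eq, areD, areOrigin, ← mul_sub, ← Finset.sum_sub_distrib]
  rfl

/-- The risk estimate approximates the loss in mean, uniformly in the hyperparameters. -/
lemma exists_integral_abs_areD_sub_loss_le {K : ℝ} (hK : M.BoundedBy K)
    (hA3 : M.SufficientHistory) (hγ : M.ThresholdConstants γ) :
    ∃ C : ℝ, 0 ≤ C ∧ ∀ᶠ n : ℕ in atTop, ∀ p : ℝ × ℝ≥0∞, p.2 ≠ ⊤ →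
      Integrable (fun x : Fin n → ℝ => |M.areD γ x p - M.loss θ (M.predictor p x)|)
        (M.pastLaw θ n) ∧
      ∫ x : Fin n → ℝ, |M.areD γ x p - M.loss θ (M.predictor p x)| ∂(M.pastLaw θ n)
        ≤ C / √√(Real.log n) := by
  obtain ⟨C, hC0, hC⟩ := M.exists_coordError_moments γ hK hA3 hγ
  refine ⟨(1 + C + C ^ 2) / 2, by positivity, ?_⟩
  filter_upwards [hC, eventually_gt_atTop 0, tendsto_log_natCast_atTop.eventually_ge_atTop 1]
    with n hn hn0 hL p hp
  have hn0' : (0 : ℝ) < n := Nat.cast_pos.2 hn0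
  have hsL : 1 ≤ √(Real.log n) := Real.one_le_sqrt.2 hL
  obtain ⟨h1, h2⟩ := integral_average_sq_le hn0
    (μ := fun i : Fin n => gaussianReal (θ i) (M.σp i).toNNReal)
    (fun i => (hn i (θ i) p hp).1) (fun i => (hn i (θ i) p hp).2.1)
    (fun i => (hn i (θ i) p hp).2.2)
  simp_rw [← areD_sub_loss_eq] at h1 h2
  change MemLp _ 2 (M.pastLaw θ n) at h1
  change ∫ x : Fin n → ℝ, _ ∂(M.pastLaw θ n) ≤ _ at h2
  refine ⟨(h1.integrable one_le_two).abs, ?_⟩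
  set κ := √√(Real.log n) with hκ
  have hκ2 : κ ^ 2 = √(Real.log n) := Real.sq_sqrt (Real.sqrt_nonneg _)
  have hκ0 : 0 < κ := Real.sqrt_pos.2 (by linarith)
  -- The second moment is of order `κ^(-2)`; this weight balances the two terms, each of order `1 /
  -- κ`.
  have hpt : ∀ d : ℝ, |d| ≤ 1 / (2 * κ) + κ / 2 * d ^ 2 := by
    intro d
    rw [div_add' _ _ _ (by positivity), le_div_iff₀ (by positivity), ← sq_abs d]
    nlinarith [sq_nonneg (κ * |d| - 1)]
  refine (integral_mono (h1.integrable one_le_two).abs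
    ((integrable_const (1 / (2 * κ))).add (h1.integrable_sq.const_mul (κ / 2)))
    fun x => hpt _).trans ?_
  simp only [Pi.add_apply]
  rw [integral_add (integrable_const _) (h1.integrable_sq.const_mul _), integral_const_mul,
    integral_const, probReal_univ, one_smul]
  have h3 : C * n / √(Real.log n) / n + (C / √(Real.log n)) ^ 2 ≤ (C + C ^ 2) / κ ^ 2 := by
    rw [hκ2, add_div]
    refine add_le_add (le_of_eq (by field_simp)) ?_
    rw [div_pow]
    gcongr
    nlinarith
  have h4 := mul_le_mul_of_nonneg_left (h2.trans h3) (by positivity : 0 ≤ κ / 2)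
  calc _ ≤ 1 / (2 * κ) + κ / 2 * ((C + C ^ 2) / κ ^ 2) := by linarith
    _ = _ := by field_simp; ring

end PredModel

/-! ### The scale parameter on the unit interval -/

/-- The coordinate `τ / (τ + 1)` on `[0, ∞]`. -/
noncomputable def scaleCoord (τ : ℝ≥0∞) : ℝ := if τ = ⊤ then 1 else τ.toReal / (τ.toReal + 1)

lemma scaleCoord_mem (τ : ℝ≥0∞) : scaleCoord τ ∈ Set.Icc (0 : ℝ) 1 := by
  unfold scaleCoord
  have := ENNReal.toReal_nonneg (a := τ)
  split_ifs
  · simp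
  · exact ⟨by positivity, div_le_one_of_le₀ (by linarith) (by positivity)⟩

lemma scaleCoord_ofReal {u : ℝ} (h0 : 0 ≤ u) (h1 : u < 1) :
    scaleCoord (ENNReal.ofReal (u / (1 - u))) = u := by
  have h2 : 0 < 1 - u := by linarith
  rw [scaleCoord, if_neg ENNReal.ofReal_ne_top, ENNReal.toReal_ofReal (by positivity)]
  field_simp
  ring

/-- The inverse of `scaleCoord`. -/
noncomputable def scaleOf (u : ℝ) : ℝ≥0∞ := if u < 1 then ENNReal.ofReal (u / (1 - u)) else ⊤

lemma scaleCoord_scaleOf {u : ℝ} (h0 : 0 ≤ u) (h1 : u ≤ 1) : scaleCoord (scaleOf u) = u := by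
  unfold scaleOf
  split_ifs with h
  · exact scaleCoord_ofReal h0 h
  · rw [scaleCoord, if_pos rfl]
    linarith

namespace PredModel

variable (M : PredModel) (θ : ℕ → ℝ)

lemma shrink_eq (i : ℕ) (τ : ℝ≥0∞) :
    M.shrink i τ = scaleCoord τ / (scaleCoord τ + (1 - scaleCoord τ) * M.σp i) := by
  unfold shrink scaleCoord
  have h := ENNReal.toReal_nonneg (a := τ)
  have hp := M.σp_pos i
  split_ifs
  · simp
  · have h1 : τ.toReal + 1 ≠ 0 := by positivity
    have h2 : τ.toReal + M.σp i ≠ 0 := by positivity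
    have e : τ.toReal / (τ.toReal + 1) + (1 - τ.toReal / (τ.toReal + 1)) * M.σp i
        = (τ.toReal + M.σp i) / (τ.toReal + 1) := by field_simp; ring
    rw [e]
    field_simp

/-- In the coordinate `u = τ / (τ + 1)` the shrinkage factor is `u / (u + (1 - u) σ)`. Both
denominators are at least `min 1 σ`, so the Lipschitz constant is at most `σ / (min 1 σ)² = max(σ,
1/σ)`. This covers `τ = ∞` as well. -/
lemma abs_shrink_sub_le {K : ℝ} (hK : M.BoundedBy K) (i : ℕ) (τ τ' : ℝ≥0∞) :
    |M.shrink i τ - M.shrink i τ'| ≤ K * |scaleCoord τ - scaleCoord τ'| := by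
  have hp := M.σp_pos i
  obtain ⟨u0, u1⟩ := scaleCoord_mem τ
  obtain ⟨w0, w1⟩ := scaleCoord_mem τ'
  rw [shrink_eq, shrink_eq]
  set u := scaleCoord τ
  set w := scaleCoord τ'
  set σ := M.σp i with hσ
  set m := min 1 σ with hm
  have hm0 : 0 < m := lt_min one_pos hp
  have hu : m ≤ u + (1 - u) * σ := by
    nlinarith [mul_le_mul_of_nonneg_left (min_le_left 1 σ) u0,
      mul_le_mul_of_nonneg_left (min_le_right 1 σ) (sub_nonneg.2 u1)]
  have hw : m ≤ w + (1 - w) * σ := by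
    nlinarith [mul_le_mul_of_nonneg_left (min_le_left 1 σ) w0,
      mul_le_mul_of_nonneg_left (min_le_right 1 σ) (sub_nonneg.2 w1)]
  have hu0 := hm0.trans_le hu
  have hw0 := hm0.trans_le hw
  have e : u / (u + (1 - u) * σ) - w / (w + (1 - w) * σ)
      = σ / ((u + (1 - u) * σ) * (w + (1 - w) * σ)) * (u - w) := by
    rw [div_sub_div _ _ hu0.ne' hw0.ne', div_mul_eq_mul_div]
    congr 1
    ring
  rw [e, abs_mul, abs_of_pos (by positivity)]
  refine mul_le_mul_of_nonneg_right ?_ (abs_nonneg _)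
  have h1 : σ / ((u + (1 - u) * σ) * (w + (1 - w) * σ)) ≤ σ / (m * m) := by gcongr
  refine h1.trans ?_
  rcases le_total 1 σ with h | h
  · rw [hm, min_eq_left h]
    simpa using hK.σp_le i
  · rw [hm, min_eq_right h, div_mul_cancel_left₀ hp.ne']
    exact hK.inv_σp_le i

lemma sqrt_predVar_le {K : ℝ} (hK : M.BoundedBy K) (i : ℕ) (τ : ℝ≥0∞) :
    √(M.σf i + M.shrink i τ * M.σp i) ≤ 2 * K := by
  have hK0 := hK.one_le
  have h2 : M.shrink i τ * M.σp i ≤ M.σp i :=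
    mul_le_of_le_one_left (M.σp_pos i).le (M.shrink_le_one i τ)
  refine Real.sqrt_le_iff.2 ⟨by linarith, ?_⟩
  nlinarith [hK.σp_le i, hK.σf_le i]

lemma sqrt_σf_le {K : ℝ} (hK : M.BoundedBy K) (i : ℕ) : √(M.σf i) ≤ K := by
  have hK0 := hK.one_le
  exact Real.sqrt_le_iff.2 ⟨by linarith, by nlinarith [hK.σf_le i]⟩

/-- Difference of squares, with the sum of the roots bounded below by `√σf`. Because `σp ≤ σf`, the
quotient is controlled by `√σf`, and no lower bound on `σf` is needed. -/
lemma abs_sqrt_predVar_sub_le {K : ℝ} (hK : M.BoundedBy K) (i : ℕ) (τ τ' : ℝ≥0∞) :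
    |√(M.σf i + M.shrink i τ * M.σp i) - √(M.σf i + M.shrink i τ' * M.σp i)|
      ≤ K * |M.shrink i τ - M.shrink i τ'| := by
  have hp := M.σp_pos i
  have hf := M.σf_pos i
  have a0 := M.shrink_nonneg i τ
  have b0 := M.shrink_nonneg i τ'
  have hs := Real.sqrt_pos.2 hf
  set α := M.shrink i τ
  set β := M.shrink i τ'
  have h1 : √(M.σf i) ≤ √(M.σf i + α * M.σp i) :=
    Real.sqrt_le_sqrt (by nlinarith)
  have h2 : 0 ≤ √(M.σf i + β * M.σp i) := Real.sqrt_nonneg _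
  have e1 : √(M.σf i + α * M.σp i) ^ 2 = M.σf i + α * M.σp i := Real.sq_sqrt (by positivity)
  have e2 : √(M.σf i + β * M.σp i) ^ 2 = M.σf i + β * M.σp i := Real.sq_sqrt (by positivity)
  set a := √(M.σf i + α * M.σp i)
  set b := √(M.σf i + β * M.σp i)
  have e3 : (a - b) * (a + b) = (α - β) * M.σp i := by
    have : (a - b) * (a + b) = a ^ 2 - b ^ 2 := by ring
    rw [this, e1, e2]; ring
  have e4 : |a - b| * (a + b) = |α - β| * M.σp i := by
    rw [← abs_of_pos (by linarith : 0 < a + b), ← abs_mul, e3, abs_mul, abs_of_pos hp]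
  have h3 : |a - b| * √(M.σf i) ≤ |α - β| * M.σf i := by
    calc |a - b| * √(M.σf i) ≤ |a - b| * (a + b) := by gcongr; linarith
      _ = |α - β| * M.σp i := e4
      _ ≤ |α - β| * M.σf i := by gcongr; exact hK.σp_le_σf i
  have h4 : |α - β| * M.σf i = |α - β| * √(M.σf i) * √(M.σf i) := by
    rw [mul_assoc, Real.mul_self_sqrt hf.le]
  rw [h4] at h3
  have h5 := le_of_mul_le_mul_right h3 hs
  rw [mul_comm K]
  exact h5.trans (mul_le_mul_of_nonneg_left (M.sqrt_σf_le hK i) (abs_nonneg _))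

lemma abs_coordPredictor_sub_le {K : ℝ} (hK : M.BoundedBy K) (i : ℕ) (p p' : ℝ × ℝ≥0∞) (x : ℝ) :
    |M.coordPredictor i p x - M.coordPredictor i p' x|
      ≤ |p.1 - p'.1| + K * |scaleCoord p.2 - scaleCoord p'.2| * (|x| + |p.1| + K ^ 2) := by
  have hK0 := hK.one_le
  set α := M.shrink i p.2 with hα
  set β := M.shrink i p'.2 with hβ
  set ζ := stdNormalQuantile (M.ratio i)
  have b0 := M.shrink_nonneg i p'.2
  have b1 := M.shrink_le_one i p'.2
  have e : M.coordPredictor i p x - M.coordPredictor i p' x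
      = (1 - β) * (p.1 - p'.1) + ((α - β) * (x - p.1)
        + (√(M.σf i + α * M.σp i) - √(M.σf i + β * M.σp i)) * ζ) := by
    unfold coordPredictor
    ring
  have h1 := M.abs_shrink_sub_le hK i p.2 p'.2
  have h2 := M.abs_sqrt_predVar_sub_le hK i p.2 p'.2
  rw [← hα, ← hβ] at h1 h2
  have t1 : |(1 - β) * (p.1 - p'.1)| ≤ |p.1 - p'.1| := by
    rw [abs_mul, abs_of_nonneg (by linarith : 0 ≤ 1 - β)]
    exact mul_le_of_le_one_left (abs_nonneg _) (by linarith)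
  have t2 : |(α - β) * (x - p.1)| ≤ |α - β| * (|x| + |p.1|) := by
    rw [abs_mul]
    exact mul_le_mul_of_nonneg_left (abs_sub _ _) (abs_nonneg _)
  have t3 : |(√(M.σf i + α * M.σp i) - √(M.σf i + β * M.σp i)) * ζ| ≤ |α - β| * K ^ 2 := by
    rw [abs_mul]
    refine (mul_le_mul h2 (hK.quantile_le i) (abs_nonneg _) (by positivity)).trans (le_of_eq ?_)
    ring
  rw [e]
  calc _ ≤ |p.1 - p'.1| + (|α - β| * (|x| + |p.1|) + |α - β| * K ^ 2) :=
        (abs_add_le _ _).trans (add_le_add t1 ((abs_add_le _ _).trans (add_le_add t2 t3)))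
    _ = |p.1 - p'.1| + |α - β| * (|x| + |p.1| + K ^ 2) := by ring
    _ ≤ _ := by gcongr

/-- Average absolute value of a sample. -/
noncomputable def _root_.avgAbs {n : ℕ} (x : Fin n → ℝ) : ℝ := (∑ i, |x i|) / n

lemma _root_.avgAbs_nonneg {n : ℕ} (x : Fin n → ℝ) : 0 ≤ avgAbs x := by
  unfold avgAbs
  positivity

lemma loss_nonneg {n : ℕ} (q : Fin n → ℝ) : 0 ≤ M.loss θ q :=
  mul_nonneg (by positivity) (Finset.sum_nonneg fun i _ => M.coordLoss_nonneg i _ _)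

lemma _root_.one_div_mul_sum_affine {n : ℕ} (hn : 0 < n) (a c : ℝ) (x : Fin n → ℝ) :
    (1 / (n : ℝ)) * ∑ i, (a + c * |x i|) = a + c * avgAbs x := by
  have hn0 : (n : ℝ) ≠ 0 := (Nat.cast_pos.2 hn).ne'
  rw [Finset.sum_add_distrib, ← Finset.mul_sum, avgAbs]
  simp
  field_simp

/-- Continuity of the loss in the hyperparameters. It controls the cost of rounding to the grid and
also gives the measurability of the oracle loss. -/
lemma abs_loss_sub_le {K : ℝ} (hK : M.BoundedBy K) {n : ℕ} (hn : 0 < n) (p p' : ℝ × ℝ≥0∞)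
    (x : Fin n → ℝ) :
    |M.loss θ (M.predictor p x) - M.loss θ (M.predictor p' x)|
      ≤ 2 * K * |p.1 - p'.1|
        + 2 * K ^ 2 * |scaleCoord p.2 - scaleCoord p'.2| * (avgAbs x + |p.1| + K ^ 2) := by
  have hK0 := hK.one_le
  rw [loss_predictor_eq, loss_predictor_eq, ← mul_sub, ← Finset.sum_sub_distrib, abs_mul,
    abs_of_nonneg (by positivity : 0 ≤ 1 / (n : ℝ))]
  set D := |scaleCoord p.2 - scaleCoord p'.2|
  have h : ∀ i : Fin n, |M.coordLoss i (θ i) (M.coordPredictor i p (x i))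
      - M.coordLoss i (θ i) (M.coordPredictor i p' (x i))|
      ≤ (2 * K * |p.1 - p'.1| + 2 * K ^ 2 * D * (|p.1| + K ^ 2)) + 2 * K ^ 2 * D * |x i| := by
    intro i
    refine (M.abs_coordLoss_sub_le i _ _ _).trans ?_
    have hw := hK.weight_le i
    have h2 := M.abs_coordPredictor_sub_le hK i p p' (x i)
    refine (mul_le_mul (mul_le_mul_of_nonneg_left hw zero_le_two) h2 (abs_nonneg _)
      (by positivity)).trans (le_of_eq ?_)
    ring
  refine (mul_le_mul_of_nonneg_left ((Finset.abs_sum_le_sum_abs _ _).trans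
    (Finset.sum_le_sum fun i _ => h i)) (by positivity)).trans ?_
  rw [one_div_mul_sum_affine hn]
  exact le_of_eq (by ring)

lemma loss_le {K : ℝ} (hK : M.BoundedBy K) {n : ℕ} (hn : 0 < n) (p : ℝ × ℝ≥0∞)
    (x : Fin n → ℝ) :
    M.loss θ (M.predictor p x)
      ≤ 2 * K * (avgAbs x + |p.1| + avgAbs (fun i : Fin n => θ i) + 3 * K ^ 2) := by
  have hK0 := hK.one_le
  have hKK : K ≤ K ^ 2 := by nlinarith
  have h : ∀ i : Fin n, M.coordLoss i (θ i) (M.coordPredictor i p (x i))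
      ≤ (2 * K * (|p.1| + 3 * K ^ 2) + 2 * K * |x i|) + 2 * K * |θ i| := by
    intro i
    have a0 := M.shrink_nonneg i p.2
    have a1 := M.shrink_le_one i p.2
    have hq : |M.coordPredictor i p (x i) - θ i| ≤ |x i| + |p.1| + 2 * K ^ 2 + |θ i| := by
      refine (abs_sub _ _).trans (add_le_add ?_ le_rfl)
      have t1 : |M.shrink i p.2 * x i| ≤ |x i| := by
        rw [abs_mul, abs_of_nonneg a0]
        exact mul_le_of_le_one_left (abs_nonneg _) a1
      have t2 : |(1 - M.shrink i p.2) * p.1| ≤ |p.1| := by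
        rw [abs_mul, abs_of_nonneg (by linarith : 0 ≤ 1 - M.shrink i p.2)]
        exact mul_le_of_le_one_left (abs_nonneg _) (by linarith)
      have t3 : |√(M.σf i + M.shrink i p.2 * M.σp i) * stdNormalQuantile (M.ratio i)|
          ≤ 2 * K ^ 2 := by
        rw [abs_mul, abs_of_nonneg (Real.sqrt_nonneg _)]
        refine (mul_le_mul (M.sqrt_predVar_le hK i p.2) (hK.quantile_le i) (abs_nonneg _)
          (by positivity)).trans (le_of_eq (by ring))
      unfold coordPredictor
      exact (abs_add_le _ _).trans (add_le_add ((abs_add_le _ _).trans (add_le_add t1 t2)) t3)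
    have hw := hK.weight_le i
    have hs := M.sqrt_σf_le hK i
    refine (M.coordLoss_le i _ _).trans ?_
    calc (M.b i + M.h i) * (√(M.σf i) + 2 * |M.coordPredictor i p (x i) - θ i|)
        ≤ K * (K + 2 * (|x i| + |p.1| + 2 * K ^ 2 + |θ i|)) := by
          refine mul_le_mul hw (by linarith) ?_ (by linarith)
          have := Real.sqrt_nonneg (M.σf i)
          positivity
      _ ≤ K * (2 * K ^ 2 + 2 * (|x i| + |p.1| + 2 * K ^ 2 + |θ i|)) := by
          gcongr
          linarith
      _ = _ := by ring
  rw [loss_predictor_eq]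
  refine (mul_le_mul_of_nonneg_left (Finset.sum_le_sum fun i _ => h i) (by positivity)).trans ?_
  rw [Finset.sum_add_distrib, mul_add, one_div_mul_sum_affine hn]
  have := one_div_mul_sum_affine hn 0 (2 * K) (fun i : Fin n => θ i)
  simp only [zero_add] at this
  rw [this]
  exact le_of_eq (by ring)

end PredModel

/-! ### Sample quantiles -/

section SampleQuantile

variable {n : ℕ}

/-- The empirical distribution function jumps only at sample points. A finite union of closed rays
is closed, so the infimum defining the quantile is attained. -/
lemma setOf_le_empirical_eq (x : Fin n → ℝ) {p : ℝ} (hp : 0 < p) :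
    {t : ℝ | p ≤ ((Finset.univ.filter fun i => x i ≤ t).card : ℝ) / n}
      = ⋃ i ∈ {i : Fin n | p ≤ ((Finset.univ.filter fun j => x j ≤ x i).card : ℝ) / n},
          Set.Ici (x i) := by
  ext t
  simp only [Set.mem_ofPred_eq, Set.mem_iUnion, Set.mem_Ici, exists_prop]
  constructor
  · intro h
    have hne : (Finset.univ.filter fun i => x i ≤ t).Nonempty := by
      rw [Finset.nonempty_iff_ne_empty]
      intro he
      rw [he] at h
      simp at h
      linarith
    obtain ⟨i, hi, hmax⟩ := Finset.exists_max_image _ x hne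
    refine ⟨i, h.trans ?_, (Finset.mem_filter.1 hi).2⟩
    refine div_le_div_of_nonneg_right (Nat.cast_le.2 (Finset.card_le_card fun j hj => ?_))
      (Nat.cast_nonneg n)
    exact Finset.mem_filter.2 ⟨Finset.mem_univ _, hmax j hj⟩
  · rintro ⟨i, h, hi⟩
    refine h.trans ?_
    gcongr with j hj

lemma sampleQuantile_le_iff (hn : 0 < n) (x : Fin n → ℝ) {p : ℝ} (hp : 0 < p) (hp1 : p ≤ 1)
    (t : ℝ) :
    sampleQuantile x p ≤ t ↔ p ≤ ((Finset.univ.filter fun i => x i ≤ t).card : ℝ) / n := by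
  have : Nonempty (Fin n) := ⟨⟨0, hn⟩⟩
  have hS := setOf_le_empirical_eq x hp
  have hcl : IsClosed {t : ℝ | p ≤ ((Finset.univ.filter fun i => x i ≤ t).card : ℝ) / n} := by
    rw [hS]
    exact Set.Finite.isClosed_biUnion (Set.toFinite _) fun i _ => isClosed_Ici
  have hne : {t : ℝ | p ≤ ((Finset.univ.filter fun i => x i ≤ t).card : ℝ) / n}.Nonempty := by
    obtain ⟨i, hi⟩ := Finite.exists_max x
    refine ⟨x i, ?_⟩
    have : (Finset.univ.filter fun j => x j ≤ x i) = Finset.univ := by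
      simpa [Finset.filter_eq_self] using hi
    rw [Set.mem_ofPred_eq, this, Finset.card_univ, Fintype.card_fin,
      div_self (Nat.cast_pos.2 hn).ne']
    exact hp1
  have hbd : BddBelow {t : ℝ | p ≤ ((Finset.univ.filter fun i => x i ≤ t).card : ℝ) / n} := by
    obtain ⟨i, hi⟩ := Finite.exists_min x
    refine ⟨x i, fun s hs => ?_⟩
    rw [hS] at hs
    simp only [Set.mem_iUnion, Set.mem_Ici] at hs
    obtain ⟨j, -, hj⟩ := hs
    exact (hi j).trans hj
  constructor
  · intro h
    have h1 : p ≤ _ := hcl.csInf_mem hne hbd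
    refine h1.trans ?_
    gcongr with j hj
    exact h
  · intro h
    exact csInf_le hbd h

lemma measurable_sampleQuantile (hn : 0 < n) {p : ℝ} (hp : 0 < p) (hp1 : p ≤ 1) :
    Measurable fun x : Fin n → ℝ => sampleQuantile x p := by
  refine measurable_of_Iic fun t => ?_
  have e : (fun x : Fin n → ℝ => sampleQuantile x p) ⁻¹' Set.Iic t
      = {x | p ≤ (∑ i, if x i ≤ t then (1 : ℝ) else 0) / n} := by
    ext x
    simp [sampleQuantile_le_iff hn x hp hp1]
  rw [e]
  refine measurableSet_le measurable_const (Measurable.div_const ?_ _)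
  refine Finset.measurable_sum _ fun i _ => ?_
  exact Measurable.ite (measurableSet_le (measurable_pi_apply i) measurable_const)
    measurable_const measurable_const

lemma sampleQuantile_mono (hn : 0 < n) (x : Fin n → ℝ) {p p' : ℝ} (hp : 0 < p) (hpp : p ≤ p')
    (hp1 : p' ≤ 1) : sampleQuantile x p ≤ sampleQuantile x p' := by
  rw [sampleQuantile_le_iff hn x hp (hpp.trans hp1)]
  exact hpp.trans ((sampleQuantile_le_iff hn x (hp.trans_le hpp) hp1 _).1 le_rfl)

lemma card_mul_le_mul_avgAbs (hn : 0 < n) (x : Fin n → ℝ) (s : Finset (Fin n)) {a : ℝ}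
    (h : ∀ i ∈ s, a ≤ |x i|) : (s.card : ℝ) * a ≤ n * avgAbs x := by
  have hn0 : (n : ℝ) ≠ 0 := (Nat.cast_pos.2 hn).ne'
  rw [avgAbs, mul_div_cancel₀ _ hn0]
  calc (s.card : ℝ) * a = ∑ i ∈ s, a := by simp
    _ ≤ ∑ i ∈ s, |x i| := Finset.sum_le_sum h
    _ ≤ ∑ i, |x i| :=
      Finset.sum_le_sum_of_subset_of_nonneg (Finset.subset_univ _) fun _ _ _ => abs_nonneg _

/-- Markov's inequality: at least `p n` sample points lie at or below the quantile, and when it is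
negative each has absolute value at least its modulus. -/
lemma mul_neg_sampleQuantile_le (hn : 0 < n) (x : Fin n → ℝ) {p : ℝ} (hp : 0 < p) (hp1 : p ≤ 1) :
    p * -sampleQuantile x p ≤ avgAbs x := by
  have hn0 : (0 : ℝ) < n := Nat.cast_pos.2 hn
  rcases le_or_gt 0 (sampleQuantile x p) with h | h
  · exact (mul_nonpos_of_nonneg_of_nonpos hp.le (by linarith)).trans (avgAbs_nonneg x)
  have h1 := (sampleQuantile_le_iff hn x hp hp1 _).1 le_rfl
  rw [le_div_iff₀ hn0] at h1
  have h2 := card_mul_le_mul_avgAbs hn x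
    (Finset.univ.filter fun i => x i ≤ sampleQuantile x p) (a := -sampleQuantile x p)
    fun i hi => by
      have := (Finset.mem_filter.1 hi).2
      exact (neg_le_neg this).trans (neg_le_abs _)
  have h3 := (mul_le_mul_of_nonneg_right h1 (by linarith : 0 ≤ -sampleQuantile x p)).trans h2
  refine le_of_mul_le_mul_left ?_ hn0
  linarith

/-- For every positive `t` below the quantile more than `(1 - p) n` sample points exceed `t`;
Markov's inequality applies at `t`, which may then approach the quantile. -/
lemma mul_sampleQuantile_le (hn : 0 < n) (x : Fin n → ℝ) {p : ℝ} (hp : 0 < p) (hp1 : p ≤ 1) :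
    (1 - p) * sampleQuantile x p ≤ avgAbs x := by
  have hn0 : (0 : ℝ) < n := Nat.cast_pos.2 hn
  rcases le_or_gt (sampleQuantile x p) 0 with h | h
  · exact (mul_nonpos_of_nonneg_of_nonpos (by linarith) h).trans (avgAbs_nonneg x)
  have key : ∀ t, 0 < t → t < sampleQuantile x p → (1 - p) * t ≤ avgAbs x := by
    intro t ht htq
    have h1 := mt (sampleQuantile_le_iff hn x hp hp1 t).2 (not_le.2 htq)
    rw [not_le, div_lt_iff₀ hn0] at h1
    have h2 := card_mul_le_mul_avgAbs hn x
      (Finset.univ.filter fun i => ¬ x i ≤ t) (a := t)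
      fun i hi => (not_le.1 (Finset.mem_filter.1 hi).2).le.trans (le_abs_self _)
    have h3 := Finset.card_filter_add_card_filter_not (s := (Finset.univ : Finset (Fin n)))
      (fun i => x i ≤ t)
    rw [Finset.card_univ, Fintype.card_fin] at h3
    have h4 : ((Finset.univ.filter fun i => x i ≤ t).card : ℝ)
      + ((Finset.univ.filter fun i => ¬ x i ≤ t).card : ℝ) = n := by exact_mod_cast h3
    refine le_of_mul_le_mul_left ?_ hn0
    refine le_trans ?_ h2
    rw [← mul_assoc]
    exact mul_le_mul_of_nonneg_right (by linarith) ht.le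
  rcases hp1.eq_or_lt with rfl | hp1
  · simpa using avgAbs_nonneg x
  by_contra! hc
  have h0 : 0 < 1 - p := by linarith
  have h5 : avgAbs x / (1 - p) < sampleQuantile x p := by
    rw [div_lt_iff₀ h0]; linarith
  obtain ⟨t, ht1, ht2⟩ := exists_between h5
  have ht0 : 0 < t := (div_nonneg (avgAbs_nonneg x) h0.le).trans_lt ht1
  have := key t ht0 ht2
  rw [div_lt_iff₀ h0] at ht1
  linarith

end SampleQuantile

namespace PredModel

variable (M : PredModel)

/-- The critical ratios lie in `[c, 1 - c]`. -/
structure RatioBound (c : ℝ) : Prop where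
  pos : 0 < c
  le_ratio : ∀ i, c ≤ M.ratio i
  ratio_le : ∀ i, M.ratio i ≤ 1 - c

variable {M} {c : ℝ} {n : ℕ}

lemma RatioBound.iInf_mem (hc : M.RatioBound c) (hn : 0 < n) :
    (⨅ i : Fin n, M.ratio i) ∈ Set.Icc c (1 - c) := by
  have : Nonempty (Fin n) := ⟨⟨0, hn⟩⟩
  exact ⟨le_ciInf fun i => hc.le_ratio i,
    (ciInf_le (Set.finite_range _).bddBelow ⟨0, hn⟩).trans (hc.ratio_le _)⟩

lemma RatioBound.iSup_mem (hc : M.RatioBound c) (hn : 0 < n) :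
    (⨆ i : Fin n, M.ratio i) ∈ Set.Icc c (1 - c) := by
  have : Nonempty (Fin n) := ⟨⟨0, hn⟩⟩
  exact ⟨(hc.le_ratio _).trans
    (le_ciSup (f := fun i : Fin n => M.ratio i) (Set.finite_range _).bddAbove ⟨0, hn⟩),
    ciSup_le fun i => hc.ratio_le i⟩

lemma RatioBound.iInf_le_iSup (hn : 0 < n) :
    (⨅ i : Fin n, M.ratio i) ≤ ⨆ i : Fin n, M.ratio i := by
  have : Nonempty (Fin n) := ⟨⟨0, hn⟩⟩
  exact ciInf_le_ciSup (Set.finite_range _).bddBelow (Set.finite_range _).bddAbove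

lemma RatioBound.mul_abs_sampleQuantile_le (hc : M.RatioBound c) (hn : 0 < n) (x : Fin n → ℝ)
    {p : ℝ} (hp : p ∈ Set.Icc c (1 - c)) : c * |sampleQuantile x p| ≤ avgAbs x := by
  have h0 := hc.pos
  have hp0 : 0 < p := h0.trans_le hp.1
  have hp1 : p ≤ 1 := by linarith [hp.2]
  rcases abs_cases (sampleQuantile x p) with ⟨e, h⟩ | ⟨e, h⟩ <;> rw [e]
  · exact (mul_le_mul_of_nonneg_right (by linarith [hp.2]) h).trans
      (mul_sampleQuantile_le hn x hp0 hp1)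
  · exact (mul_le_mul_of_nonneg_right hp.1 (by linarith)).trans
      (mul_neg_sampleQuantile_le hn x hp0 hp1)

lemma RatioBound.locRange_endpoints (hc : M.RatioBound c) (hn : 0 < n) (x : Fin n → ℝ) :
    sampleQuantile x (⨅ i : Fin n, M.ratio i) ≤ sampleQuantile x (⨆ i : Fin n, M.ratio i) := by
  have h1 := hc.iInf_mem hn
  have h2 := hc.iSup_mem hn
  exact sampleQuantile_mono hn x (hc.pos.trans_le h1.1) (RatioBound.iInf_le_iSup hn)
    (by linarith [h2.2, hc.pos])

lemma RatioBound.mul_abs_le (hc : M.RatioBound c) (hn : 0 < n) {x : Fin n → ℝ} {η : ℝ}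
    (hη : η ∈ M.locRange x) : c * |η| ≤ avgAbs x := by
  have h1 := hc.mul_abs_sampleQuantile_le hn x (hc.iInf_mem hn)
  have h2 := hc.mul_abs_sampleQuantile_le hn x (hc.iSup_mem hn)
  have h3 : |η| ≤ max |sampleQuantile x (⨅ i : Fin n, M.ratio i)|
      |sampleQuantile x (⨆ i : Fin n, M.ratio i)| := abs_le_max_abs_abs hη.1 hη.2
  rcases le_max_iff.1 h3 with h | h
  · exact (mul_le_mul_of_nonneg_left h hc.pos.le).trans h1
  · exact (mul_le_mul_of_nonneg_left h hc.pos.le).trans h2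

end PredModel

/-! ### The grids -/

namespace GridConstants

variable (C : GridConstants) {n : ℕ}

lemma exists_gridLoc_le (hδ : 0 < C.meshLoc n) {η : ℝ} (h1 : -logLog n ≤ η) :
    ∃ k : ℕ, -logLog n + k * C.meshLoc n ≤ η ∧ η < -logLog n + (k + 1) * C.meshLoc n := by
  have h0 : 0 ≤ (η + logLog n) / C.meshLoc n := div_nonneg (by linarith) hδ.le
  refine ⟨⌊(η + logLog n) / C.meshLoc n⌋₊, ?_, ?_⟩
  · have := Nat.floor_le h0
    rw [le_div_iff₀ hδ] at this
    linarith
  · have := Nat.lt_floor_add_one ((η + logLog n) / C.meshLoc n)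
    rw [div_lt_iff₀ hδ] at this
    linarith

lemma abs_le_of_mem_gridLoc (hδ : 0 < C.meshLoc n) {η : ℝ} (h : η ∈ C.gridLoc n) :
    |η| ≤ logLog n := by
  obtain ⟨k, hk, hk2⟩ := h
  refine abs_le.2 ⟨?_, hk2⟩
  rw [hk]
  have : 0 ≤ (k : ℝ) * C.meshLoc n := by positivity
  linarith

/-- Rounding down could give the forbidden index `⌈1/δ⌉` when `t = 1`. Capping at the last index is
harmless, since that grid point is still within `δ` of `1`. -/
lemma exists_gridScale_near (hδ : 0 < C.meshScale n) {t : ℝ} (h0 : 0 ≤ t) (h1 : t ≤ 1) :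
    ∃ τ ∈ C.gridScale n, |scaleCoord τ - t| ≤ C.meshScale n := by
  set δ := C.meshScale n with hδd
  have hJ : 0 < ⌈1 / δ⌉₊ := Nat.ceil_pos.2 (by positivity)
  have hj : min ⌊t / δ⌋₊ (⌈1 / δ⌉₊ - 1) < ⌈1 / δ⌉₊ := by omega
  have hfl := Nat.floor_le (div_nonneg h0 hδ.le)
  have hfl2 := Nat.lt_floor_add_one (t / δ)
  rw [le_div_iff₀ hδ] at hfl
  rw [div_lt_iff₀ hδ] at hfl2
  have hjt : (min ⌊t / δ⌋₊ (⌈1 / δ⌉₊ - 1) : ℕ) * δ ≤ t := by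
    refine le_trans (mul_le_mul_of_nonneg_right ?_ hδ.le) hfl
    exact Nat.cast_le.2 (min_le_left _ _)
  have htj : t ≤ (min ⌊t / δ⌋₊ (⌈1 / δ⌉₊ - 1) : ℕ) * δ + δ := by
    rcases min_choice ⌊t / δ⌋₊ (⌈1 / δ⌉₊ - 1) with e | e <;> rw [e]
    · linarith
    · have := Nat.le_ceil (1 / δ)
      rw [div_le_iff₀ hδ] at this
      rw [Nat.cast_sub hJ, Nat.cast_one]
      linarith
  have hj1 : (min ⌊t / δ⌋₊ (⌈1 / δ⌉₊ - 1) : ℕ) * δ < 1 := by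
    have := Nat.lt_ceil.1 hj
    rwa [lt_div_iff₀ hδ] at this
  refine ⟨_, ⟨_, hj, rfl⟩, ?_⟩
  rw [← hδd, scaleCoord_ofReal (by positivity) hj1, abs_le]
  constructor <;> linarith

/-- All points of the two grids. -/
noncomputable def gridFinset (C : GridConstants) (n : ℕ) : Finset (ℝ × ℝ≥0∞) := by
  classical
  exact (Finset.range (⌊2 * logLog n / C.meshLoc n⌋₊ + 1) ×ˢ Finset.range ⌈1 / C.meshScale n⌉₊).image
    fun p => (-logLog n + p.1 * C.meshLoc n,
      ENNReal.ofReal (p.2 * C.meshScale n / (1 - p.2 * C.meshScale n)))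

lemma mem_gridFinset (hδ : 0 < C.meshLoc n) {p : ℝ × ℝ≥0∞} (h1 : p.1 ∈ C.gridLoc n)
    (h2 : p.2 ∈ C.gridScale n) : p ∈ C.gridFinset n := by
  obtain ⟨k, hk, hk2⟩ := h1
  obtain ⟨j, hj, hj2⟩ := h2
  refine Finset.mem_image.2 ⟨(k, j), Finset.mem_product.2 ⟨Finset.mem_range.2 ?_,
    Finset.mem_range.2 hj⟩, ?_⟩
  · refine Nat.lt_succ_of_le (Nat.le_floor ?_)
    rw [le_div_iff₀ hδ]
    linarith
  · exact Prod.ext hk.symm hj2.symm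

lemma ne_top_of_mem_gridFinset {p : ℝ × ℝ≥0∞} (h : p ∈ C.gridFinset n) : p.2 ≠ ⊤ := by
  obtain ⟨q, -, rfl⟩ := Finset.mem_image.1 h
  exact ENNReal.ofReal_ne_top

lemma card_gridFinset_le (hδ : 0 < C.meshLoc n) (hδ2 : 0 < C.meshScale n) (ha : 0 ≤ logLog n) :
    ((C.gridFinset n).card : ℝ)
      ≤ (2 * logLog n / C.meshLoc n + 1) * (1 / C.meshScale n + 1) := by
  have h1 : (C.gridFinset n).card
      ≤ (⌊2 * logLog n / C.meshLoc n⌋₊ + 1) * ⌈1 / C.meshScale n⌉₊ := by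
    refine Finset.card_image_le.trans (le_of_eq ?_)
    simp
  have h2 : ((C.gridFinset n).card : ℝ)
      ≤ ((⌊2 * logLog n / C.meshLoc n⌋₊ : ℝ) + 1) * ⌈1 / C.meshScale n⌉₊ := by exact_mod_cast h1
  refine h2.trans (mul_le_mul ?_ (Nat.ceil_lt_add_one (by positivity)).le (by positivity)
    (by positivity))
  have := Nat.floor_le (by positivity : 0 ≤ 2 * logLog n / C.meshLoc n)
  linarith

end GridConstants

/-! ### Candidate locations and the data-dependent range -/

namespace PredModel

variable {M : PredModel} {C : GridConstants} {n : ℕ} {x : Fin n → ℝ}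

lemma candidateLoc_subset : M.candidateLoc C x ⊆ C.gridLoc n := by
  intro η h
  unfold candidateLoc at h
  split_ifs at h
  · exact h.1
  · exact h.1

/-- When no grid point lies in the range, every candidate is close to every point of the range. -/
lemma abs_candidateLoc_sub_le (hδ : 0 < C.meshLoc n)
    (hM : M.locRange x ⊆ Set.Icc (-logLog n) (logLog n))
    (he : ¬ (C.gridLoc n ∩ M.locRange x).Nonempty) {η₁ η : ℝ} (h1 : η₁ ∈ M.candidateLoc C x)
    (hη : η ∈ M.locRange x) : |η₁ - η| ≤ 2 * C.meshLoc n := by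
  rw [candidateLoc, if_neg he] at h1
  obtain ⟨k, hk1, hk2⟩ := C.exists_gridLoc_le hδ (hM hη).1
  have hg : -logLog n + k * C.meshLoc n ∈ C.gridLoc n := ⟨k, rfl, hk1.trans (hM hη).2⟩
  -- As no grid point lies in the range, the whole range sits inside the grid cell containing `η`
  -- and is shorter than one mesh.
  have hgM : -logLog n + k * C.meshLoc n
      < sampleQuantile x (⨅ i : Fin n, M.ratio i) := by
    by_contra! hc
    exact he ⟨_, hg, hc, hk1.trans hη.2⟩
  have hgM2 : sampleQuantile x (⨆ i : Fin n, M.ratio i)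
      < -logLog n + (k + 1) * C.meshLoc n := by
    by_contra! hc
    have hm2 : sampleQuantile x (⨆ i : Fin n, M.ratio i) ∈ M.locRange x :=
      ⟨hη.1.trans hη.2, le_rfl⟩
    refine he ⟨-logLog n + (k + 1) * C.meshLoc n, ⟨k + 1, by push_cast; ring,
      hc.trans (hM hm2).2⟩, hη.1.trans hk2.le, hc⟩
  have hcpt : IsCompact (M.locRange x) := isCompact_Icc
  obtain ⟨y, hy, hy2⟩ := hcpt.exists_infDist_eq_dist ⟨η, hη⟩ η₁
  have hd : Metric.infDist η₁ (M.locRange x) ≤ C.meshLoc n := by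
    refine (h1.2 hg).trans ((Metric.infDist_le_dist_of_mem hη).trans ?_)
    rw [Real.dist_eq, abs_le]
    constructor <;> linarith
  rw [hy2, Real.dist_eq, abs_le] at hd
  rw [abs_le]
  obtain ⟨a1, a2⟩ := hη
  obtain ⟨b1, b2⟩ := hy
  constructor <;> linarith [hd.1, hd.2]

lemma exists_candidateLoc_near (hδ : 0 < C.meshLoc n)
    (hM : M.locRange x ⊆ Set.Icc (-logLog n) (logLog n)) (hne : (M.candidateLoc C x).Nonempty)
    {η : ℝ} (hη : η ∈ M.locRange x) : ∃ η₁ ∈ M.candidateLoc C x, |η₁ - η| ≤ 2 * C.meshLoc n := by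
  by_cases he : (C.gridLoc n ∩ M.locRange x).Nonempty
  · rw [candidateLoc, if_pos he]
    obtain ⟨k, hk1, hk2⟩ := C.exists_gridLoc_le hδ (hM hη).1
    by_cases hg : sampleQuantile x (⨅ i : Fin n, M.ratio i) ≤ -logLog n + k * C.meshLoc n
    · refine ⟨_, ⟨⟨k, rfl, hk1.trans (hM hη).2⟩, hg, hk1.trans hη.2⟩, ?_⟩
      rw [abs_le]
      constructor <;> linarith
    · rw [not_le] at hg
      -- The point below `η` has fallen off the left end of the range. Some grid point is in the
      -- range, so its index exceeds `k`, and the next point `k + 1`, lying above `η` but not beyond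
      -- `g`, is in the range too.
      obtain ⟨g, ⟨l, hl, hl2⟩, hgM⟩ := he
      have h1 : (k : ℝ) * C.meshLoc n < l * C.meshLoc n := by
        have := hgM.1
        linarith
      have h2 : k < l := by
        have := lt_of_mul_lt_mul_right h1 hδ.le
        exact_mod_cast this
      have h3 : ((k : ℝ) + 1) * C.meshLoc n ≤ l * C.meshLoc n := by
        gcongr
        exact_mod_cast h2
      refine ⟨-logLog n + (k + 1) * C.meshLoc n, ⟨⟨k + 1, by push_cast; ring, by linarith⟩,
        hη.1.trans hk2.le, ?_⟩, ?_⟩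
      · have := hgM.2
        linarith
      · rw [abs_le]
        constructor <;> linarith
  · obtain ⟨η₁, h1⟩ := hne
    exact ⟨η₁, h1, abs_candidateLoc_sub_le hδ hM he h1 hη⟩

lemma exists_locRange_near (hδ : 0 < C.meshLoc n)
    (hM : M.locRange x ⊆ Set.Icc (-logLog n) (logLog n)) (hne : (M.locRange x).Nonempty)
    {η₁ : ℝ} (h1 : η₁ ∈ M.candidateLoc C x) :
    ∃ η ∈ M.locRange x, |η₁ - η| ≤ 2 * C.meshLoc n := by
  by_cases he : (C.gridLoc n ∩ M.locRange x).Nonempty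
  · rw [candidateLoc, if_pos he] at h1
    refine ⟨η₁, h1.2, ?_⟩
    rw [sub_self, abs_zero]
    positivity
  · obtain ⟨η, hη⟩ := hne
    exact ⟨η, hη, abs_candidateLoc_sub_le hδ hM he h1 hη⟩

end PredModel

/-! ### Measurability and integrability of the losses -/

lemma exists_rat_unitInterval_near {t ε : ℝ} (h0 : 0 ≤ t) (h1 : t ≤ 1) (hε : 0 < ε) :
    ∃ q : ℚ, ((q : ℝ) ∈ Set.Icc (0 : ℝ) 1) ∧ |(q : ℝ) - t| < ε := by
  have h : max 0 (t - ε) < min 1 (t + ε) := by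
    rw [max_lt_iff, lt_min_iff, lt_min_iff]
    refine ⟨⟨one_pos, ?_⟩, ?_, ?_⟩ <;> linarith
  obtain ⟨q, hq1, hq2⟩ := exists_rat_btwn h
  rw [max_lt_iff] at hq1
  rw [lt_min_iff] at hq2
  refine ⟨q, ⟨hq1.1.le, hq2.1.le⟩, abs_lt.2 ⟨?_, ?_⟩⟩ <;> linarith

namespace PredModel

variable (M : PredModel) (θ : ℕ → ℝ) {n : ℕ}

lemma measurable_shrink (i : ℕ) : Measurable (M.shrink i) := by
  unfold shrink
  refine Measurable.ite (measurableSet_singleton _) measurable_const ?_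
  exact ENNReal.measurable_toReal.div (ENNReal.measurable_toReal.add_const _)

lemma measurable_loss_predictor {p : (Fin n → ℝ) → ℝ × ℝ≥0∞} (hp : Measurable p) :
    Measurable fun x => M.loss θ (M.predictor (p x) x) := by
  unfold loss
  refine Measurable.const_mul (Finset.measurable_sum _ fun i _ => ?_) _
  refine (M.continuous_coordLoss i (θ i)).measurable.comp ?_
  have h1 : Measurable fun x => M.shrink i (p x).2 := (M.measurable_shrink i).comp hp.snd
  have h2 : Measurable fun x => (p x).1 := hp.fst
  unfold predictor
  fun_prop

lemma integrable_avgAbs : Integrable (fun x : Fin n → ℝ => avgAbs x) (M.pastLaw θ n) := by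
  unfold avgAbs
  refine (integrable_finsetSum _ fun i _ => ?_).div_const _
  exact ((measurePreserving_eval (fun i : Fin n => gaussianReal (θ i) (M.σp i).toNNReal)
    i).integrable_comp_of_integrable (integrable_id_gaussianReal _ _)).abs

lemma integrable_loss_predictor {K : ℝ} (hK : M.BoundedBy K) (hn : 0 < n)
    {p : (Fin n → ℝ) → ℝ × ℝ≥0∞}
    (hm : Measurable fun x => M.loss θ (M.predictor (p x) x)) {D E : ℝ}
    (hp : ∀ x, |(p x).1| ≤ D + E * avgAbs x) :
    Integrable (fun x => M.loss θ (M.predictor (p x) x)) (M.pastLaw θ n) := by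
  have hA := M.integrable_avgAbs θ (n := n)
  have hint : Integrable (fun x : Fin n → ℝ => 2 * K * (avgAbs x + (D + E * avgAbs x)
      + avgAbs (fun i : Fin n => θ i) + 3 * K ^ 2)) (M.pastLaw θ n) :=
    (((hA.add ((integrable_const D).add (hA.const_mul E))).add (integrable_const _)).add
      (integrable_const _)).const_mul _
  refine hint.mono' hm.aestronglyMeasurable (Eventually.of_forall fun x => ?_)
  rw [Real.norm_of_nonneg (M.loss_nonneg θ _)]
  have hK0 := hK.one_le
  refine (M.loss_le θ hK hn (p x) x).trans ?_
  gcongr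
  exact hp x

/-- The minimal loss over the range is measurable, whatever the choice of the minimizers. -/
lemma measurable_loss_oracle {K c : ℝ} (hK : M.BoundedBy K) (hc : M.RatioBound c) (hn : 0 < n)
    {p : (Fin n → ℝ) → ℝ × ℝ≥0∞} (hp : ∀ x, M.IsOracleChoice θ x (p x)) :
    Measurable fun x => M.loss θ (M.predictor (p x) x) := by
  have hK0 := hK.one_le
  set q₁ : (Fin n → ℝ) → ℝ := fun x => sampleQuantile x (⨅ i : Fin n, M.ratio i) with hq₁
  set q₂ : (Fin n → ℝ) → ℝ := fun x => sampleQuantile x (⨆ i : Fin n, M.ratio i) with hq₂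
  have h1 := hc.iInf_mem hn
  have h2 := hc.iSup_mem hn
  have hc0 := hc.pos
  have m₁ : Measurable q₁ :=
    measurable_sampleQuantile hn (by linarith [h1.1]) (by linarith [h1.2])
  have m₂ : Measurable q₂ :=
    measurable_sampleQuantile hn (by linarith [h2.1]) (by linarith [h2.2])
  -- A countable dense family: rational convex combinations of the two measurable end points of the
  -- range, with rational scale coordinates. By continuity the minimal loss is the infimum over this
  -- family.
  let ι := {r : ℚ × ℚ // (r.1 : ℝ) ∈ Set.Icc (0 : ℝ) 1 ∧ (r.2 : ℝ) ∈ Set.Icc (0 : ℝ) 1}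
  let g : ι → (Fin n → ℝ) → ℝ × ℝ≥0∞ := fun r x =>
    ((1 - (r.1.1 : ℝ)) * q₁ x + (r.1.1 : ℝ) * q₂ x, scaleOf r.1.2)
  have hg : ∀ r, Measurable fun x => M.loss θ (M.predictor (g r x) x) := fun r =>
    M.measurable_loss_predictor θ (((m₁.const_mul _).add (m₂.const_mul _)).prodMk measurable_const)
  refine Measurable.isGLB hg fun x => ?_
  have hq : q₁ x ≤ q₂ x := hc.locRange_endpoints hn x
  obtain ⟨⟨hmem, -⟩, hmin⟩ := hp x
  constructor
  · rintro _ ⟨⟨r, ⟨s0, s1⟩, -⟩, rfl⟩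
    refine hmin ⟨⟨?_, ?_⟩, Set.mem_univ _⟩
    · change q₁ x ≤ (1 - (r.1 : ℝ)) * q₁ x + (r.1 : ℝ) * q₂ x
      nlinarith
    · change (1 - (r.1 : ℝ)) * q₁ x + (r.1 : ℝ) * q₂ x ≤ q₂ x
      nlinarith
  · intro b hb
    obtain ⟨t, ⟨t0, t1⟩, ht⟩ : ∃ t ∈ Set.Icc (0 : ℝ) 1,
        (p x).1 = (1 - t) * q₁ x + t * q₂ x := by
      have : (p x).1 ∈ segment ℝ (q₁ x) (q₂ x) := by rw [segment_eq_Icc hq]; exact hmem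
      obtain ⟨a, t, ha, ht, hat, e⟩ := this
      refine ⟨t, ⟨ht, by linarith⟩, ?_⟩
      rw [← e, ← hat]
      simp
    obtain ⟨u0, u1⟩ := scaleCoord_mem (p x).2
    refine le_of_forall_pos_le_add fun ε hε => ?_
    have hA := avgAbs_nonneg x
    set D := 2 * K * (q₂ x - q₁ x) + 2 * K ^ 2 * (avgAbs x + |(p x).1| + K ^ 2) + 1 with hD
    have hqq : 0 ≤ q₂ x - q₁ x := by linarith
    have hD1 : 2 * K * (q₂ x - q₁ x) + 2 * K ^ 2 * (avgAbs x + |(p x).1| + K ^ 2) ≤ D := by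
      linarith
    have hD0 : 0 < D := by positivity
    obtain ⟨s, hs, hst⟩ := exists_rat_unitInterval_near t0 t1 (div_pos hε hD0)
    obtain ⟨u, hu, hut⟩ := exists_rat_unitInterval_near u0 u1 (div_pos hε hD0)
    have hb1 := hb ⟨⟨(s, u), hs, hu⟩, rfl⟩
    have h3 := M.abs_loss_sub_le θ hK hn (p x) (g ⟨(s, u), hs, hu⟩ x) x
    have e1 : |(p x).1 - (g ⟨(s, u), hs, hu⟩ x).1| ≤ ε / D * (q₂ x - q₁ x) := by
      have : (p x).1 - (g ⟨(s, u), hs, hu⟩ x).1 = -(((s : ℝ) - t) * (q₂ x - q₁ x)) := by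
        rw [ht]
        simp only [g]
        ring
      rw [this, abs_neg, abs_mul, abs_of_nonneg hqq]
      exact mul_le_mul_of_nonneg_right hst.le hqq
    have e2 : |scaleCoord (p x).2 - scaleCoord (g ⟨(s, u), hs, hu⟩ x).2| ≤ ε / D := by
      simp only [g]
      rw [scaleCoord_scaleOf hu.1 hu.2, abs_sub_comm]
      exact hut.le
    have h4 : 2 * K * |(p x).1 - (g ⟨(s, u), hs, hu⟩ x).1|
        + 2 * K ^ 2 * |scaleCoord (p x).2 - scaleCoord (g ⟨(s, u), hs, hu⟩ x).2|
          * (avgAbs x + |(p x).1| + K ^ 2) ≤ ε := by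
      calc _ ≤ 2 * K * (ε / D * (q₂ x - q₁ x))
            + 2 * K ^ 2 * (ε / D) * (avgAbs x + |(p x).1| + K ^ 2) := by gcongr
        _ = ε / D * (2 * K * (q₂ x - q₁ x)
            + 2 * K ^ 2 * (avgAbs x + |(p x).1| + K ^ 2)) := by ring
        _ ≤ ε / D * D := by gcongr
        _ = ε := div_mul_cancel₀ _ hD0.ne'
    have h5 := (abs_le.1 (h3.trans h4)).1
    linarith

end PredModel

/-! ### Tuned loss against oracle loss at fixed data -/

namespace PredModel

variable (M : PredModel) (θ γ : ℕ → ℝ) {C : GridConstants} {n : ℕ}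

lemma exists_boundedBy (hA3 : M.SufficientHistory) (hC : M.AdmissibleGridConstants θ C) :
    ∃ K, M.BoundedBy K := by
  obtain ⟨⟨r, hr, hr2⟩, ⟨B, hB⟩, -⟩ := hA3
  obtain ⟨c1, c2, c3, -⟩ := hC
  have hp := M.σp_pos 0
  have hf := M.σf_pos 0
  refine ⟨max 1 (max C.C₁ (max C.C₂ (max B (C.C₃ * (M.σf 0 / M.σp 0))))), ?_⟩
  constructor
  · exact le_max_left _ _
  · exact fun i => le_max_of_le_right (le_max_of_le_left (c1 i))
  · exact fun i => le_max_of_le_right (le_max_of_le_right (le_max_of_le_left (c2 i).1))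
  · exact fun i => le_max_of_le_right (le_max_of_le_right (le_max_of_le_right
      (le_max_of_le_left (hB i))))
  · exact fun i => le_max_of_le_right (le_max_of_le_right (le_max_of_le_left (c2 i).2))
  · intro i
    have he : 1 / (4 * Real.exp 1) ≤ 1 := by
      rw [div_le_one (by positivity)]
      linarith [Real.add_one_le_exp 1]
    have h := (hr2 i).trans (hr.le.trans he)
    rwa [div_le_one (M.σf_pos i)] at h
  · intro i
    -- The bound on the normal quantiles comes from the product bound `C₃`, divided by the positive
    -- ratio `σp / σf` of coordinate `0`.
    refine le_max_of_le_right (le_max_of_le_right (le_max_of_le_right (le_max_of_le_right ?_)))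
    have h := mul_le_mul_of_nonneg_right (c3 0 i) (by positivity : 0 ≤ M.σf 0 / M.σp 0)
    refine le_trans (le_of_eq ?_) h
    field_simp

lemma exists_ratioBound (hA1 : M.BoundedWeights) : ∃ c, M.RatioBound c := by
  obtain ⟨⟨lo, h0, hlo⟩, ⟨hi, h1, hhi⟩, -⟩ := hA1
  refine ⟨min lo (1 - hi), lt_min h0 (by linarith), fun i => (min_le_left _ _).trans (hlo i),
    fun i => (hhi i).trans ?_⟩
  linarith [min_le_right lo (1 - hi)]

/-- Mean squared deviation of the sample from its means. -/
noncomputable def meanSqDev (θ : ℕ → ℝ) {n : ℕ} (x : Fin n → ℝ) : ℝ :=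
  (∑ i : Fin n, (x i - θ i) ^ 2) / n

lemma meanSqDev_nonneg (x : Fin n → ℝ) : 0 ≤ meanSqDev θ x := by
  unfold meanSqDev
  positivity

lemma avgAbs_sub_sq_le (hn : 0 < n) (x : Fin n → ℝ) :
    avgAbs (fun i => x i - θ i) ^ 2 ≤ meanSqDev θ x := by
  have hn0 : (0 : ℝ) < n := Nat.cast_pos.2 hn
  have h := sq_sum_le_card_mul_sum_sq (s := (Finset.univ : Finset (Fin n)))
    (f := fun i => |x i - θ i|)
  simp only [sq_abs, Finset.card_univ, Fintype.card_fin] at h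
  rw [avgAbs, meanSqDev, div_pow, div_le_div_iff₀ (by positivity) hn0]
  nlinarith

lemma avgAbs_le_add (x : Fin n → ℝ) :
    avgAbs x ≤ avgAbs (fun i => x i - θ i) + avgAbs (fun i : Fin n => θ i) := by
  unfold avgAbs
  rw [← add_div, ← Finset.sum_add_distrib]
  gcongr with i
  simpa using abs_add_le (x i - θ i) (θ i)

lemma integrable_meanSqDev : Integrable (fun x : Fin n → ℝ => meanSqDev θ x) (M.pastLaw θ n) := by
  unfold meanSqDev
  refine (integrable_finsetSum _ fun i _ => ?_).div_const _
  exact (measurePreserving_eval (fun i : Fin n => gaussianReal (θ i) (M.σp i).toNNReal)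
    i).integrable_comp_of_integrable (integrable_sub_sq_gaussianReal _ _ (θ i))

lemma integral_meanSqDev_le {K : ℝ} (hK : M.BoundedBy K) (hn : 0 < n) :
    ∫ x : Fin n → ℝ, meanSqDev θ x ∂(M.pastLaw θ n) ≤ K := by
  have hn0 : (0 : ℝ) < n := Nat.cast_pos.2 hn
  unfold meanSqDev
  have hmp := fun i : Fin n =>
    measurePreserving_eval (fun i : Fin n => gaussianReal (θ i) (M.σp i).toNNReal) i
  have hint : ∀ i ∈ (Finset.univ : Finset (Fin n)),
      Integrable (fun x : Fin n → ℝ => (x i - θ i) ^ 2) (M.pastLaw θ n) := fun i _ =>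
    (hmp i).integrable_comp_of_integrable (integrable_sub_sq_gaussianReal _ _ (θ i))
  rw [integral_div, integral_finsetSum _ hint, div_le_iff₀ hn0]
  have e : ∀ i : Fin n, ∫ x : Fin n → ℝ, (x i - θ i) ^ 2 ∂(M.pastLaw θ n) = M.σp i := by
    intro i
    have h := integral_sub_sq_gaussianReal (θ i) (M.σp i).toNNReal
    rw [← (hmp i).map_eq, integral_map (measurable_pi_apply i).aemeasurable
      (by fun_prop), Real.coe_toNNReal _ (M.σp_pos i).le] at h
    exact h
  simp_rw [e]
  refine (Finset.sum_le_sum fun (i : Fin n) _ => hK.σp_le i).trans ?_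
  simp [mul_comm]

/-- Total absolute error of the risk estimate over the grid. -/
noncomputable def gridError (C : GridConstants) (x : Fin n → ℝ) : ℝ :=
  ∑ p ∈ C.gridFinset n, |M.areD γ x p - M.loss θ (M.predictor p x)|

lemma gridError_nonneg (x : Fin n → ℝ) : 0 ≤ M.gridError θ γ C x :=
  Finset.sum_nonneg fun _ _ => abs_nonneg _

/-- Estimate and loss are exchanged once at `p` and once at `p'`. The candidate set is random, so
the error is summed over a fixed finite set containing every possible candidate. -/
lemma loss_choice_le (hδ : 0 < C.meshLoc n) {x : Fin n → ℝ} {p p' : ℝ × ℝ≥0∞}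
    (hp : M.IsAREChoice γ C x p) (h1 : p'.1 ∈ M.candidateLoc C x) (h2 : p'.2 ∈ C.gridScale n) :
    M.loss θ (M.predictor p x) ≤ M.loss θ (M.predictor p' x) + 2 * M.gridError θ γ C x := by
  have key : ∀ q : ℝ × ℝ≥0∞, q.1 ∈ M.candidateLoc C x → q.2 ∈ C.gridScale n →
      |M.areD γ x q - M.loss θ (M.predictor q x)| ≤ M.gridError θ γ C x := fun q g1 g2 =>
    Finset.single_le_sum
      (f := fun q : ℝ × ℝ≥0∞ => |M.areD γ x q - M.loss θ (M.predictor q x)|)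
      (fun _ _ => abs_nonneg _) (C.mem_gridFinset hδ (candidateLoc_subset g1) g2)
  obtain ⟨⟨g1, g2⟩, hmin⟩ := hp
  have a1 := (abs_le.1 (key p g1 g2)).1
  have a2 := (abs_le.1 (key p' h1 h2)).2
  have a3 : M.areD γ x p ≤ M.areD γ x p' := hmin ⟨h1, h2⟩
  linarith

/-- From above, the oracle is rounded to a candidate `(η₁, τ₁)`. From below, the tuned location is
moved to a point `η₂` of the range with its scale kept, and optimality of the oracle applies. -/
lemma abs_loss_choice_sub_oracle_le {K c : ℝ} (hK : M.BoundedBy K) (hc : M.RatioBound c)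
    (hn : 0 < n) (hδ : 0 < C.meshLoc n) (hδ' : 0 < C.meshScale n) {x : Fin n → ℝ}
    {p p' : ℝ × ℝ≥0∞} (hp : M.IsAREChoice γ C x p) (hp' : M.IsOracleChoice θ x p')
    (hx : avgAbs x ≤ c * logLog n) :
    |M.loss θ (M.predictor p x) - M.loss θ (M.predictor p' x)|
      ≤ 2 * M.gridError θ γ C x + (4 * K * C.meshLoc n
        + 2 * K ^ 2 * C.meshScale n * (c * logLog n + logLog n + K ^ 2)) := by
  have hK0 := hK.one_le
  have hA := avgAbs_nonneg x
  have hW := M.gridError_nonneg θ γ (C := C) x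
  have hM : M.locRange x ⊆ Set.Icc (-logLog n) (logLog n) := fun η hη =>
    abs_le.1 (le_of_mul_le_mul_left ((hc.mul_abs_le hn hη).trans hx) hc.pos)
  obtain ⟨⟨g1, -⟩, hmin⟩ := hp'
  have f1 : p.1 ∈ M.candidateLoc C x := hp.1.1
  obtain ⟨η₁, e1, e2⟩ := exists_candidateLoc_near hδ hM ⟨_, f1⟩ g1
  obtain ⟨u0, u1⟩ := scaleCoord_mem p'.2
  obtain ⟨τ₁, e3, e4⟩ := C.exists_gridScale_near hδ' u0 u1
  obtain ⟨η₂, e5, e6⟩ := exists_locRange_near hδ hM ⟨_, g1⟩ f1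
  have b1 := M.loss_choice_le θ γ hδ hp (p' := (η₁, τ₁)) e1 e3
  have b2 := (abs_le.1 (M.abs_loss_sub_le θ hK hn (η₁, τ₁) p' x)).2
  have b3 := (abs_le.1 (M.abs_loss_sub_le θ hK hn p (η₂, p.2) x)).1
  have b4 : M.loss θ (M.predictor p' x) ≤ M.loss θ (M.predictor (η₂, p.2) x) :=
    hmin (show (η₂, p.2) ∈ M.locRange x ×ˢ Set.univ from ⟨e5, Set.mem_univ _⟩)
  have b5 := C.abs_le_of_mem_gridLoc hδ (candidateLoc_subset e1)
  simp only [sub_self, abs_zero, mul_zero, zero_mul, add_zero] at b3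
  have b6 : 2 * K * |p.1 - η₂| ≤ 4 * K * C.meshLoc n := by nlinarith
  have ha : 0 ≤ logLog n := (abs_nonneg _).trans b5
  have b7 : 2 * K * |η₁ - p'.1|
        + 2 * K ^ 2 * |scaleCoord τ₁ - scaleCoord p'.2| * (avgAbs x + |η₁| + K ^ 2)
      ≤ 4 * K * C.meshLoc n
        + 2 * K ^ 2 * C.meshScale n * (c * logLog n + logLog n + K ^ 2) := by
    refine add_le_add (by nlinarith) ?_
    gcongr
  have b8 : 0 ≤ 2 * K ^ 2 * C.meshScale n * (c * logLog n + logLog n + K ^ 2) := by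
    have := hc.pos
    positivity
  rw [abs_le]
  constructor <;> linarith

/-- With `A` the average of `|x_i|`, both losses are at most a multiple of `A`, since `A ≥ c a_n`
dominates locations, means and constants. The means account for at most half of `A`, so `A²` is at
most four times the mean squared deviation; dividing by `A ≥ c a_n` gains the factor `1 / a_n`. -/
lemma abs_loss_choice_sub_oracle_le_of_lt {K c B : ℝ} (hK : M.BoundedBy K) (hc : M.RatioBound c)
    (hn : 0 < n) (hδ : 0 < C.meshLoc n) (ha : 1 ≤ logLog n) {x : Fin n → ℝ}
    {p p' : ℝ × ℝ≥0∞} (hp : M.IsAREChoice γ C x p) (hp' : M.IsOracleChoice θ x p')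
    (hB : avgAbs (fun i : Fin n => θ i) ≤ B) (hB2 : 2 * B ≤ c * logLog n)
    (hx : c * logLog n < avgAbs x) :
    |M.loss θ (M.predictor p x) - M.loss θ (M.predictor p' x)|
      ≤ 8 * K * (2 + (2 + 3 * K ^ 2) / c) / c / logLog n * meanSqDev θ x := by
  have hK0 := hK.one_le
  have hc0 := hc.pos
  have hA := avgAbs_nonneg x
  have ha0 : 0 < logLog n := by linarith
  set A := avgAbs x with hAd
  have h1 : |p.1| ≤ logLog n := C.abs_le_of_mem_gridLoc hδ (candidateLoc_subset hp.1.1)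
  have h2 : c * |p'.1| ≤ A := hc.mul_abs_le hn hp'.1.1
  have h2' : |p'.1| ≤ A / c := by rw [le_div_iff₀ hc0]; linarith
  have h3 : logLog n ≤ A / c := by rw [le_div_iff₀ hc0]; linarith
  have l1 := M.loss_le θ hK hn p x
  have l2 := M.loss_le θ hK hn p' x
  have n1 := M.loss_nonneg θ (M.predictor p x)
  have n2 := M.loss_nonneg θ (M.predictor p' x)
  rw [← hAd] at l1 l2
  have hθ0 := avgAbs_nonneg (fun i : Fin n => θ i)
  have h4 : |M.loss θ (M.predictor p x) - M.loss θ (M.predictor p' x)|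
      ≤ 2 * K * (2 + (2 + 3 * K ^ 2) / c) * A := by
    have h5 : 2 * K * (A + A / c + A + 3 * K ^ 2 * (A / c))
        ≤ 2 * K * (2 + (2 + 3 * K ^ 2) / c) * A := by
      have : 2 * K * (2 + (2 + 3 * K ^ 2) / c) * A
          = 2 * K * (A + A / c + A + 3 * K ^ 2 * (A / c)) + 2 * K * (A / c) := by ring
      rw [this]
      have : 0 ≤ 2 * K * (A / c) := by positivity
      linarith
    have h6 : 3 * K ^ 2 ≤ 3 * K ^ 2 * (A / c) :=
      le_mul_of_one_le_right (by positivity) (ha.trans h3)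
    have h7 : ∀ η : ℝ, |η| ≤ A / c → 2 * K * (A + |η| + avgAbs (fun i : Fin n => θ i) + 3 * K ^ 2)
        ≤ 2 * K * (A + A / c + A + 3 * K ^ 2 * (A / c)) := fun η hη => by
      gcongr
      linarith
    have h8 := h7 p.1 (h1.trans h3)
    have h9 := h7 p'.1 h2'
    rw [abs_le]
    constructor <;> linarith
  have h10 := avgAbs_le_add θ x
  have h11 : A ≤ 2 * avgAbs (fun i : Fin n => x i - θ i) := by linarith
  have h12 : A ^ 2 ≤ 4 * meanSqDev θ x := by
    have := avgAbs_sub_sq_le θ hn x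
    nlinarith
  have h13 : A ≤ 4 * meanSqDev θ x / (c * logLog n) := by
    rw [le_div_iff₀ (by positivity)]
    nlinarith
  refine h4.trans ((mul_le_mul_of_nonneg_left h13 (by positivity)).trans (le_of_eq ?_))
  field_simp
  ring

end PredModel

/-! ### Rates, meshes and the size of the grid -/

lemma tendsto_logLog : Tendsto logLog atTop atTop :=
  Real.tendsto_log_atTop.comp tendsto_log_natCast_atTop

/-- With `y = (log n)^(1/4)` one has `log log n = 4 log y`, and powers of `log y` are negligible
against `y`. -/
lemma tendsto_logLog_pow_div :
    Tendsto (fun n : ℕ => logLog n ^ 4 / √√(Real.log n)) atTop (𝓝 0) := by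
  have h : Tendsto (fun y : ℝ => Real.log y ^ 4 / y) atTop (𝓝 0) := by
    have := (Real.isLittleO_pow_log_id_atTop (n := 4)).tendsto_div_nhds_zero
    simpa using this
  have h2 : Tendsto (fun n : ℕ => √√(Real.log n)) atTop atTop :=
    Real.tendsto_sqrt_atTop.comp (Real.tendsto_sqrt_atTop.comp tendsto_log_natCast_atTop)
  have h3 := (h.comp h2).const_mul (4 ^ 4)
  rw [mul_zero] at h3
  refine h3.congr' ?_
  filter_upwards [tendsto_log_natCast_atTop.eventually_ge_atTop 0] with n hn
  simp only [Function.comp_apply]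
  rw [Real.log_sqrt (Real.sqrt_nonneg _), Real.log_sqrt hn, logLog]
  ring

namespace PredModel

variable {M : PredModel} {θ γ : ℕ → ℝ} {C : GridConstants}

lemma AdmissibleGridConstants.C₁_pos (hC : M.AdmissibleGridConstants θ C) : 0 < C.C₁ :=
  (add_pos (M.b_pos 0) (M.h_pos 0)).trans_le (hC.1 0)

lemma AdmissibleGridConstants.C₂_pos (hC : M.AdmissibleGridConstants θ C) : 0 < C.C₂ :=
  (M.σp_pos 0).trans_le (hC.2.1 0).1

lemma AdmissibleGridConstants.C₃_nonneg (hC : M.AdmissibleGridConstants θ C) : 0 ≤ C.C₃ :=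
  (mul_nonneg (div_pos (M.σp_pos 0) (M.σf_pos 0)).le (abs_nonneg _)).trans (hC.2.2.1 0 0)

/-- Orders of magnitude of the meshes and of the number of grid points. -/
lemma AdmissibleGridConstants.exists_mesh_bounds (hC : M.AdmissibleGridConstants θ C) :
    ∃ D : ℝ, 0 ≤ D ∧ ∀ᶠ n : ℕ in atTop, 1 ≤ logLog n ∧ 0 < C.meshLoc n ∧ 0 < C.meshScale n ∧
      C.meshLoc n ≤ D / logLog n ∧ C.meshScale n ≤ D / logLog n ^ 2 ∧
      ((C.gridFinset n).card : ℝ) ≤ D * logLog n ^ 4 := by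
  have h1 := hC.C₁_pos
  have h2 := hC.C₂_pos
  have h3 := hC.C₃_nonneg
  have hφ : 0 ≤ stdNormalPDF 0 := gaussianPDFReal_nonneg _ _ _
  set E := 2 * C.C₁ * C.C₂ * (2 * stdNormalPDF 0 + C.C₃ + |C.C₄| + 2) with hE
  refine ⟨max (1 / (2 * C.C₁)) (max (1 / (2 * C.C₁ * C.C₂)) ((4 * C.C₁ + 1) * (E + 1))),
    le_max_of_le_left (by positivity), ?_⟩
  filter_upwards [hC.2.2.2, tendsto_logLog.eventually_ge_atTop 1] with n h4 ha
  -- The sign of `C₄` is not prescribed, but this product dominates an average of absolute values.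
  have h4' : 0 ≤ √(logLog n) * C.C₄ := by
    rw [mul_comm]
    exact (avgAbs_nonneg fun i : Fin n => θ i).trans h4
  have hloc : C.meshLoc n = (2 * C.C₁ * logLog n)⁻¹ := rfl
  have hsc : C.meshScale n = (2 * C.C₁ * C.C₂ * (2 * stdNormalPDF 0 + C.C₃
      + √(logLog n) * C.C₄ + logLog n + logLog n ^ 2))⁻¹ := rfl
  have hs : √(logLog n) ≤ logLog n ^ 2 :=
    Real.sqrt_le_iff.2 ⟨by positivity, by
      rw [← pow_mul]
      exact le_self_pow₀ ha (by norm_num)⟩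
  set a := logLog n
  have ha0 : 0 < a := by linarith
  have ha2 : 1 ≤ a ^ 2 := one_le_pow₀ ha
  have haa : a ≤ a ^ 2 := le_self_pow₀ ha two_ne_zero
  have hsum0 : 0 ≤ 2 * stdNormalPDF 0 + C.C₃ + √a * C.C₄ + a := by positivity
  have hsum : 0 < 2 * stdNormalPDF 0 + C.C₃ + √a * C.C₄ + a + a ^ 2 := by positivity
  have hl : 0 < C.meshLoc n := by rw [hloc]; positivity
  have hl2 : 0 < C.meshScale n := by rw [hsc]; positivity
  have hE0 : 0 ≤ E := by positivity
  refine ⟨ha, hl, hl2, ?_, ?_, ?_⟩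
  · refine le_trans (le_of_eq ?_) (div_le_div_of_nonneg_right (le_max_left _ _) ha0.le)
    rw [hloc]
    field_simp
  · refine le_trans ?_ (div_le_div_of_nonneg_right
      (le_max_of_le_right (le_max_left _ _)) (by positivity))
    rw [hsc, div_div, inv_eq_one_div]
    exact one_div_le_one_div_of_le (by positivity)
      (mul_le_mul_of_nonneg_left (by linarith) (by positivity))
  · refine (C.card_gridFinset_le hl hl2 ha0.le).trans ?_
    have t1 : 2 * a / C.meshLoc n + 1 ≤ (4 * C.C₁ + 1) * a ^ 2 := by
      rw [hloc, div_inv_eq_mul]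
      nlinarith
    have t2 : 1 / C.meshScale n + 1 ≤ (E + 1) * a ^ 2 := by
      rw [hsc, one_div, inv_inv]
      have q : √a * C.C₄ ≤ |C.C₄| * a ^ 2 := by
        rw [mul_comm]
        exact mul_le_mul (le_abs_self _) hs (Real.sqrt_nonneg _) (abs_nonneg _)
      have q2 : 2 * stdNormalPDF 0 + C.C₃ + √a * C.C₄ + a + a ^ 2
          ≤ (2 * stdNormalPDF 0 + C.C₃ + |C.C₄| + 2) * a ^ 2 := by nlinarith
      have q3 := mul_le_mul_of_nonneg_left q2 (by positivity : 0 ≤ 2 * C.C₁ * C.C₂)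
      have e : 2 * C.C₁ * C.C₂ * ((2 * stdNormalPDF 0 + C.C₃ + |C.C₄| + 2) * a ^ 2)
          = E * a ^ 2 := by rw [hE]; ring
      rw [e] at q3
      linarith
    calc _ ≤ (4 * C.C₁ + 1) * a ^ 2 * ((E + 1) * a ^ 2) := by gcongr
      _ = (4 * C.C₁ + 1) * (E + 1) * a ^ 4 := by ring
      _ ≤ _ := mul_le_mul_of_nonneg_right
        (le_max_of_le_right (le_max_right _ _)) (by positivity)

end PredModel

/-! ### Convergence of the risk difference -/

theorem mainTheorem9 (M : PredModel) (θ γ : ℕ → ℝ) (C : GridConstants)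
    (hA1 : M.BoundedWeights) (hA2 : BoundedMeans θ) (hA3 : M.SufficientHistory)
    (hγ : M.ThresholdConstants γ) (hC : M.AdmissibleGridConstants θ C)
    (are oracle : ∀ n : ℕ, (Fin n → ℝ) → ℝ × ℝ≥0∞)
    (hare_meas : ∀ n, Measurable (are n))
    (hare : ∀ᶠ n in atTop, ∀ x : Fin n → ℝ, M.IsAREChoice γ C x (are n x))
    (horacle : ∀ᶠ n in atTop, ∀ x : Fin n → ℝ, M.IsOracleChoice θ x (oracle n x)) :
    (∀ᶠ n in atTop,
      Integrable (fun x : Fin n → ℝ => M.loss θ (M.predictor (are n x) x)) (M.pastLaw θ n) ∧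
      Integrable (fun x : Fin n → ℝ => M.loss θ (M.predictor (oracle n x) x)) (M.pastLaw θ n)) ∧
    Tendsto
      (fun n : ℕ => M.risk θ (fun x : Fin n → ℝ => M.predictor (are n x) x)
        - ∫ x, M.loss θ (M.predictor (oracle n x) x) ∂(M.pastLaw θ n))
      atTop (𝓝 0) := by
  obtain ⟨K, hK⟩ := M.exists_boundedBy θ hA3 hC
  obtain ⟨c, hc⟩ := M.exists_ratioBound hA1
  obtain ⟨B, hB⟩ := hA2
  obtain ⟨D, hD0, hD⟩ := hC.exists_mesh_bounds
  obtain ⟨E, hE0, hE⟩ := M.exists_integral_abs_areD_sub_loss_le γ θ hK hA3 hγ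
  have hK0 := hK.one_le
  have hc0 := hc.pos
  have hint : ∀ᶠ n in atTop,
      Integrable (fun x : Fin n → ℝ => M.loss θ (M.predictor (are n x) x)) (M.pastLaw θ n) ∧
      Integrable (fun x : Fin n → ℝ => M.loss θ (M.predictor (oracle n x) x))
        (M.pastLaw θ n) := by
    filter_upwards [hare, horacle, hD, eventually_gt_atTop 0] with n h1 h2 ⟨_, h3, _⟩ hn
    constructor
    · refine M.integrable_loss_predictor θ hK hn (M.measurable_loss_predictor θ (hare_meas n))
        (D := logLog n) (E := 0) fun x => ?_
      rw [zero_mul, add_zero]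
      exact C.abs_le_of_mem_gridLoc h3 (PredModel.candidateLoc_subset (h1 x).1.1)
    · refine M.integrable_loss_predictor θ hK hn (M.measurable_loss_oracle θ hK hc hn h2)
        (D := 0) (E := 1 / c) fun x => ?_
      rw [zero_add, one_div_mul_eq_div, le_div_iff₀ hc0, mul_comm]
      exact hc.mul_abs_le hn (h2 x).1.1
  refine ⟨hint, ?_⟩
  set F := 8 * K * (2 + (2 + 3 * K ^ 2) / c) / c with hF
  set G := 4 * K * D + 2 * K ^ 2 * D * (c + 1 + K ^ 2) + F * K with hG
  -- The first term is the estimation error summed over the grid. The second collects rounding and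
  -- the contribution of large samples, both of order `1 / a_n`.
  have hlim : Tendsto (fun n : ℕ => 2 * D * E * (logLog n ^ 4 / √√(Real.log n)) + G / logLog n)
      atTop (𝓝 0) := by
    simpa using (tendsto_logLog_pow_div.const_mul (2 * D * E)).add
      (tendsto_logLog.const_div_atTop G)
  refine squeeze_zero_norm' ?_ hlim
  filter_upwards [hint, hare, horacle, hD, hE, hB, eventually_gt_atTop 0,
    tendsto_logLog.eventually_ge_atTop (2 * B / c)]
    with n ⟨i1, i2⟩ hp hp' ⟨ha, hl, hs, hl2, hs2, hcard⟩ hEn hBn hn hBa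
  have ha0 : 0 < logLog n := by linarith
  have hB2 : 2 * B ≤ c * logLog n := by
    rw [div_le_iff₀ hc0] at hBa
    linarith
  set κ := 4 * K * C.meshLoc n
    + 2 * K ^ 2 * C.meshScale n * (c * logLog n + logLog n + K ^ 2) with hκ
  have hκ0 : 0 ≤ κ := by positivity
  have hF0 : 0 ≤ F := by positivity
  -- One integrable majorant serves both cases: every term is nonnegative, and each case needs only
  -- some of them.
  have hpt : ∀ x : Fin n → ℝ,
      ‖M.loss θ (M.predictor (are n x) x) - M.loss θ (M.predictor (oracle n x) x)‖
        ≤ 2 * M.gridError θ γ C x + (κ + F / logLog n * PredModel.meanSqDev θ x) := by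
    intro x
    have hW := M.gridError_nonneg θ γ (C := C) x
    have hV : 0 ≤ F / logLog n * PredModel.meanSqDev θ x :=
      mul_nonneg (by positivity) (PredModel.meanSqDev_nonneg θ x)
    rw [Real.norm_eq_abs]
    rcases le_or_gt (avgAbs x) (c * logLog n) with hx | hx
    · have := M.abs_loss_choice_sub_oracle_le θ γ hK hc hn hl hs (hp x) (hp' x) hx
      linarith
    · have := M.abs_loss_choice_sub_oracle_le_of_lt θ γ hK hc hn hl ha (hp x) (hp' x) hBn hB2 hx
      linarith
  have hgi : ∀ p ∈ C.gridFinset n,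
      Integrable (fun x : Fin n → ℝ => |M.areD γ x p - M.loss θ (M.predictor p x)|)
        (M.pastLaw θ n) := fun p h => (hEn p (C.ne_top_of_mem_gridFinset h)).1
  have hWi : Integrable (fun x : Fin n → ℝ => M.gridError θ γ C x) (M.pastLaw θ n) :=
    integrable_finsetSum _ hgi
  have hW : ∫ x : Fin n → ℝ, M.gridError θ γ C x ∂(M.pastLaw θ n)
      ≤ D * logLog n ^ 4 * (E / √√(Real.log n)) := by
    unfold PredModel.gridError
    rw [integral_finsetSum _ hgi]
    refine (Finset.sum_le_sum fun p h => (hEn p (C.ne_top_of_mem_gridFinset h)).2).trans ?_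
    rw [Finset.sum_const, nsmul_eq_mul]
    exact mul_le_mul_of_nonneg_right hcard (by positivity)
  have hVi := M.integrable_meanSqDev θ (n := n)
  have hV := M.integral_meanSqDev_le θ hK hn
  have hκ2 : κ ≤ (4 * K * D + 2 * K ^ 2 * D * (c + 1 + K ^ 2)) / logLog n := by
    have t1 : c * logLog n + logLog n + K ^ 2 ≤ (c + 1 + K ^ 2) * logLog n := by nlinarith
    calc κ ≤ 4 * K * (D / logLog n)
          + 2 * K ^ 2 * (D / logLog n ^ 2) * ((c + 1 + K ^ 2) * logLog n) := by
            rw [hκ]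
            gcongr
      _ = _ := by field_simp
  rw [PredModel.risk, ← integral_sub i1 i2]
  have j1 : Integrable (fun x : Fin n → ℝ => 2 * M.gridError θ γ C x) (M.pastLaw θ n) :=
    hWi.const_mul 2
  have j2 : Integrable (fun x : Fin n → ℝ => F / logLog n * PredModel.meanSqDev θ x)
      (M.pastLaw θ n) := hVi.const_mul _
  have j3 : Integrable (fun x : Fin n → ℝ => κ + F / logLog n * PredModel.meanSqDev θ x)
      (M.pastLaw θ n) := (integrable_const κ).add j2
  refine (norm_integral_le_of_norm_le (j1.add j3) (Eventually.of_forall hpt)).trans ?_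
  simp only [Pi.add_apply]
  rw [integral_add j1 j3, integral_add (integrable_const κ) j2, integral_const_mul,
    integral_const_mul, integral_const, probReal_univ, one_smul]
  have hV2 : F / logLog n * ∫ x : Fin n → ℝ, PredModel.meanSqDev θ x ∂(M.pastLaw θ n)
      ≤ F * K / logLog n := by
    rw [mul_div_right_comm]
    exact mul_le_mul_of_nonneg_left hV (by positivity)
  have e1 : 2 * D * E * (logLog n ^ 4 / √√(Real.log n)) + G / logLog n
      = 2 * (D * logLog n ^ 4 * (E / √√(Real.log n)))
        + ((4 * K * D + 2 * K ^ 2 * D * (c + 1 + K ^ 2)) / logLog n + F * K / logLog n) := by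
    rw [hG]
    ring
  rw [e1]
  linarith
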